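/- **Theorem.** Let $d\ge 1$, $\mathfrak m>d$, $\sigma\in\mathbb R$, and let $W$ be Gaussian white noise on $\mathbb R^d$, defined on a probability space $\Omega$; write $W(g)=\int g\,dW$ for $g\in L^2(\mathbb R^d)$, so that $\mathbb E\{W(g)W(h)\}=\int gh\,dx$. Let $-P$ be the generator of a strongly continuous semigroup $e^{-tP}$ on $L^2(\mathbb R^d)$ (for instance, $P$ elliptic of order $\mathfrak m$). Let $0<T_*\le\infty$ and suppose that for $0<t<T_*$ the operator $e^{-tP}$ has a distribution kernel $G(t,x;y)=G(t,y;x)$ that is continuous in $(t,x,y)$ and satisfies, with suprema over $t\in(0,T_*)$ and $x,y\in\mathbb R^d$, $$\sup_{t,y}\int_{\mathbb R^d}|G(t,x;y)|\,dx+\sup_{t,y}t^{d/\mathfrak m}\int_{\mathbb R^d}|G(t,x;y)|^2dx+\sup_{t,x,y}t^{d/\mathfrak m}|G(t,x;y)|<\infty .$$ *Notation.* For a Borel function $f$ on $(\mathbb R^d)^n$ put $$\|f\|_n^2=\sum_{\mathfrak p}\int |f\otimes f|(x_1,\dots,x_{2n})\prod_{k\in A_0(\mathfrak p)}\delta(x_k-x_{l(k)})\,dx_k\,dx_{l(k)},$$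 where $\mathfrak p$ runs over the pairings of $\{1,\dots,2n\}$, $A_0(\mathfrak p)$ is the set of smaller elements of the pairs and $l(k)>k$ is the partner of $k\in A_0(\mathfrak p)$. Let $\mathcal B_n$ be the closure of $C_c^\infty((\mathbb R^d)^n)$ for this norm. The iterated Stratonovich integral $\mathcal I_n:\mathcal B_n\to L^2(\Omega)$ is the extension by linearity and density of $\mathcal I_n\big(\prod_{k=1}^n f_k(x_k)\big)=\prod_{k=1}^n W(f_k)$, $f_k\in L^2(\mathbb R^d)$. For a random field given by an expansion $\varphi(y)=\sum_{n\ge0}\mathcal I_n(k_n(y,\cdot))$ with continuous kernels $k_n(y,y_1,\dots,y_n)$, the Stratonovich integral is $\int\varphi(y)\circ dW(y)=\sum_{n\ge0}\mathcal I_{n+1}(k_n)$, where $k_n$ is regarded as a function of the $n+1$ variables $(y,y_1,\dots,y_n)$; both series are required to converge in $L^2(\Omega)$ (the first one for almost every $y$). For such random fields $u(s,y)$ put $$\mathcal H u(t,x)=\sigma\int_0^t\Big(\int_{\mathbb R^d}G(t-s,x;y)\,u(s,y)\circ dW(y)\Big)ds .$$ Let $u_0\in L^1(\mathbb R^d)$,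 let $u_0(t,x)=f_0(t,x)=e^{-tP}u_0(x):=\int G(t,x;\xi)u_0(\xi)\,d\xi$, and for $n\ge0$ $$f_{n+1}(t,x,y_1,\dots,y_{n+1})=\sigma\int_0^tG(t-s,x;y_1)\,f_n(s,y_1,y_2,\dots,y_{n+1})\,ds .$$ Then the following holds. 1. For every $n\ge1$ and $0<t<T_*$, $f_n(t,\cdot)\in L^2(\mathbb R^d;\mathcal B_n)$, and $\sup_{0<t<T}\int\|f_n(t,x,\cdot)\|_n^2\,dx<\infty$ for all finite $T\le T_*$. There are measurable random fields $u_n(t,x)$ with $u_n(t,x)=\mathcal I_n(f_n(t,x,\cdot))$ for all $n\ge0$, $0<t<T_*$ and almost every $x$; they satisfy $u_{n+1}=\mathcal Hu_n$ for $n\ge 0$ and, for $n\ge1$, are bounded in $L^2(\mathbb R^d\times\Omega)$ uniformly in $t\in(0,T)$ for all finite $T\le T_*$. 2. If moreover $u_0\in L^2(\mathbb R^d)$, then the series $u(t)=\sum_{n\ge0}u_n(t)$ converges in $L^2(\mathbb R^d\times\Omega)$, uniformly in $t\in(0,T)$ for all finite $T\le T_*$; its sum is bounded in $L^2(\mathbb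 R^d\times\Omega)$ uniformly in $t\in(0,T)$, and it is a mild solution of $\partial_tu+Pu-\sigma u\circ\dot W=0$, $u(0,\cdot)=u_0$; that is, with the expansion $u(t,x)=\sum_n\mathcal I_n(f_n(t,x,\cdot))$, for every $0<t<T_*$ and almost every $(x,\omega)$, $$u(t,x)=e^{-tP}u_0(x)+\sigma\int_0^t\int_{\mathbb R^d}G(t-s,x;y)\,u(s,y)\circ dW(y)\,ds .$$ 3. For $u_0\in L^1(\mathbb R^d)$ only, $t^{\frac d{2\mathfrak m}}e^{-tP}u_0\in L^2(\mathbb R^d)$, with norm bounded uniformly in $t\in(0,T_*)$. -/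

import Mathlib

open MeasureTheory ProbabilityTheory Filter Topology Set
open scoped ENNReal NNReal

noncomputable section

namespace StratSPDE

/-- The space `ℝ^d` with its Euclidean structure and Lebesgue measure. -/
abbrev E (d : ℕ) : Type := EuclideanSpace ℝ (Fin d)

/-- The real Hilbert space `L²(ℝ^d)`. -/
abbrev L2 (d : ℕ) : Type := Lp ℝ 2 (volume : Measure (E d))

/-! ### Pairings, the norm of `𝓑_n` and the space `𝓑_n` -/

/-- Pairings of `N` objects: involutions `l` without fixed points. -/
abbrev Pairing (N : ℕ) : Type :=
  {l : Equiv.Perm (Fin N) // ∀ i, l (l i) = i ∧ l i ≠ i}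

/-- The set `A₀` of the first (smaller) elements of the pairs of a pairing. -/
abbrev Pairing.A₀ {N : ℕ} (l : Pairing N) : Type := {k : Fin N // k < l.1 k}

/-- The first element of the pair that contains `k`. -/
def Pairing.rep {N : ℕ} (l : Pairing N) (k : Fin N) : l.A₀ :=
  if h : k < l.1 k then ⟨k, h⟩
  else ⟨l.1 k, by
    have h1 := l.2 k
    rw [h1.1]
    exact lt_of_le_of_ne (not_lt.mp h) h1.2⟩

/-- The square of the norm of `𝓑_n`: the sum, over all pairings of `2n` variables, of the integral
of `|f ⊗ f|(x_1, …, x_{2n})` against `∏_{k ∈ A₀} δ(x_k - x_{l(k)}) dx_k dx_{l(k)}`.  The variables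
`z` of integration are the common values of the pairs. -/
def normSqB {d : ℕ} (n : ℕ) (f : (Fin n → E d) → ℝ) : ℝ≥0∞ :=
  ∑ l : Pairing (n + n), ∫⁻ z : l.A₀ → E d,
    ‖f (fun i => z (l.rep (Fin.castAdd n i)))‖ₑ * ‖f (fun i => z (l.rep (Fin.natAdd n i)))‖ₑ

/-- The space `𝓑_n`: Borel functions on `(ℝ^d)^n` in the closure of the smooth compactly supported
functions for the norm of `𝓑_n`.  The norm sees the values of a function on the diagonals. -/
structure MemB {d : ℕ} (n : ℕ) (f : (Fin n → E d) → ℝ) : Prop where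
  measurable : Measurable f
  approx : ∀ ε : ℝ≥0∞, ε ≠ 0 → ∃ φ : (Fin n → E d) → ℝ,
    ContDiff ℝ ((⊤ : ℕ∞) : WithTop ℕ∞) φ ∧ HasCompactSupport φ ∧ normSqB n (f - φ) < ε

/-- The square of the norm of `L²(ℝ^d; 𝓑_n)`. -/
def normSqL2B {d : ℕ} (n : ℕ) (F : E d → (Fin n → E d) → ℝ) : ℝ≥0∞ :=
  ∫⁻ x, normSqB n (F x)

/-- The space `L²(ℝ^d; 𝓑_n)`. -/
structure MemL2B {d : ℕ} (n : ℕ) (F : E d → (Fin n → E d) → ℝ) : Prop where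
  measurable : Measurable (Function.uncurry F)
  memB : ∀ᵐ x, MemB n (F x)
  norm_lt_top : normSqL2B n F < ∞

/-! ### White noise and iterated Stratonovich integrals -/

section Integrals

variable {d : ℕ} {Ω : Type*} [MeasurableSpace Ω] {μ : Measure Ω}

/-- Gaussian white noise on `ℝ^d`, given by `W g = ∫ g dW`: a linear isometry of `L²(ℝ^d)` into
`L²(Ω)` all of whose values are centered Gaussian variables (of variance `‖g‖²`).  By linearity
the family `(W g)_g` is then jointly Gaussian, with covariance `⟪g, h⟫`. -/
def IsWhiteNoise (W : L2 d →ₗᵢ[ℝ] Lp ℝ 2 μ) : Prop :=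
  ∀ g : L2 d, Measure.map (W g) μ = gaussianReal 0 (‖g‖₊ ^ 2)

/-- Finite linear combinations `∑_j c_j ∏_k g_{j,k}(x_k)` of products of functions in `L²(ℝ^d)`. -/
structure SimpleIntegrand (d n : ℕ) : Type where
  len : ℕ
  coeff : Fin len → ℝ
  fac : Fin len → Fin n → L2 d

/-- The function `(x_1, …, x_n) ↦ ∑_j c_j ∏_k g_{j,k}(x_k)`. -/
def SimpleIntegrand.toFun {n : ℕ} (e : SimpleIntegrand d n) (x : Fin n → E d) : ℝ :=
  ∑ j, e.coeff j * ∏ k, (e.fac j k : E d → ℝ) (x k)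

/-- The Stratonovich integral `∑_j c_j ∏_k W(g_{j,k})` of a combination of products. -/
def SimpleIntegrand.integral {n : ℕ} (W : L2 d →ₗᵢ[ℝ] Lp ℝ 2 μ) (e : SimpleIntegrand d n)
    (ω : Ω) : ℝ :=
  ∑ j, e.coeff j * ∏ k, (W (e.fac j k) : Ω → ℝ) ω

/-- `X = 𝓘_n(f)`: the iterated Stratonovich integral, the extension by density of
`𝓘_n(∏ f_k) = ∏ 𝓘_1(f_k)` for the norm of `𝓑_n` (and the norm of `L²(Ω)` on the values). -/
structure IsIteratedIntegral (W : L2 d →ₗᵢ[ℝ] Lp ℝ 2 μ) (n : ℕ) (f : (Fin n → E d) → ℝ)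
    (X : Ω → ℝ) : Prop where
  measurable : Measurable f
  memLp : MemLp X 2 μ
  approx : ∀ ε : ℝ≥0∞, ε ≠ 0 → ∃ e : SimpleIntegrand d n,
    normSqB n (f - e.toFun) < ε ∧ eLpNorm (X - e.integral W) 2 μ < ε

/-- `X = ∑_n 𝓘_n(f_n)`, with convergence in `L²(Ω)`. -/
def HasStratSeries (W : L2 d →ₗᵢ[ℝ] Lp ℝ 2 μ) (f : ∀ n, (Fin n → E d) → ℝ) (X : Ω → ℝ) : Prop :=
  MemLp X 2 μ ∧ ∃ Y : ℕ → Ω → ℝ, (∀ n, IsIteratedIntegral W n (f n) (Y n)) ∧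
    Tendsto (fun N => eLpNorm (X - ∑ n ∈ Finset.range N, Y n) 2 μ) atTop (𝓝 0)

/-- Turns the kernels of a random field `φ(y) = ∑_n 𝓘_n(k_n(y, ·))` into those of
`∫ φ(y) dW(y)`: the point `y` becomes the first variable of a kernel of order `n + 1`. -/
def shift (k : ∀ n : ℕ, E d → (Fin n → E d) → ℝ) : ∀ n : ℕ, (Fin n → E d) → ℝ
  | 0 => fun _ => 0
  | n + 1 => fun y => k n (y 0) (Fin.tail y)

/-- `X = ∫ φ(y) dW(y)` (Stratonovich) for the random field with the expansion
`φ(y) = ∑_n 𝓘_n(k_n(y, ·))` into iterated Stratonovich integrals with continuous kernels: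
the integral is `∑_n 𝓘_{n+1}(k_n)`. -/
structure IsStratIntegral (W : L2 d →ₗᵢ[ℝ] Lp ℝ 2 μ) (k : ∀ n : ℕ, E d → (Fin n → E d) → ℝ)
    (φ : E d → Ω → ℝ) (X : Ω → ℝ) : Prop where
  continuous : ∀ n, Continuous (Function.uncurry (k n))
  expansion : ∀ᵐ y, HasStratSeries W (fun n => k n y) (φ y)
  integral : HasStratSeries W (shift k) X

/-- `w = 𝓗 v(t)`, i.e. `w(x) = σ ∫_0^t ∫ G(t-s,x;y) v(s,y) dW(y) ds` with the inner integral in the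
Stratonovich sense, for the random field `v(s,y) = ∑_n 𝓘_n(k_n(s,y,·))`.  Here `Z s x` is the inner
integral. -/
def IsDuhamelIntegral (W : L2 d →ₗᵢ[ℝ] Lp ℝ 2 μ) (G : ℝ → E d → E d → ℝ) (σ : ℝ)
    (k : ∀ n : ℕ, ℝ → E d → (Fin n → E d) → ℝ) (v : ℝ → E d → Ω → ℝ) (t : ℝ)
    (w : E d → Ω → ℝ) : Prop :=
  ∃ Z : ℝ → E d → Ω → ℝ,
    AEStronglyMeasurable (fun q : ℝ × E d × Ω => Z q.1 q.2.1 q.2.2)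
      ((volume.restrict (Ioo 0 t)).prod (volume.prod μ)) ∧
    (∀ᵐ s ∂(volume.restrict (Ioo 0 t)), ∀ᵐ x,
      IsStratIntegral W (fun n y z => G (t - s) x y * k n s y z)
        (fun y ω => G (t - s) x y * v s y ω) (Z s x)) ∧
    ∀ᵐ q ∂((volume : Measure (E d)).prod μ),
      IntegrableOn (fun s => Z s q.1 q.2) (Ioo 0 t) ∧
        w q.1 q.2 = σ * ∫ s in Ioo 0 t, Z s q.1 q.2

/-- `u`, with expansion `u(t,x) = ∑_n 𝓘_n(k_n(t,x,·))`, is a mild solution of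
`∂_t u + P u - σ u ∘ Ẇ = 0`, `u(0) = u₀`, at the times in `I`: for `t ∈ I`,
`u(t,x) = e^{-tP} u₀(x) + σ ∫_0^t ∫ G(t-s,x;y) u(s,y) ∘ dW(y) ds`.
Here `S t = e^{-tP}` and `G` is its kernel. -/
def IsMildSolution (W : L2 d →ₗᵢ[ℝ] Lp ℝ 2 μ) (S : ℝ → L2 d →L[ℝ] L2 d) (G : ℝ → E d → E d → ℝ)
    (σ : ℝ) (I : Set ℝ) (u₀ : L2 d) (k : ∀ n : ℕ, ℝ → E d → (Fin n → E d) → ℝ)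
    (u : ℝ → E d → Ω → ℝ) : Prop :=
  ∀ t ∈ I, ∃ w : E d → Ω → ℝ, IsDuhamelIntegral W G σ k u t w ∧
    ∀ᵐ q ∂((volume : Measure (E d)).prod μ), u t q.1 q.2 = (S t u₀ : E d → ℝ) q.1 + w q.1 q.2

end Integrals

/-! ### The unperturbed problem and the Duhamel expansion -/

/-- `S t = e^{-tP}`: `S` is a strongly continuous semigroup on `L²(ℝ^d)` with generator `-P`. -/
structure IsSemigroupOf {d : ℕ} (P : L2 d →ₗ.[ℝ] L2 d) (S : ℝ → L2 d →L[ℝ] L2 d) : Prop where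
  zero : S 0 = ContinuousLinearMap.id ℝ (L2 d)
  add : ∀ s t : ℝ, 0 ≤ s → 0 ≤ t → S (s + t) = (S s).comp (S t)
  continuous : ∀ f, Tendsto (fun t => S t f) (𝓝[>] 0) (𝓝 f)
  generator : ∀ f g : L2 d, (f, g) ∈ P.graph ↔
    Tendsto (fun t : ℝ => t⁻¹ • (f - S t f)) (𝓝[>] 0) (𝓝 g)

/-- The times `0 < t < T₀`, where `T₀ ≤ ∞`. -/
def times (T₀ : EReal) : Set ℝ := {t | 0 < t ∧ (t : EReal) < T₀}

/-- `G(t,x;y)` is the distribution kernel of `S t` for `t ∈ I`. -/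
def IsKernelOf {d : ℕ} (S : ℝ → L2 d →L[ℝ] L2 d) (I : Set ℝ) (G : ℝ → E d → E d → ℝ) : Prop :=
  ∀ t ∈ I, ∀ (φ : E d → ℝ) (hφ : MemLp φ 2 volume), ContDiff ℝ ((⊤ : ℕ∞) : WithTop ℕ∞) φ → HasCompactSupport φ →
    ∀ᵐ x, (S t (hφ.toLp φ) : E d → ℝ) x = ∫ y, G t x y * φ y

/-- The bounds on the Green's function: uniformly in `t ∈ I`, bounds on the `L¹` norms, on the
squares of the `L²` norms times `t^{d/𝔪}` and on the `L^∞` norms times `t^{d/𝔪}`. -/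
def GreenBounds {d : ℕ} (m : ℝ) (I : Set ℝ) (G : ℝ → E d → E d → ℝ) : Prop :=
  (⨆ t ∈ I, ⨆ y, ∫⁻ x, ‖G t x y‖ₑ)
    + (⨆ t ∈ I, ⨆ y, ENNReal.ofReal (t ^ ((d : ℝ) / m)) * ∫⁻ x, ‖G t x y‖ₑ ^ 2)
    + (⨆ t ∈ I, ⨆ x, ⨆ y, ENNReal.ofReal (t ^ ((d : ℝ) / m)) * ‖G t x y‖ₑ) < ∞

/-- `(e^{-tP} u₀)(x) = ∫ G(t,x;ξ) u₀(ξ) dξ`, for an integrable function `u₀`. -/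
def freeFlow {d : ℕ} (G : ℝ → E d → E d → ℝ) (u₀ : E d → ℝ) (t : ℝ) (x : E d) : ℝ :=
  ∫ ξ, G t x ξ * u₀ ξ

/-- The kernels `f_n(t,x,y_1,…,y_n)` of the Duhamel expansion: `f_0(t,x) = e^{-tP} u₀(x)` and
`f_{n+1}(t,x,y_1,…,y_{n+1}) = σ ∫_0^t G(t-s,x;y_1) f_n(s,y_1,y_2,…,y_{n+1}) ds`. -/
def duhamelKernel {d : ℕ} (G : ℝ → E d → E d → ℝ) (σ : ℝ) (u₀ : E d → ℝ) :
    ∀ n : ℕ, ℝ → E d → (Fin n → E d) → ℝ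
  | 0 => fun t x _ => freeFlow G u₀ t x
  | n + 1 => fun t x y =>
      σ * ∫ s in (0 : ℝ)..t, G (t - s) x (y 0) * duhamelKernel G σ u₀ n s (y 0) (Fin.tail y)

end StratSPDE

end

open StratSPDE

set_option linter.unusedSectionVars false

open MeasureTheory ProbabilityTheory Filter Topology Set
open scoped ENNReal NNReal

noncomputable section

namespace StratSPDE

/-! ### Polarization and Wick's formula -/

section Polarization

variable {ι V : Type*} [Fintype ι] [DecidableEq ι] [AddCommGroup V] [Module ℝ V]

/-! The proof has two halves: an L² theory of iterated Stratonovich integrals in which only the norm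
of `𝓑_n` enters, and an estimate of that norm for the Duhamel kernels.

L² theory. By Wick's formula (`IsWhiteNoise.integral_prod`) the second moment of the integral of a
combination of products is a sum over pairings of integrals of e ⊗ e over diagonals, hence at most
`normSqB` (`SimpleIntegrand.enorm_toLp_sq_le`). Continuous kernels of finite norm are reached from
step functions by two dominated limits, first in the grid and then in the radius of a ball; this
defines `stratLp`, with the same bound (`enorm_stratLp_sq_le`). On nonnegative combinations of
products the bilinear form `pairB` is an expectation of a product, so 2XY ≤ X² + Y² makes mixed
terms finite (`pairB_box_lt_top`). This is what allows dominated convergence to show that `stratLp`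
is the iterated integral and that the kernels lie in `𝓑_n`. Since integrals of step functions are
finite combinations of point values, `stratLp` commutes with integrals over parameters
(`integral_stratLp`).

Kernel estimate. Iterating the recursion bounds |f_n| by an integral, over the gaps between times,
of n Green's functions along a path, followed by the free flow (`GreenKernel.enorm_kern_le`). In the
square of the norm, two such paths start at x and their 2n further points are glued in pairs. Go
back along the first path and forth along the second: a step to a new point is integrated and costs
a constant, a step to a visited point is bounded by the supremum and costs r^{-α} with α = d/m < 1
(`exists_flags`). Of the 2n+2 factors, n+2 cost a supremum for fixed x, and n+1 when x is integrated
as well. The time integrals are Dirichlet integrals: a path with f suprema gives t^{a-1}/Γ(a), a =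
n+1-αf. Up to geometric factors the two Gamma functions yield n^{-(2-α)n}, against at most n^n for
the (2n-1)!! pairings; n^{-(1-α)n} remains (`le_superExp`). So the norms are summable in n, at fixed
(t,x) and, for n ≥ 1, in L²(ℝ^d; `𝓑_n`) uniformly over bounded times.

Conclusion. Exchanging the integral over s with `stratLp` and with the sum over n gives Duhamel's
formula, both for a single term and for the whole series (`GreenKernel.isDuhamelIntegral`). The term
n = 0 is deterministic: Schur's test bounds it for data in L², and the product of its L¹ and L^∞
bounds for data in L¹. Statements for almost every (x,ω) come from jointly measurable versions of
L²(Ω)-valued functions (`exists_joint_version`). -/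

lemma sum_signs_eq_zero {φ : ι → ι} (hφ : ¬ Function.Surjective φ) :
    ∑ ε : ι → ℤˣ, (∏ i, (((ε i : ℤˣ) : ℤ) : ℝ)) * ∏ i, (((ε (φ i) : ℤˣ) : ℤ) : ℝ) = 0 := by
  obtain ⟨j, hj⟩ : ∃ j, ∀ i, φ i ≠ j := by
    simpa [Function.Surjective] using hφ
  -- Flipping the sign at an index `j` that `φ` misses changes only the first product, so the sum
  -- equals its own negative.
  obtain ⟨δ, hδ, hδ'⟩ : ∃ δ : ι → ℤˣ, δ j = -1 ∧ ∀ i, i ≠ j → δ i = 1 :=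
    ⟨Function.update (fun _ => 1) j (-1), by simp, fun i hi => by simp [hi]⟩
  have h1 : ∏ i, (((δ i : ℤˣ) : ℤ) : ℝ) = -1 := by
    rw [Finset.prod_eq_single j (fun b _ hb => by simp [hδ' b hb]) (by simp), hδ]
    simp
  obtain ⟨F, hF⟩ : ∃ F : (ι → ℤˣ) → ℝ, ∀ ε, F ε =
    (∏ i, (((ε i : ℤˣ) : ℤ) : ℝ)) * ∏ i, (((ε (φ i) : ℤˣ) : ℤ) : ℝ) := ⟨_, fun _ => rfl⟩
  have h : ∀ ε, F (ε * δ) = - F ε := by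
    intro ε
    simp only [hF, Pi.mul_apply, Units.val_mul, Int.cast_mul, Finset.prod_mul_distrib, h1,
      hδ' _ (hj _), mul_one, mul_neg, neg_mul]
  have h3 : ∑ ε, F ε = ∑ ε, F (ε * δ) :=
    (Equiv.sum_comp (Equiv.mulRight δ) F).symm
  simp only [h, Finset.sum_neg_distrib] at h3
  simp only [← hF]
  exact self_eq_neg.mp h3

/-- A symmetric multilinear form that vanishes on the diagonal vanishes. -/
lemma MultilinearMap.eq_zero_of_symmetric_of_diag
    (f : MultilinearMap ℝ (fun _ : ι => V) ℝ)
    (hsymm : ∀ (τ : Equiv.Perm ι) (v : ι → V), f (fun i => v (τ i)) = f v)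
    (hdiag : ∀ v : V, f (fun _ => v) = 0) (v : ι → V) : f v = 0 := by
  -- Polarization: the diagonal values at the signed sums of the `v j` are weighted by the product
  -- of the signs. After expansion only the bijective index maps survive the sum over signs, and by
  -- symmetry each contributes the same multiple of `f v`.
  have h0 : ∑ ε : ι → ℤˣ, (∏ i, (((ε i : ℤˣ) : ℤ) : ℝ)) *
      f (fun _ => ∑ j, (((ε j : ℤˣ) : ℤ) : ℝ) • v j) = 0 :=
    Finset.sum_eq_zero fun ε _ => by rw [hdiag, mul_zero]
  have h1 : ∀ ε : ι → ℤˣ, f (fun _ => ∑ j, (((ε j : ℤˣ) : ℤ) : ℝ) • v j)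
      = ∑ φ : ι → ι, (∏ i, (((ε (φ i) : ℤˣ) : ℤ) : ℝ)) * f (fun i => v (φ i)) := by
    intro ε
    rw [f.map_sum (fun _ j => (((ε j : ℤˣ) : ℤ) : ℝ) • v j)]
    refine Finset.sum_congr rfl fun φ _ => ?_
    rw [f.map_smul_univ, smul_eq_mul]
  simp only [h1, Finset.mul_sum] at h0
  rw [Finset.sum_comm] at h0
  have h2 : ∀ φ : ι → ι, ∑ ε : ι → ℤˣ, (∏ i, (((ε i : ℤˣ) : ℤ) : ℝ)) *
      ((∏ i, (((ε (φ i) : ℤˣ) : ℤ) : ℝ)) * f (fun i => v (φ i)))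
      = if Function.Bijective φ then (Fintype.card (ι → ℤˣ) : ℝ) * f v else 0 := by
    intro φ
    split_ifs with hφ
    · have h3 : ∀ ε : ι → ℤˣ, (∏ i, (((ε i : ℤˣ) : ℤ) : ℝ)) *
          ((∏ i, (((ε (φ i) : ℤˣ) : ℤ) : ℝ)) * f (fun i => v (φ i))) = f v := by
        intro ε
        have h4 : ∏ i, (((ε (φ i) : ℤˣ) : ℤ) : ℝ) = ∏ i, (((ε i : ℤˣ) : ℤ) : ℝ) :=
          hφ.prod_comp (fun i => (((ε i : ℤˣ) : ℤ) : ℝ))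
        have h5 := hsymm (Equiv.ofBijective φ hφ) v
        simp only [Equiv.ofBijective_apply] at h5
        rw [h4, h5, ← mul_assoc, ← Finset.prod_mul_distrib]
        have h6 : ∀ i, (((ε i : ℤˣ) : ℤ) : ℝ) * (((ε i : ℤˣ) : ℤ) : ℝ) = 1 := by
          intro i
          rw [← Int.cast_mul, ← Units.val_mul, Int.units_mul_self]
          simp
        simp [h6]
      simp only [h3, Finset.sum_const, Finset.card_univ, nsmul_eq_mul]
    · have h3 : ¬ Function.Surjective φ := fun hs => hφ (Finite.surjective_iff_bijective.mp hs)
      simp only [← mul_assoc]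
      rw [← Finset.sum_mul, sum_signs_eq_zero h3, zero_mul]
  simp only [h2] at h0
  rw [← Finset.sum_filter, Finset.sum_const, nsmul_eq_mul] at h0
  have hc : (0 : ℝ) < (Finset.univ.filter fun φ : ι → ι => Function.Bijective φ).card := by
    rw [Nat.cast_pos, Finset.card_pos]
    exact ⟨id, by simp⟩
  have hc' : (0 : ℝ) < (Fintype.card (ι → ℤˣ) : ℝ) := by
    rw [Nat.cast_pos]; exact Fintype.card_pos
  rcases mul_eq_zero.mp h0 with h | h
  · exact absurd h hc.ne'
  · rcases mul_eq_zero.mp h with h | h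
    · exact absurd h hc'.ne'
    · exact h

end Polarization

/-! ### Combinatorics of pairings. -/

namespace Pairing

variable {N : ℕ} (l : Pairing N)

lemma invol (i : Fin N) : l.1 (l.1 i) = i := (l.2 i).1

lemma apply_ne (i : Fin N) : l.1 i ≠ i := (l.2 i).2

lemma rep_val (k : Fin N) : (l.rep k : Fin N) = k ∨ (l.rep k : Fin N) = l.1 k := by
  unfold rep
  split_ifs
  · exact Or.inl rfl
  · exact Or.inr rfl

lemma rep_coe (k : l.A₀) : l.rep k = k := by
  unfold rep
  rw [dif_pos k.2]

lemma rep_apply (k : Fin N) : l.rep (l.1 k) = l.rep k := by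
  unfold rep
  have h := l.invol k
  have h' := l.apply_ne k
  by_cases h1 : k < l.1 k
  · rw [dif_pos h1, dif_neg (by rw [h]; exact not_lt.mpr h1.le)]
    exact Subtype.ext h
  · have h2 : l.1 k < k := lt_of_le_of_ne (not_lt.mp h1) h'
    rw [dif_neg h1, dif_pos (by rw [h]; exact h2)]

lemma rep_surjective : Function.Surjective l.rep := fun k => ⟨k, l.rep_coe k⟩

lemma apply_rep_val (b : Fin N → ℝ) (hb : ∀ i, b (l.1 i) = b i) (k : Fin N) :
    b (l.rep k) = b k := by
  rcases l.rep_val k with h | h <;> rw [h]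
  exact hb k

/-- The pairing obtained by relabelling. -/
def conj (τ : Equiv.Perm (Fin N)) : Pairing N :=
  ⟨τ * l.1 * τ⁻¹, fun i => by
    refine ⟨by simp [l.invol], fun h => l.apply_ne (τ⁻¹ i) ?_⟩
    apply τ.injective
    simpa using h⟩

lemma conj_apply (τ : Equiv.Perm (Fin N)) (i : Fin N) : (l.conj τ).1 (τ i) = τ (l.1 i) := by
  simp [conj]

/-- Relabelling acts on pairings. -/
def conjEquiv (τ : Equiv.Perm (Fin N)) : Pairing N ≃ Pairing N where
  toFun l := l.conj τ
  invFun l := l.conj τ⁻¹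
  left_inv l := by
    apply Subtype.ext; ext i; simp [conj]
  right_inv l := by
    apply Subtype.ext; ext i; simp [conj]

/-- Relabelling may turn the smaller element of a pair into the larger one. As `b` is constant on
the pairs, the choice of representative does not matter. -/
lemma prod_conj (τ : Equiv.Perm (Fin N)) (b : Fin N → ℝ)
    (hb : ∀ i, b ((l.conj τ).1 i) = b i) :
    ∏ k : (l.conj τ).A₀, b k = ∏ k : l.A₀, b (τ k) := by
  symm
  refine Fintype.prod_bijective (fun k : l.A₀ => (l.conj τ).rep (τ k)) ⟨?_, ?_⟩ _ _ ?_
  · intro k k' h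
    simp only at h
    have h1 : ∀ k : l.A₀, l.rep (τ⁻¹ ((l.conj τ).rep (τ k))) = k := by
      intro k
      rcases (l.conj τ).rep_val (τ k) with h | h
      · rw [h, Equiv.Perm.coe_inv, Equiv.symm_apply_apply, l.rep_coe]
      · rw [h, conj_apply, Equiv.Perm.coe_inv, Equiv.symm_apply_apply, l.rep_apply, l.rep_coe]
    rw [← h1 k, h, h1 k']
  · intro m
    refine ⟨l.rep (τ⁻¹ m), ?_⟩
    rcases l.rep_val (τ⁻¹ m) with h | h
    · simp only [h]
      rw [Equiv.Perm.coe_inv, Equiv.apply_symm_apply, rep_coe]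
    · simp only [h]
      rw [← conj_apply, Equiv.Perm.coe_inv, Equiv.apply_symm_apply, rep_apply, rep_coe]
  · intro k
    exact ((l.conj τ).apply_rep_val b hb _).symm

/-- The first elements and their partners exhaust the paired objects. -/
def sumEquiv : l.A₀ ⊕ l.A₀ ≃ Fin N where
  toFun := Sum.elim (fun k => k) (fun k => l.1 k)
  invFun i := if h : i < l.1 i then Sum.inl ⟨i, h⟩ else Sum.inr (l.rep i)
  left_inv := by
    rintro (k | k)
    · simp [k.2]
    · have : ¬ (l.1 k < l.1 (l.1 k)) := by rw [l.invol]; exact not_lt.mpr k.2.le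
      simp [this, l.rep_apply, l.rep_coe]
  right_inv i := by
    by_cases h : i < l.1 i
    · simp [h]
    · simp only [h, dite_false, Sum.elim_inr]
      rcases l.rep_val i with h' | h'
      · exact absurd (h' ▸ (l.rep i).2) h
      · rw [h', l.invol]

lemma prod_eq_prod_pairs {M : Type*} [CommMonoid M] (b : Fin N → M) :
    ∏ i, b i = ∏ k : l.A₀, b k * b (l.1 k) := by
  rw [← l.sumEquiv.prod_comp, Fintype.prod_sum_type, Finset.prod_mul_distrib]
  rfl

lemma two_mul_card_A₀ : 2 * Fintype.card l.A₀ = N := by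
  have h := Fintype.card_congr l.sumEquiv
  rw [Fintype.card_sum, Fintype.card_fin] at h
  omega

lemma card_A₀ {n : ℕ} (l : Pairing (n + n)) : Fintype.card l.A₀ = n := by
  have := l.two_mul_card_A₀
  omega

lemma rep_partner (k : l.A₀) : l.rep (l.1 k) = k := by rw [rep_apply, rep_coe]

end Pairing


/-! ### The number of pairings and the even Gaussian moments. -/

lemma isPairing_iff_cycleType {n : ℕ} (g : Equiv.Perm (Fin (n + n))) :
    (∀ i, g (g i) = i ∧ g i ≠ i) ↔ g.cycleType = Multiset.replicate n 2 := by
  constructor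
  · intro h
    have h2 : g ^ 2 = 1 := by
      ext i; simp [pow_two, (h i).1]
    have hs : g.support = Finset.univ := by
      ext i; simp [(h i).2]
    have hall : ∀ m ∈ g.cycleType, m = 2 := by
      intro m hm
      have h3 : m ∣ 2 := (Equiv.Perm.dvd_of_mem_cycleType hm).trans (orderOf_dvd_of_pow_eq_one h2)
      have h4 := Equiv.Perm.two_le_of_mem_cycleType hm
      exact le_antisymm (Nat.le_of_dvd two_pos h3) h4
    have h5 := Multiset.eq_replicate_card.mpr hall
    have h6 := g.sum_cycleType
    rw [h5, hs, Multiset.sum_replicate, Finset.card_univ, Fintype.card_fin, smul_eq_mul] at h6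
    rw [h5]
    congr 1
    omega
  · intro h i
    have hs : g.support = Finset.univ := by
      rw [← Finset.card_eq_iff_eq_univ, ← g.sum_cycleType, h]
      simp [mul_two]
    have ho : orderOf g ∣ 2 := by
      rw [← Equiv.Perm.lcm_cycleType, h, Multiset.lcm_dvd]
      intro b hb
      rw [Multiset.eq_of_mem_replicate hb]
    have h2 : g ^ 2 = 1 := orderOf_dvd_iff_pow_eq_one.mp ho
    refine ⟨?_, ?_⟩
    · have := congrArg (fun e : Equiv.Perm (Fin (n + n)) => e i) h2
      simpa [pow_two] using this
    · rw [← Equiv.Perm.mem_support, hs]; simp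

-- Pairings are the permutations of cycle type 2^n, so their number times 2^n n! is (2n)!. Dividing
-- by (2n)!! = 2^n n! leaves (2n-1)!!.
open scoped Nat in
lemma card_pairing (n : ℕ) : Fintype.card (Pairing (n + n)) = (2 * n - 1)‼ := by
  have h1 : Fintype.card (Pairing (n + n)) = (Finset.univ.filter fun g : Equiv.Perm (Fin (n + n)) =>
      g.cycleType = Multiset.replicate n 2).card := by
    rw [Fintype.card_subtype]
    congr 1
    ext g
    simp only [Finset.mem_filter, Finset.mem_univ, true_and]
    exact isPairing_iff_cycleType g
  have h2 := Equiv.Perm.card_of_cycleType_mul_eq (Fin (n + n)) (Multiset.replicate n 2)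
  rw [← h1, if_pos ⟨by simp [mul_two], fun a ha => (Multiset.eq_of_mem_replicate ha).ge⟩] at h2
  simp only [Fintype.card_fin, Multiset.sum_replicate, smul_eq_mul, mul_two, Nat.sub_self,
    Nat.factorial_zero, one_mul, Multiset.prod_replicate] at h2
  rcases Nat.eq_zero_or_pos n with rfl | hn
  · simpa using h2
  · rw [Multiset.toFinset_replicate, if_neg hn.ne', Finset.prod_singleton,
      Multiset.count_replicate_self] at h2
    obtain ⟨k, rfl⟩ : ∃ k, n = k + 1 := ⟨n - 1, by omega⟩
    have h3 : (k + 1 + (k + 1))! = (2 * (k + 1))‼ * (2 * (k + 1) - 1)‼ := by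
      have : 2 * (k + 1) - 1 = 2 * k + 1 := by omega
      rw [this, show k + 1 + (k + 1) = (2 * k + 1) + 1 by ring, Nat.factorial_eq_mul_doubleFactorial]
      rfl
    rw [h3, Nat.doubleFactorial_two_mul, mul_comm] at h2
    exact Nat.eq_of_mul_eq_mul_left (by positivity) h2

/-- For unit variance the moment is a value of Γ at n + 1/2, which contains the double factorial;
scaling gives the general variance. -/
lemma integral_pow_gaussianReal (n : ℕ) (v : ℝ≥0) :
    ∫ x, x ^ (n + n) ∂(gaussianReal 0 v) = (Fintype.card (Pairing (n + n)) : ℝ) * (v : ℝ) ^ n := by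
  have hstd : ∫ x, x ^ (n + n) ∂(gaussianReal 0 1) = (Fintype.card (Pairing (n + n)) : ℝ) := by
    rw [integral_gaussianReal_eq_integral_smul one_ne_zero]
    have h1 : ∀ x : ℝ, gaussianPDFReal 0 1 x • x ^ (n + n)
        = (√(2 * Real.pi))⁻¹ * ((fun y : ℝ => y ^ (2 * n : ℝ) * Real.exp (-(1 / 2) * y ^ (2 : ℝ))) |x|) := by
      intro x
      have e1 : |x| ^ (2 * n : ℝ) = x ^ (n + n) := by
        rw [show (2 * n : ℝ) = ((2 * n : ℕ) : ℝ) by push_cast; ring, Real.rpow_natCast, pow_mul,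
          sq_abs, ← pow_mul, two_mul]
      simp only [gaussianPDFReal, e1, smul_eq_mul]
      have e2 : |x| ^ (2 : ℝ) = x ^ 2 := by
        rw [Real.rpow_two, sq_abs]
      rw [e2]
      have e3 : -(x - 0) ^ 2 / (2 * ((1 : ℝ≥0) : ℝ)) = -(1 / 2) * x ^ 2 := by
        push_cast; ring
      rw [e3]
      push_cast
      ring_nf
    simp only [h1]
    rw [integral_const_mul,
      integral_comp_abs (f := fun y : ℝ => y ^ (2 * n : ℝ) * Real.exp (-(1 / 2) * y ^ (2 : ℝ))),
      integral_rpow_mul_exp_neg_mul_rpow (by norm_num) (by linarith [(Nat.cast_nonneg n : (0:ℝ) ≤ n)])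
        (by norm_num), show ((2 * n + 1) / 2 : ℝ) = n + 1 / 2 by ring, Real.Gamma_nat_add_half,
        card_pairing]
    have e4 : (1 / 2 : ℝ) ^ (-(2 * n + 1) / 2 : ℝ) = 2 ^ n * √2 := by
      rw [one_div, Real.inv_rpow (by norm_num), ← Real.rpow_neg (by norm_num),
        show -(-(2 * n + 1) / 2 : ℝ) = n + 1 / 2 by ring, Real.rpow_add (by norm_num),
        Real.rpow_natCast, Real.sqrt_eq_rpow]
    rw [e4, Real.sqrt_mul (by norm_num)]
    have := Real.sqrt_pos.mpr Real.pi_pos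
    have h2 : (0 : ℝ) < √2 := by positivity
    field_simp
  have hmap : gaussianReal 0 v = (gaussianReal 0 1).map (fun x => √(v : ℝ) * x) := by
    rw [gaussianReal_map_const_mul]
    congr 1
    · simp
    · ext
      simp
  rw [hmap, integral_map (by fun_prop) (by fun_prop)]
  simp only [mul_pow]
  rw [integral_const_mul, hstd, ← two_mul, pow_mul, Real.sq_sqrt v.coe_nonneg, mul_comm]

/-! ### Wick's formula for white noise. -/

section Wick

variable {d : ℕ} {Ω : Type*} [MeasurableSpace Ω] {μ : Measure Ω} [IsProbabilityMeasure μ]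
  {W : L2 d →ₗᵢ[ℝ] Lp ℝ 2 μ}

lemma IsWhiteNoise.memLp (hW : IsWhiteNoise W) (g : L2 d) {p : ℝ≥0∞} (hp : p ≠ ∞) :
    MemLp (W g : Ω → ℝ) p μ := by
  have h := memLp_id_gaussianReal' (μ := 0) (v := ‖g‖₊ ^ 2) p hp
  rw [← hW g, memLp_map_measure_iff (by fun_prop) (Lp.aestronglyMeasurable _).aemeasurable] at h
  exact h

/-- Hölder's inequality with exponents 2p and 2p in each step; this is why the induction is over all
`p` at once. -/
lemma IsWhiteNoise.memLp_prod (hW : IsWhiteNoise W) {ι : Type*} (s : Finset ι) (g : ι → L2 d)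
    {p : ℝ≥0∞} (hp : p ≠ ∞) : MemLp (fun ω => ∏ i ∈ s, (W (g i) : Ω → ℝ) ω) p μ := by
  classical
  induction s using Finset.induction_on generalizing p with
  | empty => simpa using memLp_const (1 : ℝ)
  | insert a s ha ih =>
    simp only [Finset.prod_insert ha]
    exact MemLp.mul (p := 2 * p) (q := 2 * p) (r := p) (hpqr := ⟨by
      rw [ENNReal.mul_inv (by simp) (by simp), ← add_mul, ENNReal.inv_two_add_inv_two, one_mul]⟩)
      (ih (by finiteness)) (hW.memLp _ (by finiteness))

lemma IsWhiteNoise.integral_pow (hW : IsWhiteNoise W) (g : L2 d) (n : ℕ) :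
    ∫ ω, (W g : Ω → ℝ) ω ^ (n + n) ∂μ = (Fintype.card (Pairing (n + n)) : ℝ) * (‖g‖ ^ 2) ^ n := by
  have h := integral_pow_gaussianReal n (‖g‖₊ ^ 2)
  rw [← hW g, integral_map (Lp.aestronglyMeasurable _).aemeasurable (by fun_prop)] at h
  simpa using h

/-- The expectation of a product of values of white noise, as a multilinear form. -/
def expectProd (hW : IsWhiteNoise W) (N : ℕ) : MultilinearMap ℝ (fun _ : Fin N => L2 d) ℝ where
  toFun g := ∫ ω, ∏ i, (W (g i) : Ω → ℝ) ω ∂μ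
  map_update_add' {inst} g i x y := by
    have hinst : inst = instDecidableEqFin N := Subsingleton.elim _ _
    subst hinst
    have key : ∀ z : L2 d, ∀ ω, ∏ j, (W (Function.update g i z j) : Ω → ℝ) ω
        = (W z : Ω → ℝ) ω * ∏ j ∈ Finset.univ \ {i}, (W (g j) : Ω → ℝ) ω := by
      intro z ω
      rw [← Finset.prod_update_of_mem (Finset.mem_univ i)
        (fun j => (W (g j) : Ω → ℝ) ω) ((W z : Ω → ℝ) ω)]
      refine Finset.prod_congr rfl fun j _ => ?_
      by_cases h : j = i
      · subst h; simp
      · simp [h]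
    have hint : ∀ z : L2 d, Integrable
        (fun ω => (W z : Ω → ℝ) ω * ∏ j ∈ Finset.univ \ {i}, (W (g j) : Ω → ℝ) ω) μ := by
      intro z
      exact (hW.memLp z (p := 2) (by simp)).integrable_mul (hW.memLp_prod _ g (p := 2) (by simp))
    simp only [key]
    rw [← integral_add (hint x) (hint y)]
    refine integral_congr_ae ?_
    rw [map_add]
    filter_upwards [Lp.coeFn_add (W x) (W y)] with ω hω
    rw [hω, Pi.add_apply, add_mul]
  map_update_smul' {inst} g i c x := by
    have hinst : inst = instDecidableEqFin N := Subsingleton.elim _ _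
    subst hinst
    have key : ∀ z : L2 d, ∀ ω, ∏ j, (W (Function.update g i z j) : Ω → ℝ) ω
        = (W z : Ω → ℝ) ω * ∏ j ∈ Finset.univ \ {i}, (W (g j) : Ω → ℝ) ω := by
      intro z ω
      rw [← Finset.prod_update_of_mem (Finset.mem_univ i)
        (fun j => (W (g j) : Ω → ℝ) ω) ((W z : Ω → ℝ) ω)]
      refine Finset.prod_congr rfl fun j _ => ?_
      by_cases h : j = i
      · subst h; simp
      · simp [h]
    simp only [key]
    rw [smul_eq_mul, ← integral_const_mul]
    refine integral_congr_ae ?_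
    rw [map_smul]
    filter_upwards [Lp.coeFn_smul c (W x)] with ω hω
    rw [hω, Pi.smul_apply, smul_eq_mul, mul_assoc]

/-- Exactly one pair contains `i`. Isolating its inner product makes the linearity of each term in
the slot `i` visible. -/
lemma Pairing.prod_inner_update {N : ℕ} (l : Pairing N) (g : Fin N → L2 d) (i : Fin N) (x : L2 d) :
    ∏ k : l.A₀, inner ℝ (Function.update g i x k) (Function.update g i x (l.1 k))
      = inner ℝ x (g (l.1 i)) *
        ∏ k ∈ Finset.univ \ {l.rep i}, inner ℝ (g (k : l.A₀)) (g (l.1 k)) := by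
  rw [Finset.prod_eq_mul_prod_sdiff_singleton_of_mem (Finset.mem_univ (l.rep i))]
  congr 1
  · rcases l.rep_val i with h | h
    · rw [h, Function.update_self, Function.update_of_ne (l.apply_ne i)]
    · rw [h, l.invol, Function.update_self, Function.update_of_ne (l.apply_ne i), real_inner_comm]
  · refine Finset.prod_congr rfl fun k hk => ?_
    have hk' : k ≠ l.rep i := by simpa using hk
    have h1 : (k : Fin N) ≠ i := fun h => hk' (by rw [← h, l.rep_coe])
    have h2 : l.1 k ≠ i := fun h => hk' (by rw [← h, l.rep_apply, l.rep_coe])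
    rw [Function.update_of_ne h1, Function.update_of_ne h2]

/-- The sum over pairings of the products of the inner products of the pairs. -/
def pairingForm (d N : ℕ) : MultilinearMap ℝ (fun _ : Fin N => L2 d) ℝ where
  toFun g := ∑ l : Pairing N, ∏ k : l.A₀, inner ℝ (g k) (g (l.1 k))
  map_update_add' {inst} g i x y := by
    have hinst : inst = instDecidableEqFin N := Subsingleton.elim _ _
    subst hinst
    simp only [Pairing.prod_inner_update, inner_add_left, add_mul, Finset.sum_add_distrib]
  map_update_smul' {inst} g i c x := by
    have hinst : inst = instDecidableEqFin N := Subsingleton.elim _ _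
    subst hinst
    simp only [Pairing.prod_inner_update, real_inner_smul_left, mul_assoc, ← Finset.mul_sum,
      smul_eq_mul]

/-- **Wick's formula** for white noise. -/
theorem IsWhiteNoise.integral_prod (hW : IsWhiteNoise W) {n : ℕ} (g : Fin (n + n) → L2 d) :
    ∫ ω, ∏ i, (W (g i) : Ω → ℝ) ω ∂μ
      = ∑ l : Pairing (n + n), ∏ k : l.A₀, inner ℝ (g k) (g (l.1 k)) := by
  -- Both sides are symmetric multilinear forms, so it suffices to compare them on the diagonal,
  -- where the identity is the formula for the even Gaussian moments.
  have h := MultilinearMap.eq_zero_of_symmetric_of_diag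
    (expectProd hW (n + n) - pairingForm d (n + n)) ?_ ?_ g
  · rw [sub_apply, sub_eq_zero] at h
    exact h
  · intro τ v
    rw [sub_apply, sub_apply]
    congr 1
    · exact integral_congr_ae (ae_of_all _ fun ω => Equiv.prod_comp τ fun i => (W (v i) : Ω → ℝ) ω)
    · change ∑ l : Pairing (n + n), ∏ k : l.A₀, inner ℝ (v (τ k)) (v (τ (l.1 k)))
        = ∑ l : Pairing (n + n), ∏ k : l.A₀, inner ℝ (v k) (v (l.1 k))
      refine Fintype.sum_equiv (Pairing.conjEquiv τ) _ _ fun l => ?_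
      change _ = ∏ k : (l.conj τ).A₀, inner ℝ (v k) (v ((l.conj τ).1 k))
      rw [l.prod_conj τ (fun i => inner ℝ (v i) (v ((l.conj τ).1 i)))
        (fun i => by rw [(l.conj τ).invol, real_inner_comm])]
      simp only [Pairing.conj_apply]
  · intro v
    rw [sub_apply, sub_eq_zero]
    change ∫ ω, ∏ i : Fin (n + n), (W v : Ω → ℝ) ω ∂μ
      = ∑ l : Pairing (n + n), ∏ k : l.A₀, inner ℝ v v
    simp only [Finset.prod_const, Finset.card_univ, Fintype.card_fin, hW.integral_pow,
      Pairing.card_A₀, real_inner_self_eq_norm_sq, Finset.sum_const, nsmul_eq_mul]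

end Wick

/-! ### The norm of `𝓑_n` -/

section PairB

variable {d n : ℕ}

/-- The first `n` of the `2n` variables of a paired configuration. -/
def Pairing.left (l : Pairing (n + n)) (z : l.A₀ → E d) : Fin n → E d :=
  fun i => z (l.rep (Fin.castAdd n i))

/-- The last `n` of the `2n` variables of a paired configuration. -/
def Pairing.right (l : Pairing (n + n)) (z : l.A₀ → E d) : Fin n → E d :=
  fun i => z (l.rep (Fin.natAdd n i))

@[fun_prop]
lemma Pairing.measurable_left (l : Pairing (n + n)) : Measurable (l.left (d := d)) :=
  measurable_pi_lambda _ fun _ => measurable_pi_apply _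

@[fun_prop]
lemma Pairing.measurable_right (l : Pairing (n + n)) : Measurable (l.right (d := d)) :=
  measurable_pi_lambda _ fun _ => measurable_pi_apply _

/-- The bilinear form of the norm of `𝓑_n`. -/
def pairB (a b : (Fin n → E d) → ℝ≥0∞) : ℝ≥0∞ :=
  ∑ l : Pairing (n + n), ∫⁻ z : l.A₀ → E d, a (l.left z) * b (l.right z)

lemma normSqB_eq_pairB (f : (Fin n → E d) → ℝ) :
    normSqB n f = pairB (fun y => ‖f y‖ₑ) (fun y => ‖f y‖ₑ) := rfl

/-- Equality almost everywhere on all the diagonals. -/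
def AEEqB (f g : (Fin n → E d) → ℝ) : Prop :=
  ∀ l : Pairing (n + n), ∀ᵐ z : l.A₀ → E d, f (l.left z) = g (l.left z) ∧ f (l.right z) = g (l.right z)

lemma pairB_congr {f f' g g' : (Fin n → E d) → ℝ} (hf : AEEqB f f') (hg : AEEqB g g') :
    pairB (fun y => ‖f y‖ₑ) (fun y => ‖g y‖ₑ) = pairB (fun y => ‖f' y‖ₑ) (fun y => ‖g' y‖ₑ) := by
  refine Finset.sum_congr rfl fun l _ => lintegral_congr_ae ?_
  filter_upwards [hf l, hg l] with z hz hz'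
  simp only [hz.1, hz'.2]

lemma normSqB_congr {f g : (Fin n → E d) → ℝ} (h : AEEqB f g) : normSqB n f = normSqB n g :=
  pairB_congr h h

lemma AEEqB.refl (f : (Fin n → E d) → ℝ) : AEEqB f f := fun _ => ae_of_all _ fun _ => ⟨rfl, rfl⟩

lemma AEEqB.sub {f f' g g' : (Fin n → E d) → ℝ} (hf : AEEqB f f') (hg : AEEqB g g') :
    AEEqB (f - g) (f' - g') := fun l => by
  filter_upwards [hf l, hg l] with z hz hz'
  simp only [Pi.sub_apply, hz.1, hz'.1, hz.2, hz'.2, and_self]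

lemma pairB_mono {a a' b b' : (Fin n → E d) → ℝ≥0∞} (ha : ∀ y, a y ≤ a' y) (hb : ∀ y, b y ≤ b' y) :
    pairB a b ≤ pairB a' b' :=
  Finset.sum_le_sum fun _ _ => lintegral_mono fun _ => mul_le_mul' (ha _) (hb _)

lemma normSqB_mono {f g : (Fin n → E d) → ℝ} (h : ∀ y, ‖f y‖ₑ ≤ ‖g y‖ₑ) :
    normSqB n f ≤ normSqB n g := pairB_mono h h

lemma normSqB_const_mul (c : ℝ) {f : (Fin n → E d) → ℝ} :
    normSqB n (fun y => c * f y) = ‖c‖ₑ ^ 2 * normSqB n f := by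
  unfold normSqB
  rw [Finset.mul_sum]
  refine Finset.sum_congr rfl fun l _ => ?_
  rw [← lintegral_const_mul' _ _ (by finiteness)]
  refine lintegral_congr fun z => ?_
  rw [enorm_mul, enorm_mul]
  ring

lemma pairB_add {a b : (Fin n → E d) → ℝ≥0∞} (ha : Measurable a) (hb : Measurable b) :
    pairB (a + b) (a + b) = pairB a a + pairB b b + (pairB a b + pairB b a) := by
  unfold pairB
  rw [← Finset.sum_add_distrib, ← Finset.sum_add_distrib, ← Finset.sum_add_distrib]
  refine Finset.sum_congr rfl fun l _ => ?_
  rw [← lintegral_add_left (by fun_prop), ← lintegral_add_left (by fun_prop),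
    ← lintegral_add_left (by fun_prop)]
  refine lintegral_congr fun z => ?_
  simp only [Pi.add_apply]
  ring

/-- Dominated convergence for the norm of `𝓑_n`. -/
lemma tendsto_normSqB {ι : Type*} {L : Filter ι} [L.IsCountablyGenerated]
    {f : ι → (Fin n → E d) → ℝ} {g : (Fin n → E d) → ℝ} {b : (Fin n → E d) → ℝ≥0∞}
    (hf : ∀ i, Measurable (f i)) (hb : pairB b b ≠ ∞)
    (hfb : ∀ i y, ‖f i y‖ₑ ≤ b y) (hlim : ∀ y, Tendsto (fun i => f i y) L (𝓝 (g y))) :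
    Tendsto (fun i => normSqB n (f i)) L (𝓝 (normSqB n g)) := by
  unfold normSqB
  refine tendsto_finsetSum _ fun l _ => ?_
  refine tendsto_lintegral_filter_of_dominated_convergence
    (fun z => b (l.left z) * b (l.right z)) ?_ ?_ ?_ ?_
  · refine Eventually.of_forall fun i => ?_
    have h1 : Measurable fun z : l.A₀ → E d => f i (l.left z) := (hf i).comp l.measurable_left
    have h2 : Measurable fun z : l.A₀ → E d => f i (l.right z) := (hf i).comp l.measurable_right
    exact h1.enorm.mul h2.enorm
  · exact Eventually.of_forall fun i => ae_of_all _ fun z => mul_le_mul' (hfb i _) (hfb i _)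
  · exact fun h => hb (ENNReal.sum_eq_top.mpr ⟨l, Finset.mem_univ _, h⟩)
  · refine ae_of_all _ fun z => ?_
    have h1 := (hlim (l.left z)).mul (hlim (l.right z))
    have h2 : ∀ x y : ℝ, ‖x‖ₑ * ‖y‖ₑ = ‖x * y‖ₑ := fun x y => (enorm_mul x y).symm
    change Tendsto (fun i => ‖f i (l.left z)‖ₑ * ‖f i (l.right z)‖ₑ) L
      (𝓝 (‖g (l.left z)‖ₑ * ‖g (l.right z)‖ₑ))
    simp only [h2]
    exact h1.enorm

end PairB

/-! ### Stratonovich integrals of combinations of products. -/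

section Simple

variable {d n : ℕ} {Ω : Type*} [MeasurableSpace Ω] {μ : Measure Ω} [IsProbabilityMeasure μ]
  {W : L2 d →ₗᵢ[ℝ] Lp ℝ 2 μ}

lemma SimpleIntegrand.memLp (e : SimpleIntegrand d n) (hW : IsWhiteNoise W) :
    MemLp (e.integral W) 2 μ := by
  unfold SimpleIntegrand.integral
  exact memLp_finsetSum _ fun j _ => (hW.memLp_prod _ _ (by simp)).const_mul _

/-- The Stratonovich integral of a combination of products, as an element of `L²(Ω)`. -/
def SimpleIntegrand.toLp (e : SimpleIntegrand d n) (hW : IsWhiteNoise W) : Lp ℝ 2 μ :=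
  (e.memLp hW).toLp _

/-- Differences of combinations of products. -/
def SimpleIntegrand.sub (e e' : SimpleIntegrand d n) : SimpleIntegrand d n where
  len := e.len + e'.len
  coeff := Fin.append e.coeff (fun j => - e'.coeff j)
  fac := Fin.append e.fac e'.fac

lemma SimpleIntegrand.toFun_sub (e e' : SimpleIntegrand d n) :
    (e.sub e').toFun = e.toFun - e'.toFun := by
  ext y
  refine (Fin.sum_univ_add (fun j : Fin (e.len + e'.len) =>
    Fin.append e.coeff (fun j => - e'.coeff j) j * ∏ k, (Fin.append e.fac e'.fac j k : E d → ℝ) (y k))).trans ?_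
  simp [SimpleIntegrand.toFun, sub_eq_add_neg]

lemma SimpleIntegrand.integral_sub (e e' : SimpleIntegrand d n) :
    (e.sub e').integral W = e.integral W - e'.integral W := by
  ext y
  refine (Fin.sum_univ_add (fun j : Fin (e.len + e'.len) =>
    Fin.append e.coeff (fun j => - e'.coeff j) j * ∏ k, (W (Fin.append e.fac e'.fac j k) : Ω → ℝ) y)).trans ?_
  simp [SimpleIntegrand.integral, sub_eq_add_neg]

/-- Grouping the 2n factors by pairs separates the variables: each variable carries a product of two
functions in L², which is integrable with integral an inner product. -/
lemma Pairing.integrable_prod_mul_prod (l : Pairing (n + n)) (g g' : Fin n → L2 d) :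
    Integrable (fun z : l.A₀ → E d =>
      (∏ k, (g k : E d → ℝ) (l.left z k)) * ∏ k, (g' k : E d → ℝ) (l.right z k)) ∧
    ∫ z : l.A₀ → E d, (∏ k, (g k : E d → ℝ) (l.left z k)) * ∏ k, (g' k : E d → ℝ) (l.right z k)
      = ∏ k : l.A₀, inner ℝ (Fin.append g g' k) (Fin.append g g' (l.1 k)) := by
  have h : ∀ z : l.A₀ → E d,
      (∏ k, (g k : E d → ℝ) (l.left z k)) * ∏ k, (g' k : E d → ℝ) (l.right z k)
      = ∏ k : l.A₀, ((Fin.append g g' k : L2 d) : E d → ℝ) (z k) *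
          ((Fin.append g g' (l.1 k) : L2 d) : E d → ℝ) (z k) := by
    intro z
    have h1 := Fin.prod_univ_add (fun i : Fin (n + n) => ((Fin.append g g' i : L2 d) : E d → ℝ) (z (l.rep i)))
    simp only [Fin.append_left, Fin.append_right] at h1
    rw [l.prod_eq_prod_pairs] at h1
    simp only [Pairing.rep_coe, Pairing.rep_partner] at h1
    exact h1.symm
  simp only [h]
  refine ⟨Integrable.fintype_prod fun k : l.A₀ =>
    (Lp.memLp (Fin.append g g' k)).integrable_mul (Lp.memLp (Fin.append g g' (l.1 k))), ?_⟩
  rw [integral_fintype_prod_volume_eq_prod (fun k : l.A₀ => fun x : E d =>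
    ((Fin.append g g' k : L2 d) : E d → ℝ) x * ((Fin.append g g' (l.1 k) : L2 d) : E d → ℝ) x)]
  refine Finset.prod_congr rfl fun k _ => ?_
  rw [L2.inner_def]
  refine integral_congr_ae (ae_of_all _ fun x => ?_)
  simp [mul_comm]

lemma SimpleIntegrand.integrable_mul (e e' : SimpleIntegrand d n) (l : Pairing (n + n)) :
    Integrable (fun z : l.A₀ → E d => e.toFun (l.left z) * e'.toFun (l.right z)) := by
  unfold SimpleIntegrand.toFun
  simp only [Finset.sum_mul_sum]
  refine integrable_finsetSum _ fun j _ => integrable_finsetSum _ fun j' _ => ?_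
  have := ((l.integrable_prod_mul_prod (e.fac j) (e'.fac j')).1.const_mul
    (e.coeff j * e'.coeff j'))
  refine this.congr (ae_of_all _ fun z => ?_)
  ring

/-- The expectation of a product of two Stratonovich integrals. -/
lemma SimpleIntegrand.integral_mul (hW : IsWhiteNoise W) (e e' : SimpleIntegrand d n) :
    ∫ ω, e.integral W ω * e'.integral W ω ∂μ
      = ∑ l : Pairing (n + n), ∫ z : l.A₀ → E d, e.toFun (l.left z) * e'.toFun (l.right z) := by
  have h1 : ∀ j j', Integrable (fun ω => e.coeff j * (∏ k, (W (e.fac j k) : Ω → ℝ) ω) *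
      (e'.coeff j' * ∏ k, (W (e'.fac j' k) : Ω → ℝ) ω)) μ := fun j j' =>
    ((hW.memLp_prod Finset.univ (e.fac j) (p := 2) (by simp)).const_mul _).integrable_mul
      ((hW.memLp_prod Finset.univ (e'.fac j') (p := 2) (by simp)).const_mul _)
  have h2 : ∀ j j', ∫ ω, e.coeff j * (∏ k, (W (e.fac j k) : Ω → ℝ) ω) *
      (e'.coeff j' * ∏ k, (W (e'.fac j' k) : Ω → ℝ) ω) ∂μ
      = ∑ l : Pairing (n + n), ∫ z : l.A₀ → E d,
        e.coeff j * (∏ k, (e.fac j k : E d → ℝ) (l.left z k)) *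
        (e'.coeff j' * ∏ k, (e'.fac j' k : E d → ℝ) (l.right z k)) := by
    intro j j'
    have h3 := hW.integral_prod (Fin.append (e.fac j) (e'.fac j'))
    simp only [Fin.prod_univ_add, Fin.append_left, Fin.append_right] at h3
    have h4 : ∀ a b c e : ℝ, a * b * (c * e) = (a * c) * (b * e) := fun _ _ _ _ => by ring
    rw [integral_congr_ae (ae_of_all _ fun ω => h4 _ _ _ _), integral_const_mul, h3,
      Finset.sum_congr rfl fun (l : Pairing (n + n)) _ =>
        integral_congr_ae (ae_of_all _ fun z => h4 _ _ _ _)]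
    simp only [integral_const_mul]
    rw [← Finset.mul_sum]
    congr 1
    exact Finset.sum_congr rfl fun l _ => (l.integrable_prod_mul_prod _ _).2.symm
  have h5 : ∀ (l : Pairing (n + n)) j j', Integrable fun z : l.A₀ → E d =>
        e.coeff j * (∏ k, (e.fac j k : E d → ℝ) (l.left z k)) *
        (e'.coeff j' * ∏ k, (e'.fac j' k : E d → ℝ) (l.right z k)) := by
    intro l j j'
    refine ((l.integrable_prod_mul_prod (e.fac j) (e'.fac j')).1.const_mul
      (e.coeff j * e'.coeff j')).congr (ae_of_all _ fun z => ?_)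
    ring
  unfold SimpleIntegrand.integral SimpleIntegrand.toFun
  simp only [Finset.sum_mul_sum]
  rw [integral_finsetSum _ fun j _ => integrable_finsetSum _ fun j' _ => h1 j j']
  simp only [integral_finsetSum _ fun j' _ => h1 _ j', h2]
  have h6 : ∀ l : Pairing (n + n), ∫ z : l.A₀ → E d, ∑ j, ∑ j',
        e.coeff j * (∏ k, (e.fac j k : E d → ℝ) (l.left z k)) *
        (e'.coeff j' * ∏ k, (e'.fac j' k : E d → ℝ) (l.right z k))
      = ∑ j, ∑ j', ∫ z : l.A₀ → E d,
        e.coeff j * (∏ k, (e.fac j k : E d → ℝ) (l.left z k)) *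
        (e'.coeff j' * ∏ k, (e'.fac j' k : E d → ℝ) (l.right z k)) := by
    intro l
    rw [integral_finsetSum _ fun j _ => integrable_finsetSum _ fun j' _ => h5 l j j']
    exact Finset.sum_congr rfl fun j _ => integral_finsetSum _ fun j' _ => h5 l j j'
  simp only [h6]
  rw [Finset.sum_comm]
  rw [Finset.sum_comm (s := (Finset.univ : Finset (Pairing (n + n))))]
  rw [Finset.sum_comm]
  exact Finset.sum_congr rfl fun j _ => Finset.sum_comm

/-- Wick's formula gives the second moment as a sum of signed integrals over the diagonals, and the
norm of `𝓑_n` takes absolute values inside. This contraction estimate is what permits the extension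
by density. -/
lemma SimpleIntegrand.enorm_toLp_sq_le (hW : IsWhiteNoise W) (e : SimpleIntegrand d n) :
    ‖e.toLp hW‖ₑ ^ 2 ≤ normSqB n e.toFun := by
  have h1 : ‖e.toLp hW‖ₑ ^ 2 = ENNReal.ofReal (∫ ω, e.integral W ω * e.integral W ω ∂μ) := by
    have h2 : Integrable (fun ω => e.integral W ω * e.integral W ω) μ :=
      (e.memLp hW).integrable_mul (e.memLp hW)
    rw [SimpleIntegrand.toLp, Lp.enorm_toLp,
      ofReal_integral_eq_lintegral_ofReal h2
      (ae_of_all _ fun ω => mul_self_nonneg _), eLpNorm_eq_lintegral_rpow_enorm_toReal (by simp)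
      (by simp), ← ENNReal.rpow_natCast, ← ENNReal.rpow_mul]
    norm_num
    refine lintegral_congr fun ω => ?_
    rw [← sq, ← enorm_pow, Real.enorm_of_nonneg (sq_nonneg _)]
  rw [h1, e.integral_mul hW]
  refine (Real.ofReal_le_enorm _).trans ((enorm_sum_le _ _).trans
    (Finset.sum_le_sum fun l _ => (enorm_integral_le_lintegral_enorm _).trans ?_))
  refine lintegral_mono fun z => ?_
  rw [enorm_mul]
  rfl

lemma SimpleIntegrand.toLp_sub (hW : IsWhiteNoise W) (e e' : SimpleIntegrand d n) :
    (e.sub e').toLp hW = e.toLp hW - e'.toLp hW := by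
  unfold SimpleIntegrand.toLp
  rw [← MemLp.toLp_sub]
  exact MemLp.toLp_congr _ _ (by rw [SimpleIntegrand.integral_sub])

lemma SimpleIntegrand.enorm_toLp_sub_sq_le (hW : IsWhiteNoise W) (e e' : SimpleIntegrand d n) :
    ‖e.toLp hW - e'.toLp hW‖ₑ ^ 2 ≤ normSqB n (e.toFun - e'.toFun) := by
  rw [← SimpleIntegrand.toLp_sub, ← SimpleIntegrand.toFun_sub]
  exact SimpleIntegrand.enorm_toLp_sq_le hW _

/-- For nonnegative functions the absolute values in `pairB` change nothing, so Wick's formula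
becomes an exact identity. -/
lemma SimpleIntegrand.pairB_eq (hW : IsWhiteNoise W) (e e' : SimpleIntegrand d n)
    {s s' : (Fin n → E d) → ℝ} (hs : AEEqB e.toFun s) (hs' : AEEqB e'.toFun s')
    (h0 : ∀ y, 0 ≤ s y) (h0' : ∀ y, 0 ≤ s' y) :
    pairB (fun y => ‖s y‖ₑ) (fun y => ‖s' y‖ₑ)
      = ENNReal.ofReal (∫ ω, e.integral W ω * e'.integral W ω ∂μ) := by
  rw [e.integral_mul hW]
  have h : ∀ l : Pairing (n + n),
      ∀ᵐ z : l.A₀ → E d, 0 ≤ e.toFun (l.left z) * e'.toFun (l.right z) := by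
    intro l
    filter_upwards [hs l, hs' l] with z hz hz'
    rw [hz.1, hz'.2]
    exact mul_nonneg (h0 _) (h0' _)
  rw [ENNReal.ofReal_sum_of_nonneg fun l _ => integral_nonneg_of_ae (h l)]
  refine Finset.sum_congr rfl fun l _ => ?_
  rw [ofReal_integral_eq_lintegral_ofReal (e.integrable_mul e' l) (h l)]
  refine lintegral_congr_ae ?_
  filter_upwards [hs l, hs' l] with z hz hz'
  rw [hz.1, hz'.2, ENNReal.ofReal_mul (h0 _), Real.enorm_of_nonneg (h0 _),
    Real.enorm_of_nonneg (h0' _)]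

/-- Positivity of the bilinear form of the norm, for nonnegative combinations of products. -/
lemma SimpleIntegrand.pairB_add_le (hW : IsWhiteNoise W) (e e' : SimpleIntegrand d n)
    {s s' : (Fin n → E d) → ℝ} (hs : AEEqB e.toFun s) (hs' : AEEqB e'.toFun s')
    (h0 : ∀ y, 0 ≤ s y) (h0' : ∀ y, 0 ≤ s' y) :
    pairB (fun y => ‖s y‖ₑ) (fun y => ‖s' y‖ₑ) + pairB (fun y => ‖s' y‖ₑ) (fun y => ‖s y‖ₑ)
      ≤ normSqB n s + normSqB n s' := by
  rw [normSqB_eq_pairB, normSqB_eq_pairB, e.pairB_eq hW e' hs hs' h0 h0',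
    e'.pairB_eq hW e hs' hs h0' h0, e.pairB_eq hW e hs hs h0 h0, e'.pairB_eq hW e' hs' hs' h0' h0']
  have hi : ∀ e e' : SimpleIntegrand d n, Integrable (fun ω => e.integral W ω * e'.integral W ω) μ :=
    fun e e' => (e.memLp hW).integrable_mul (e'.memLp hW)
  have hn : ∀ e : SimpleIntegrand d n, 0 ≤ ∫ ω, e.integral W ω * e.integral W ω ∂μ :=
    fun e => integral_nonneg fun ω => mul_self_nonneg _
  have hc : ∫ ω, e'.integral W ω * e.integral W ω ∂μ = ∫ ω, e.integral W ω * e'.integral W ω ∂μ := by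
    simp only [mul_comm]
  have hle : 2 * ∫ ω, e.integral W ω * e'.integral W ω ∂μ
      ≤ ∫ ω, e.integral W ω * e.integral W ω ∂μ + ∫ ω, e'.integral W ω * e'.integral W ω ∂μ := by
    rw [← integral_const_mul, ← integral_add (hi _ _) (hi _ _)]
    refine integral_mono ((hi _ _).const_mul _) ((hi _ _).add (hi _ _)) fun ω => ?_
    simp only
    nlinarith [sq_nonneg (e.integral W ω - e'.integral W ω)]
  rw [hc, ← two_mul, ← ENNReal.ofReal_add (hn _) (hn _),
    show (2 : ℝ≥0∞) = ENNReal.ofReal 2 by simp, ← ENNReal.ofReal_mul (by norm_num)]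
  exact ENNReal.ofReal_le_ofReal hle

end Simple

/-! ### The iterated Stratonovich integral of continuous kernels -/

lemma le_sqrt_of_sq_le {a b : ℝ≥0∞} (h : a ^ 2 ≤ b) : a ≤ b ^ (1 / 2 : ℝ) := by
  rw [one_div, ENNReal.le_rpow_inv_iff (by norm_num)]
  simpa using h

/-! ### Approximation of continuous kernels by step functions. -/

section Grid

variable {d n : ℕ}

/-- A simple function that rounds the points of `ℝ^d`. -/
def gridPt (d N : ℕ) : SimpleFunc (E d) (E d) := SimpleFunc.nearestPt (TopologicalSpace.denseSeq (E d)) N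

lemma tendsto_gridPt (x : E d) : Tendsto (fun N => gridPt d N x) atTop (𝓝 x) :=
  SimpleFunc.tendsto_nearestPt (by rw [(TopologicalSpace.denseRange_denseSeq (E d)).closure_range]; trivial)

/-- The nearest of the first points of the dense sequence is at least as near as the point of index
0. Hence rounding maps a ball into a larger ball that does not depend on `N`. -/
lemma norm_gridPt_le (N : ℕ) (x : E d) : ‖gridPt d N x‖ ≤ 2 * ‖x‖ + ‖TopologicalSpace.denseSeq (E d) 0‖ := by
  have h := SimpleFunc.edist_nearestPt_le (TopologicalSpace.denseSeq (E d)) x (Nat.zero_le N)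
  rw [edist_dist, edist_dist, ENNReal.ofReal_le_ofReal_iff dist_nonneg] at h
  change dist (gridPt d N x) x ≤ _ at h
  rw [dist_eq_norm, dist_eq_norm] at h
  have h1 := norm_sub_le (TopologicalSpace.denseSeq (E d) 0) x
  have h2 := norm_le_norm_add_norm_sub' (gridPt d N x) x
  linarith

/-- The truncation of a function to a ball. -/
def trunc (R : ℕ) (f : (Fin n → E d) → ℝ) (y : Fin n → E d) : ℝ :=
  if ∀ k, ‖y k‖ ≤ R then f y else 0

/-- The step functions that approximate the truncation of a function to a ball. -/
def stepFun (R N : ℕ) (f : (Fin n → E d) → ℝ) : (Fin n → E d) → ℝ :=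
  trunc R (fun y => f (fun k => gridPt d N (y k)))

/-- A multiple of the indicator function of a ball. -/
def box (R : ℕ) (C : ℝ≥0∞) (y : Fin n → E d) : ℝ≥0∞ := if ∀ k, ‖y k‖ ≤ R then C else 0

lemma measurableSet_ballPi (R : ℕ) : MeasurableSet {y : Fin n → E d | ∀ k, ‖y k‖ ≤ R} := by
  simp only [Set.ofPred_forall]
  exact MeasurableSet.iInter fun k => measurableSet_le (by fun_prop) measurable_const

lemma measurable_trunc {f : (Fin n → E d) → ℝ} (hf : Measurable f) (R : ℕ) :
    Measurable (trunc R f) :=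
  Measurable.ite (measurableSet_ballPi R) hf measurable_const

lemma measurable_box (R : ℕ) (C : ℝ≥0∞) : Measurable (box (d := d) (n := n) R C) :=
  Measurable.ite (measurableSet_ballPi R) measurable_const measurable_const

lemma measurable_stepFun {f : (Fin n → E d) → ℝ} (hf : Measurable f) (R N : ℕ) :
    Measurable (stepFun R N f) := by
  refine measurable_trunc (hf.comp ?_) R
  exact measurable_pi_lambda _ fun k => (gridPt d N).measurable.comp (measurable_pi_apply k)

lemma enorm_trunc_le (R : ℕ) (f : (Fin n → E d) → ℝ) (y) : ‖trunc R f y‖ₑ ≤ ‖f y‖ₑ := by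
  unfold trunc; split_ifs <;> simp

lemma enorm_sub_trunc_le (R : ℕ) (f : (Fin n → E d) → ℝ) (y) : ‖f y - trunc R f y‖ₑ ≤ ‖f y‖ₑ := by
  unfold trunc; split_ifs <;> simp

lemma enorm_trunc_sub_trunc_le (R R' : ℕ) (f : (Fin n → E d) → ℝ) (y) :
    ‖trunc R f y - trunc R' f y‖ₑ ≤ ‖f y‖ₑ := by
  unfold trunc; split_ifs <;> simp

lemma tendsto_trunc (f : (Fin n → E d) → ℝ) (y) :
    Tendsto (fun R => trunc R f y) atTop (𝓝 (f y)) := by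
  refine tendsto_const_nhds.congr' ?_
  filter_upwards [eventually_ge_atTop ⌈‖y‖⌉₊] with R hR
  unfold trunc
  rw [if_pos fun k => (norm_le_pi_norm y k).trans ((Nat.le_ceil _).trans (by exact_mod_cast hR))]

lemma tendsto_stepFun {f : (Fin n → E d) → ℝ} (hf : Continuous f) (R : ℕ) (y) :
    Tendsto (fun N => stepFun R N f y) atTop (𝓝 (trunc R f y)) := by
  unfold stepFun trunc
  split_ifs
  · exact (hf.tendsto y).comp (tendsto_pi_nhds.mpr fun k => tendsto_gridPt (y k))
  · exact tendsto_const_nhds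

/-- Rounded points of the ball stay in one compact ball, where `f` is bounded. The constant is
uniform in `N`, as dominated convergence requires. -/
lemma exists_stepFun_bound {f : (Fin n → E d) → ℝ} (hf : Continuous f) (R : ℕ) :
    ∃ C : ℝ≥0, ∀ N y, ‖stepFun R N f y‖ₑ ≤ box R C y := by
  obtain ⟨C, hC⟩ := (isCompact_closedBall (0 : Fin n → E d)
    (2 * R + ‖TopologicalSpace.denseSeq (E d) 0‖)).exists_bound_of_continuousOn hf.continuousOn
  refine ⟨C.toNNReal, fun N y => ?_⟩
  unfold stepFun trunc box
  split_ifs with h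
  · rw [← ofReal_norm]
    refine ENNReal.ofReal_le_ofReal (hC _ ?_)
    rw [mem_closedBall_zero_iff, pi_norm_le_iff_of_nonneg (by positivity)]
    exact fun k => (norm_gridPt_le N (y k)).trans (by linarith [h k])
  · simp

/-- Every variable of a pairing occurs among the left or the right ones, so the integrand vanishes
outside a product of balls. -/
lemma pairB_box_ne_top (R : ℕ) {C : ℝ≥0∞} (hC : C ≠ ∞) :
    pairB (box (d := d) (n := n) R C) (box R C) ≠ ∞ := by
  refine (ENNReal.sum_lt_top.mpr fun l _ => ?_).ne
  calc ∫⁻ z : l.A₀ → E d, box R C (l.left z) * box R C (l.right z)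
      ≤ ∫⁻ z : l.A₀ → E d, (univ.pi fun _ => Metric.closedBall (0 : E d) R).indicator
          (fun _ => C * C) z := by
        refine lintegral_mono fun z => ?_
        unfold box
        by_cases h : (∀ k, ‖l.left z k‖ ≤ R) ∧ ∀ k, ‖l.right z k‖ ≤ R
        · rw [if_pos h.1, if_pos h.2, indicator_of_mem]
          intro k _
          rw [mem_closedBall_zero_iff]
          obtain ⟨i, hi⟩ := l.rep_surjective k
          rw [← hi]
          refine Fin.addCases (fun j => ?_) (fun j => ?_) i
          · exact h.1 j
          · exact h.2 j
        · rcases not_and_or.mp h with h | h <;> rw [if_neg h] <;> simp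
    _ < ∞ := by
        rw [lintegral_indicator_const
          (MeasurableSet.univ_pi fun _ => Metric.isClosed_closedBall.measurableSet), volume_pi_pi]
        have : ∀ r, volume (Metric.closedBall (0 : E d) r) < ∞ := fun r =>
          measure_closedBall_lt_top
        exact ENNReal.mul_lt_top (ENNReal.mul_lt_top hC.lt_top hC.lt_top)
          (ENNReal.prod_lt_top fun _ _ => this _)

lemma tendsto_normSqB_stepFun {f : (Fin n → E d) → ℝ} (hf : Continuous f) (R : ℕ) :
    Tendsto (fun N => normSqB n (stepFun R N f)) atTop (𝓝 (normSqB n (trunc R f))) := by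
  obtain ⟨C, hC⟩ := exists_stepFun_bound hf R
  exact tendsto_normSqB (fun N => measurable_stepFun hf.measurable R N)
    (pairB_box_ne_top R ENNReal.coe_ne_top) hC (tendsto_stepFun hf R)

lemma box_add (R : ℕ) (C D : ℝ≥0∞) (y : Fin n → E d) : box R C y + box R D y = box R (C + D) y := by
  unfold box; split_ifs <;> simp

lemma box_mono {R R' : ℕ} (h : R ≤ R') (C : ℝ≥0∞) (y : Fin n → E d) : box R C y ≤ box R' C y := by
  unfold box
  split_ifs with h1 h2
  · exact le_rfl
  · exact absurd (fun k => (h1 k).trans (by exact_mod_cast h)) h2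
  · simp
  · simp

/-- The free index filter serves two purposes: double sequences, for the Cauchy property, and a
common index with two radii, for the comparison of truncations. -/
lemma tendsto_normSqB_stepFun_sub {f g : (Fin n → E d) → ℝ} (hf : Continuous f) (hg : Continuous g)
    (R R' : ℕ) {ι : Type*} {L : Filter ι} [L.IsCountablyGenerated] {a b : ι → ℕ}
    (ha : Tendsto a L atTop) (hb : Tendsto b L atTop) :
    Tendsto (fun i => normSqB n (stepFun R (a i) f - stepFun R' (b i) g)) L
      (𝓝 (normSqB n (trunc R f - trunc R' g))) := by
  obtain ⟨C, hC⟩ := exists_stepFun_bound hf R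
  obtain ⟨D, hD⟩ := exists_stepFun_bound hg R'
  refine tendsto_normSqB (b := box (max R R') (C + D))
    (fun i => (measurable_stepFun hf.measurable R _).sub (measurable_stepFun hg.measurable R' _))
    (pairB_box_ne_top _ (by finiteness)) (fun i y => ?_) (fun y => ?_)
  · rw [← box_add]
    exact enorm_sub_le.trans (add_le_add ((hC _ y).trans (box_mono (le_max_left _ _) _ _))
      ((hD _ y).trans (box_mono (le_max_right _ _) _ _)))
  · exact ((tendsto_stepFun hf R y).comp ha).sub ((tendsto_stepFun hg R' y).comp hb)

/-- The cells of the grid. -/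
def cell (R N : ℕ) (p : E d) : Set (E d) := gridPt d N ⁻¹' {p} ∩ Metric.closedBall 0 R

lemma measurableSet_cell (R N : ℕ) (p : E d) : MeasurableSet (cell R N p) :=
  ((gridPt d N).measurableSet_preimage _).inter Metric.isClosed_closedBall.measurableSet

lemma volume_cell_ne_top (R N : ℕ) (p : E d) : volume (cell R N p) ≠ ∞ :=
  ((measure_mono inter_subset_right).trans_lt measure_closedBall_lt_top).ne

/-- The indices of the cells of the grid in `(ℝ^d)^n`. -/
abbrev GridIndex (d n N : ℕ) : Type := Fin n → (gridPt d N).range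

/-- The step functions as combinations of products. -/
def stepInt (R N : ℕ) (f : (Fin n → E d) → ℝ) : SimpleIntegrand d n where
  len := Fintype.card (GridIndex d n N)
  coeff j := f fun k => ((Fintype.equivFin (GridIndex d n N)).symm j k : E d)
  fac j k := indicatorConstLp 2
    (measurableSet_cell R N ((Fintype.equivFin (GridIndex d n N)).symm j k : E d))
    (volume_cell_ne_top R N _) (1 : ℝ)

/-- Indicators in L² are only classes of functions, and the diagonals are null sets of the full
space. On a paired configuration, however, each factor depends on a single coordinate, and
evaluation at a coordinate pulls null sets back to null sets. -/
lemma aeeqB_stepInt (R N : ℕ) (f : (Fin n → E d) → ℝ) :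
    AEEqB (stepInt R N f).toFun (stepFun R N f) := by
  have key : ∀ y : Fin n → E d, (∀ k, ∀ p : (gridPt d N).range,
      (indicatorConstLp 2 (measurableSet_cell R N (p : E d)) (volume_cell_ne_top R N _) (1 : ℝ)
        : E d → ℝ) (y k) = (cell R N (p : E d)).indicator (fun _ => (1 : ℝ)) (y k)) →
      (stepInt R N f).toFun y = stepFun R N f y := by
    intro y hy
    unfold SimpleIntegrand.toFun
    change ∑ j : Fin (Fintype.card (GridIndex d n N)),
      f (fun k => ((Fintype.equivFin (GridIndex d n N)).symm j k : E d)) *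
      ∏ k, (indicatorConstLp 2
        (measurableSet_cell R N ((Fintype.equivFin (GridIndex d n N)).symm j k : E d))
        (volume_cell_ne_top R N _) (1 : ℝ) : E d → ℝ) (y k) = _
    rw [(Fintype.equivFin (GridIndex d n N)).symm.sum_comp (fun a : GridIndex d n N =>
      f (fun k => (a k : E d)) * ∏ k, (indicatorConstLp 2 (measurableSet_cell R N (a k : E d))
        (volume_cell_ne_top R N _) (1 : ℝ) : E d → ℝ) (y k))]
    simp only [hy]
    unfold stepFun trunc
    split_ifs with h
    · rw [Finset.sum_eq_single (fun k => ⟨gridPt d N (y k), SimpleFunc.mem_range_self _ _⟩)]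
      · rw [Finset.prod_eq_one, mul_one]
        intro k _
        rw [indicator_of_mem]
        exact ⟨rfl, mem_closedBall_zero_iff.mpr (h k)⟩
      · intro a _ ha
        obtain ⟨k, hk⟩ := Function.ne_iff.mp ha
        rw [Finset.prod_eq_zero (Finset.mem_univ k), mul_zero]
        rw [indicator_of_notMem]
        intro hmem
        exact hk (Subtype.ext hmem.1.symm)
      · simp
    · push Not at h
      obtain ⟨k, hk⟩ := h
      refine Finset.sum_eq_zero fun a _ => ?_
      rw [Finset.prod_eq_zero (Finset.mem_univ k), mul_zero]
      rw [indicator_of_notMem]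
      intro hmem
      exact absurd (mem_closedBall_zero_iff.mp hmem.2) (not_le.mpr hk)
  intro l
  have h : ∀ᵐ z : l.A₀ → E d, ∀ m : l.A₀, ∀ p : (gridPt d N).range,
      (indicatorConstLp 2 (measurableSet_cell R N (p : E d)) (volume_cell_ne_top R N _) (1 : ℝ)
        : E d → ℝ) (z m) = (cell R N (p : E d)).indicator (fun _ => (1 : ℝ)) (z m) := by
    rw [ae_all_iff]
    intro m
    rw [ae_all_iff]
    intro p
    exact (Measure.quasiMeasurePreserving_eval (fun _ : l.A₀ => (volume : Measure (E d))) m).ae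
      (indicatorConstLp_coeFn (hs := measurableSet_cell R N (p : E d))
        (hμs := volume_cell_ne_top R N _) (c := (1 : ℝ)) (p := 2))
  filter_upwards [h] with z hz
  exact ⟨key _ fun k p => hz _ p, key _ fun k p => hz _ p⟩

end Grid

/-! ### Construction of the iterated integral, and its exchange with integrals over parameters. -/

section Integral

variable {d n : ℕ} {Ω : Type*} [MeasurableSpace Ω] {μ : Measure Ω} [IsProbabilityMeasure μ]
  {W : L2 d →ₗᵢ[ℝ] Lp ℝ 2 μ}

/-- The product of values of white noise, as an element of `L²(Ω)`. -/
def prodLp (hW : IsWhiteNoise W) (g : Fin n → L2 d) : Lp ℝ 2 μ :=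
  (hW.memLp_prod Finset.univ g (by simp)).toLp _

lemma SimpleIntegrand.toLp_eq_sum (hW : IsWhiteNoise W) (e : SimpleIntegrand d n) :
    e.toLp hW = ∑ j, e.coeff j • prodLp hW (e.fac j) := by
  have h : ∀ j, e.coeff j • prodLp hW (e.fac j) = MemLp.toLp
      (fun ω => e.coeff j * ∏ k, (W (e.fac j k) : Ω → ℝ) ω)
      ((hW.memLp_prod Finset.univ (e.fac j) (by simp)).const_mul _) := fun j => rfl
  apply Lp.ext
  simp only [h]
  refine (MemLp.coeFn_toLp _).trans ?_
  refine EventuallyEq.trans ?_ (Lp.coeFn_finsetSum _ _).symm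
  have h2 : ∀ᵐ ω ∂μ, ∀ j, (MemLp.toLp (fun ω => e.coeff j * ∏ k, (W (e.fac j k) : Ω → ℝ) ω)
      ((hW.memLp_prod Finset.univ (e.fac j) (by simp)).const_mul _) : Lp ℝ 2 μ) ω
      = e.coeff j * ∏ k, (W (e.fac j k) : Ω → ℝ) ω :=
    ae_all_iff.mpr fun j => MemLp.coeFn_toLp _
  filter_upwards [h2] with ω hω
  simp only [Finset.sum_apply, hω]
  rfl

/-- The integral of a step function. -/
def stepLp (hW : IsWhiteNoise W) (R N : ℕ) (f : (Fin n → E d) → ℝ) : Lp ℝ 2 μ :=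
  (stepInt R N f).toLp hW

/-- The integral of a step function is a finite linear combination of values of `f`, with vectors
that do not depend on `f`. Linearity, measurability in parameters and exchange with integrals are
clear at this level and pass to the limits. -/
lemma exists_stepLp_eq (hW : IsWhiteNoise W) (n R N : ℕ) :
    ∃ (J : ℕ) (p : Fin J → Fin n → E d) (v : Fin J → Lp ℝ 2 μ),
      ∀ f : (Fin n → E d) → ℝ, stepLp hW R N f = ∑ j, f (p j) • v j :=
  ⟨Fintype.card (GridIndex d n N),
    fun j k => ((Fintype.equivFin (GridIndex d n N)).symm j k : E d),
    fun j => prodLp hW fun k => indicatorConstLp 2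
      (measurableSet_cell R N ((Fintype.equivFin (GridIndex d n N)).symm j k : E d))
      (volume_cell_ne_top R N _) (1 : ℝ),
    fun f => SimpleIntegrand.toLp_eq_sum hW (stepInt R N f)⟩

lemma enorm_stepLp_sq_le (hW : IsWhiteNoise W) (R N : ℕ) (f : (Fin n → E d) → ℝ) :
    ‖stepLp hW R N f‖ₑ ^ 2 ≤ normSqB n (stepFun R N f) := by
  rw [← normSqB_congr (aeeqB_stepInt R N f)]
  exact SimpleIntegrand.enorm_toLp_sq_le hW _

lemma enorm_stepLp_sub_sq_le (hW : IsWhiteNoise W) (R N R' N' : ℕ) (f g : (Fin n → E d) → ℝ) :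
    ‖stepLp hW R N f - stepLp hW R' N' g‖ₑ ^ 2 ≤ normSqB n (stepFun R N f - stepFun R' N' g) := by
  rw [← normSqB_congr ((aeeqB_stepInt R N f).sub (aeeqB_stepInt R' N' g))]
  exact SimpleIntegrand.enorm_toLp_sub_sq_le hW _ _

/-- The square of the norm of `𝓑_n` is only evaluated at differences along a double sequence, so no
triangle inequality for that norm is needed. -/
lemma cauchySeq_of_enorm_sq_le {u : ℕ → Lp ℝ 2 μ} {F : ℕ × ℕ → ℝ≥0∞}
    (hF : Tendsto F atTop (𝓝 0)) (h : ∀ p : ℕ × ℕ, ‖u p.1 - u p.2‖ₑ ^ 2 ≤ F p) : CauchySeq u := by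
  rw [EMetric.cauchySeq_iff]
  intro ε hε
  have h1 := hF.eventually_lt_const (show 0 < ε ^ 2 by positivity)
  rw [← prod_atTop_atTop_eq, eventually_prod_self_iff'] at h1
  obtain ⟨t, ht, h2⟩ := h1
  obtain ⟨N, hN⟩ := mem_atTop_sets.mp ht
  refine ⟨N, fun m hm k hk => ?_⟩
  rw [edist_eq_enorm_sub]
  have h3 := (h (m, k)).trans_lt (h2 m (hN m hm) k (hN k hk))
  exact lt_of_pow_lt_pow_left' 2 h3

lemma normSqB_zero : normSqB n (0 : (Fin n → E d) → ℝ) = 0 := by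
  simp [normSqB]

lemma cauchySeq_stepLp (hW : IsWhiteNoise W) (R : ℕ) {f : (Fin n → E d) → ℝ} (hf : Continuous f) :
    CauchySeq (fun N => stepLp hW R N f) := by
  refine cauchySeq_of_enorm_sq_le
    (F := fun p => normSqB n (stepFun R p.1 f - stepFun R p.2 f)) ?_
    (fun p => enorm_stepLp_sub_sq_le hW _ _ _ _ f f)
  have h := tendsto_normSqB_stepFun_sub hf hf R R (L := (atTop : Filter (ℕ × ℕ))) (a := Prod.fst)
    (b := Prod.snd) (by rw [← prod_atTop_atTop_eq]; exact tendsto_fst)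
    (by rw [← prod_atTop_atTop_eq]; exact tendsto_snd)
  rwa [sub_self, normSqB_zero] at h

/-- The integral of the truncation of a function to a ball. -/
def truncLp (hW : IsWhiteNoise W) (R : ℕ) (f : (Fin n → E d) → ℝ) : Lp ℝ 2 μ :=
  limUnder atTop (fun N => stepLp hW R N f)

lemma tendsto_stepLp (hW : IsWhiteNoise W) (R : ℕ) {f : (Fin n → E d) → ℝ} (hf : Continuous f) :
    Tendsto (fun N => stepLp hW R N f) atTop (𝓝 (truncLp hW R f)) :=
  (cauchySeq_stepLp hW R hf).tendsto_limUnder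

lemma tendsto_enorm_sq {ι : Type*} {L : Filter ι} {u : ι → Lp ℝ 2 μ} {x : Lp ℝ 2 μ}
    (h : Tendsto u L (𝓝 x)) : Tendsto (fun i => ‖u i‖ₑ ^ 2) L (𝓝 (‖x‖ₑ ^ 2)) :=
  ENNReal.Tendsto.pow h.enorm

lemma enorm_truncLp_sq_le (hW : IsWhiteNoise W) (R : ℕ) {f : (Fin n → E d) → ℝ}
    (hf : Continuous f) : ‖truncLp hW R f‖ₑ ^ 2 ≤ normSqB n (trunc R f) :=
  le_of_tendsto_of_tendsto' (tendsto_enorm_sq (tendsto_stepLp hW R hf))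
    (tendsto_normSqB_stepFun hf R) fun N => enorm_stepLp_sq_le hW R N f

lemma enorm_truncLp_sub_sq_le (hW : IsWhiteNoise W) (R R' : ℕ) {f : (Fin n → E d) → ℝ}
    (hf : Continuous f) :
    ‖truncLp hW R f - truncLp hW R' f‖ₑ ^ 2 ≤ normSqB n (trunc R f - trunc R' f) :=
  le_of_tendsto_of_tendsto' (tendsto_enorm_sq ((tendsto_stepLp hW R hf).sub
    (tendsto_stepLp hW R' hf))) (tendsto_normSqB_stepFun_sub hf hf R R' tendsto_id tendsto_id)
    fun N => enorm_stepLp_sub_sq_le hW R N R' N f f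

lemma measurable_normSqB {X : Type*} [MeasurableSpace X] {h : X → (Fin n → E d) → ℝ}
    (hm : Measurable (Function.uncurry h)) : Measurable fun s => normSqB n (h s) := by
  unfold normSqB
  refine Finset.measurable_fun_sum _ fun l _ => ?_
  refine Measurable.lintegral_prod_right' (f := fun q : X × (l.A₀ → E d) =>
    ‖h q.1 (l.left q.2)‖ₑ * ‖h q.1 (l.right q.2)‖ₑ) ?_
  have h1 : Measurable fun q : X × (l.A₀ → E d) => h q.1 (l.left q.2) :=
    hm.comp (measurable_fst.prodMk (l.measurable_left.comp measurable_snd))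
  have h2 : Measurable fun q : X × (l.A₀ → E d) => h q.1 (l.right q.2) :=
    hm.comp (measurable_fst.prodMk (l.measurable_right.comp measurable_snd))
  exact h1.enorm.mul h2.enorm

/-- Continuous kernels of finite norm. -/
structure ContB (n : ℕ) (f : (Fin n → E d) → ℝ) : Prop where
  continuous : Continuous f
  norm_ne_top : normSqB n f ≠ ∞

lemma ContB.const_mul {f : (Fin n → E d) → ℝ} (hf : ContB n f) (c : ℝ) :
    ContB n (fun y => c * f y) :=
  ⟨continuous_const.mul hf.continuous, by
    rw [normSqB_const_mul]; exact ENNReal.mul_ne_top (by finiteness) hf.norm_ne_top⟩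

/-- The iterated Stratonovich integral of a continuous kernel. -/
def stratLp (hW : IsWhiteNoise W) (f : (Fin n → E d) → ℝ) : Lp ℝ 2 μ :=
  limUnder atTop (fun R => truncLp hW R f)

lemma tendsto_truncLp (hW : IsWhiteNoise W) {f : (Fin n → E d) → ℝ} (hf : ContB n f) :
    Tendsto (fun R => truncLp hW R f) atTop (𝓝 (stratLp hW f)) := by
  have h1 : Tendsto (Prod.fst : ℕ × ℕ → ℕ) atTop atTop := by
    rw [← prod_atTop_atTop_eq]; exact tendsto_fst
  have h2 : Tendsto (Prod.snd : ℕ × ℕ → ℕ) atTop atTop := by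
    rw [← prod_atTop_atTop_eq]; exact tendsto_snd
  obtain ⟨D, hD⟩ : ∃ D : ℕ × ℕ → (Fin n → E d) → ℝ, ∀ p, D p = trunc p.1 f - trunc p.2 f :=
    ⟨_, fun _ => rfl⟩
  have h : Tendsto (fun p => normSqB n (D p)) atTop (𝓝 (normSqB n (0 : (Fin n → E d) → ℝ))) := by
    -- Differences of truncations are dominated by |f| itself, whose norm is finite by hypothesis,
    -- and vanish pointwise in the limit.
    refine tendsto_normSqB (b := fun y => ‖f y‖ₑ) (fun p => ?_) hf.norm_ne_top (fun p y => ?_)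
      (fun y => ?_)
    · rw [hD]
      exact (measurable_trunc hf.continuous.measurable _).sub
        (measurable_trunc hf.continuous.measurable _)
    · rw [hD]
      exact enorm_trunc_sub_trunc_le _ _ f y
    · have h3 := ((tendsto_trunc f y).comp h1).sub ((tendsto_trunc f y).comp h2)
      rw [sub_self] at h3
      simp only [hD]
      exact h3
  rw [normSqB_zero] at h
  refine CauchySeq.tendsto_limUnder (cauchySeq_of_enorm_sq_le h fun p => ?_)
  rw [hD]
  exact enorm_truncLp_sub_sq_le hW _ _ hf.continuous

lemma enorm_stratLp_sq_le (hW : IsWhiteNoise W) {f : (Fin n → E d) → ℝ} (hf : ContB n f) :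
    ‖stratLp hW f‖ₑ ^ 2 ≤ normSqB n f :=
  le_of_tendsto' (tendsto_enorm_sq (tendsto_truncLp hW hf)) fun R =>
    (enorm_truncLp_sq_le hW R hf.continuous).trans (normSqB_mono fun y => enorm_trunc_le R f y)

lemma stepLp_const_mul (hW : IsWhiteNoise W) (R N : ℕ) (f : (Fin n → E d) → ℝ) (c : ℝ) :
    stepLp hW R N (fun y => c * f y) = c • stepLp hW R N f := by
  obtain ⟨J, p, v, h⟩ := exists_stepLp_eq hW n R N
  rw [h, h, Finset.smul_sum]
  simp only [mul_smul]

lemma stratLp_const_mul (hW : IsWhiteNoise W) {f : (Fin n → E d) → ℝ} (hf : ContB n f) (c : ℝ) :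
    stratLp hW (fun y => c * f y) = c • stratLp hW f := by
  have h1 : ∀ R, truncLp hW R (fun y => c * f y) = c • truncLp hW R f := by
    intro R
    refine tendsto_nhds_unique (tendsto_stepLp hW R (hf.const_mul c).continuous) ?_
    simp only [stepLp_const_mul]
    exact (tendsto_stepLp hW R hf.continuous).const_smul c
  refine tendsto_nhds_unique (tendsto_truncLp hW (hf.const_mul c)) ?_
  simp only [h1]
  exact (tendsto_truncLp hW hf).const_smul c

lemma enorm_stratLp_le (hW : IsWhiteNoise W) {f : (Fin n → E d) → ℝ} (hf : ContB n f) :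
    ‖stratLp hW f‖ₑ ≤ normSqB n f ^ (1 / 2 : ℝ) := le_sqrt_of_sq_le (enorm_stratLp_sq_le hW hf)

lemma stronglyMeasurable_stratLp (hW : IsWhiteNoise W) {X : Type*} [MeasurableSpace X]
    {f : X → (Fin n → E d) → ℝ} (hf : ∀ x, ContB n (f x)) (hm : ∀ y, Measurable fun x => f x y) :
    StronglyMeasurable (fun x => stratLp hW (f x)) := by
  have h1 : ∀ R N, StronglyMeasurable (fun x => stepLp hW R N (f x)) := by
    intro R N
    obtain ⟨J, p, v, h⟩ := exists_stepLp_eq hW n R N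
    simp only [h]
    exact Finset.stronglyMeasurable_fun_sum _ fun j _ =>
      (hm (p j)).stronglyMeasurable.smul_const (v j)
  have h2 : ∀ R, StronglyMeasurable (fun x => truncLp hW R (f x)) := fun R =>
    stronglyMeasurable_of_tendsto atTop (h1 R)
      (tendsto_pi_nhds.mpr fun x => tendsto_stepLp hW R (hf x).continuous)
  exact stronglyMeasurable_of_tendsto atTop h2
    (tendsto_pi_nhds.mpr fun x => tendsto_truncLp hW (hf x))

lemma normSqB_le_of_enorm_le_box {f : (Fin n → E d) → ℝ} {R : ℕ} {C : ℝ≥0∞}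
    (h : ∀ y, ‖f y‖ₑ ≤ box R C y) :
    normSqB n f ≤ pairB (box (d := d) (n := n) R C) (box R C) := pairB_mono h h

/-- Iterated Stratonovich integrals commute with integrals over parameters. -/
lemma integral_stratLp (hW : IsWhiteNoise W) {X : Type*} [MeasurableSpace X] {ν : Measure X}
    {h : X → (Fin n → E d) → ℝ} (hc : ∀ s, ContB n (h s)) (hmm : Measurable (Function.uncurry h))
    {b : X → ℝ} (hb : Integrable b ν) (hhb : ∀ s y, ‖h s y‖ ≤ b s)
    (hfin : ∫⁻ s, normSqB n (h s) ^ (1 / 2 : ℝ) ∂ν ≠ ∞)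
    (hf : ContB n (fun y => ∫ s, h s y ∂ν)) :
    Integrable (fun s => stratLp hW (h s)) ν ∧
      stratLp hW (fun y => ∫ s, h s y ∂ν) = ∫ s, stratLp hW (h s) ∂ν := by
  have hm : ∀ y, Measurable fun s => h s y := fun y =>
    hmm.comp (measurable_id.prodMk measurable_const)
  have hI : Integrable (fun s => stratLp hW (h s)) ν := by
    refine ⟨(stronglyMeasurable_stratLp hW hc hm).aestronglyMeasurable, ?_⟩
    exact lt_of_le_of_lt (lintegral_mono fun s => enorm_stratLp_le hW (hc s)) hfin.lt_top
  refine ⟨hI, ?_⟩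
  have hint : ∀ y, Integrable (fun s => h s y) ν := fun y =>
    hb.mono' (hm y).aestronglyMeasurable (ae_of_all _ fun s => hhb s y)
  have hstep : ∀ R N, stepLp hW R N (fun y => ∫ s, h s y ∂ν) = ∫ s, stepLp hW R N (h s) ∂ν := by
    intro R N
    obtain ⟨J, p, v, hs⟩ := exists_stepLp_eq hW n R N
    simp only [hs]
    rw [integral_finsetSum _ fun j _ => (hint (p j)).smul_const (v j)]
    simp only [integral_smul_const]
  have hsm : ∀ R N, StronglyMeasurable (fun s => stepLp hW R N (h s)) := by
    intro R N
    obtain ⟨J, p, v, hs⟩ := exists_stepLp_eq hW n R N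
    simp only [hs]
    exact Finset.stronglyMeasurable_fun_sum _ fun j _ =>
      (hm (p j)).stronglyMeasurable.smul_const (v j)
  have htrunc : ∀ R, truncLp hW R (fun y => ∫ s, h s y ∂ν) = ∫ s, truncLp hW R (h s) ∂ν := by
    intro R
    set D : ℝ≥0∞ := pairB (box (d := d) (n := n) R 1) (box R 1) with hD
    have hDt : D ≠ ∞ := pairB_box_ne_top R (by simp)
    refine tendsto_nhds_unique (tendsto_stepLp hW R hf.continuous) ?_
    simp only [hstep]
    -- On the grid there is no domination by the norm of `h s`, since rounded values are not
    -- controlled by it. The supremum bound `b s` on a fixed ball takes its place, and `D` is the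
    -- square of the norm of the indicator of that ball.
    refine tendsto_integral_of_dominated_convergence (fun s => b s * √ D.toReal)
      (fun N => (hsm R N).aestronglyMeasurable) (hb.mul_const _) (fun N => ae_of_all _ fun s => ?_)
      (ae_of_all _ fun s => tendsto_stepLp hW R (hc s).continuous)
    have hbs : 0 ≤ b s := (norm_nonneg _).trans (hhb s 0)
    have h1 : ‖stepLp hW R N (h s)‖ₑ ^ 2 ≤ ENNReal.ofReal (b s) ^ 2 * D := by
      refine (enorm_stepLp_sq_le hW R N (h s)).trans ?_
      have h2 : ∀ y, ‖stepFun R N (h s) y‖ₑ ≤ box R (ENNReal.ofReal (b s)) y := by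
        intro y
        unfold stepFun trunc box
        split_ifs
        · rw [← ofReal_norm]
          exact ENNReal.ofReal_le_ofReal (hhb s _)
        · simp
      refine (normSqB_le_of_enorm_le_box h2).trans ?_
      rw [hD]
      unfold pairB
      rw [Finset.mul_sum]
      refine Finset.sum_le_sum fun l _ => ?_
      rw [← lintegral_const_mul' _ _ (by finiteness)]
      refine lintegral_mono fun z => ?_
      unfold box
      simp only
      split_ifs <;> simp [sq]
    have h3 : ‖stepLp hW R N (h s)‖ ^ 2 ≤ b s ^ 2 * D.toReal := by
      have := ENNReal.toReal_mono (by finiteness) h1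
      simpa [ENNReal.toReal_ofReal hbs] using this
    calc ‖stepLp hW R N (h s)‖ = √(‖stepLp hW R N (h s)‖ ^ 2) := (Real.sqrt_sq (norm_nonneg _)).symm
      _ ≤ √(b s ^ 2 * D.toReal) := Real.sqrt_le_sqrt h3
      _ = b s * √ D.toReal := by rw [Real.sqrt_mul (sq_nonneg _), Real.sqrt_sq hbs]
  refine tendsto_nhds_unique (tendsto_truncLp hW hf) ?_
  simp only [htrunc]
  -- As the radius grows, truncations are dominated by the kernel, so the root of its squared norm
  -- is now a dominating function.
  refine tendsto_integral_of_dominated_convergence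
    (fun s => (normSqB n (h s) ^ (1 / 2 : ℝ)).toReal)
    (fun R => (stronglyMeasurable_of_tendsto atTop (hsm R) (tendsto_pi_nhds.mpr fun s =>
      tendsto_stepLp hW R (hc s).continuous)).aestronglyMeasurable)
    (integrable_toReal_of_lintegral_ne_top
      ((measurable_normSqB hmm).pow_const _).aemeasurable hfin)
    (fun R => ae_of_all _ fun s => ?_) (ae_of_all _ fun s => tendsto_truncLp hW (hc s))
  rw [← toReal_enorm]
  refine ENNReal.toReal_mono
    (ENNReal.rpow_ne_top_of_nonneg (by norm_num) (hc s).norm_ne_top) ?_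
  exact le_sqrt_of_sq_le ((enorm_truncLp_sq_le hW R (hc s).continuous).trans
    (normSqB_mono fun y => enorm_trunc_le R (h s) y))

end Integral

/-! ### Identification with the iterated Stratonovich integral, and membership in `𝓑_n`. -/

section Approximation

variable {d n : ℕ} {Ω : Type*} [MeasurableSpace Ω] {μ : Measure Ω} [IsProbabilityMeasure μ]
  {W : L2 d →ₗᵢ[ℝ] Lp ℝ 2 μ}

/-- Fatou's lemma for the terms of the bilinear form of the norm. -/
lemma lintegral_pair_le_of_tendsto {a b : ℕ → (Fin n → E d) → ℝ≥0∞}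
    {a' b' : (Fin n → E d) → ℝ≥0∞} {F : ℕ → ℝ≥0∞} {A : ℝ≥0∞} (l : Pairing (n + n))
    (ham : ∀ j, Measurable (a j)) (hbm : ∀ j, Measurable (b j))
    (ha : ∀ y, Tendsto (fun j => a j y) atTop (𝓝 (a' y)))
    (hb : ∀ y, Tendsto (fun j => b j y) atTop (𝓝 (b' y)))
    (hat : ∀ y, a' y ≠ ∞) (hbt : ∀ y, b' y ≠ ∞)
    (hF : Tendsto F atTop (𝓝 A))
    (h : ∀ j, ∫⁻ z : l.A₀ → E d, a j (l.left z) * b j (l.right z) ≤ F j) :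
    ∫⁻ z : l.A₀ → E d, a' (l.left z) * b' (l.right z) ≤ A := by
  calc ∫⁻ z : l.A₀ → E d, a' (l.left z) * b' (l.right z)
      = ∫⁻ z : l.A₀ → E d, liminf (fun j => a j (l.left z) * b j (l.right z)) atTop := by
        refine lintegral_congr fun z => ?_
        exact (ENNReal.Tendsto.mul (ha _) (Or.inr (hbt _)) (hb _) (Or.inr (hat _))).liminf_eq.symm
    _ ≤ liminf (fun j => ∫⁻ z : l.A₀ → E d, a j (l.left z) * b j (l.right z)) atTop :=
        lintegral_liminf_le fun j =>
          ((ham j).comp l.measurable_left).mul ((hbm j).comp l.measurable_right)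
    _ ≤ liminf F atTop := liminf_le_liminf (Eventually.of_forall h)
    _ = A := hF.liminf_eq

lemma enorm_trunc_const (R : ℕ) (C : ℝ≥0) (y : Fin n → E d) :
    ‖trunc R (fun _ => (C : ℝ)) y‖ₑ = box R C y := by
  unfold trunc box
  split_ifs
  · change ‖(C : ℝ)‖ₑ = C
    exact (Real.enorm_of_nonneg C.coe_nonneg).trans ENNReal.ofReal_coe_nnreal
  · simp

/-- The mixed terms of a kernel of finite norm and a bounded function are finite. -/
lemma pairB_box_lt_top (hW : IsWhiteNoise W) {f : (Fin n → E d) → ℝ} (hf : ContB n f) (R : ℕ)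
    (C : ℝ≥0) :
    pairB (fun y => ‖f y‖ₑ) (box R C) < ∞ ∧ pairB (box R C) (fun y => ‖f y‖ₑ) < ∞ := by
  -- Positivity of the form is available for nonnegative combinations of products only; passing to
  -- |f| leaves the form unchanged.
  set f' : (Fin n → E d) → ℝ := fun y => |f y| with hf'
  have hf'c : Continuous f' := continuous_abs.comp hf.continuous
  have hen : ∀ y, ‖f' y‖ₑ = ‖f y‖ₑ := fun y => by simp [hf', Real.enorm_abs]
  have hstepC : ∀ N, stepFun R N (fun _ : Fin n → E d => (C : ℝ)) = trunc R fun _ => (C : ℝ) :=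
    fun N => rfl
  set B : ℝ≥0∞ := normSqB n (trunc R fun _ : Fin n → E d => (C : ℝ)) with hB
  have hBt : B ≠ ∞ := by
    rw [hB, normSqB_eq_pairB]
    simp only [enorm_trunc_const]
    exact pairB_box_ne_top R (by simp)
  have h0 : ∀ R' N y, 0 ≤ stepFun R' N f' y := by
    intro R' N y
    unfold stepFun trunc
    split_ifs
    · exact abs_nonneg _
    · exact le_rfl
  have h0' : ∀ y : Fin n → E d, 0 ≤ trunc R (fun _ => (C : ℝ)) y := by
    intro y
    unfold trunc
    split_ifs
    · exact C.2
    · exact le_rfl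
  have hstep : ∀ R' N, pairB (fun y => ‖stepFun R' N f' y‖ₑ) (box R C) +
      pairB (box R C) (fun y => ‖stepFun R' N f' y‖ₑ) ≤ normSqB n (stepFun R' N f') + B := by
    intro R' N
    have := SimpleIntegrand.pairB_add_le hW (stepInt R' N f') (stepInt R N fun _ => (C : ℝ))
      (aeeqB_stepInt R' N f') (aeeqB_stepInt R N fun _ => (C : ℝ)) (h0 R' N) (by rw [hstepC]; exact h0')
    rw [hstepC] at this
    simpa only [enorm_trunc_const] using this
  have hle : ∀ (l : Pairing (n + n)) (a b : (Fin n → E d) → ℝ≥0∞),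
      ∫⁻ z : l.A₀ → E d, a (l.left z) * b (l.right z) ≤ pairB a b := fun l a b =>
    Finset.single_le_sum (f := fun l : Pairing (n + n) =>
      ∫⁻ z : l.A₀ → E d, a (l.left z) * b (l.right z)) (fun _ _ => zero_le) (Finset.mem_univ l)
  have hboxt : ∀ y : Fin n → E d, box R (C : ℝ≥0∞) y ≠ ∞ := by
    intro y; unfold box; split_ifs <;> simp
  have hbound : Tendsto (fun R' : ℕ => normSqB n (trunc R' f') + B) atTop (𝓝 (normSqB n f + B)) := by
    refine Tendsto.add ?_ tendsto_const_nhds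
    have h1 : normSqB n f = normSqB n f' := by
      simp only [normSqB_eq_pairB, hen]
    rw [h1]
    refine tendsto_normSqB (b := fun y => ‖f y‖ₑ) (fun R' => measurable_trunc hf'c.measurable R')
      hf.norm_ne_top (fun R' y => ?_) (tendsto_trunc f')
    exact (enorm_trunc_le R' f' y).trans (hen y).le
  have hm1 : ∀ R' N, Measurable fun y => ‖stepFun R' N f' y‖ₑ :=
    fun R' N => (measurable_stepFun hf'c.measurable R' N).enorm
  have hm2 : ∀ R', Measurable fun y => ‖trunc R' f' y‖ₑ :=
    fun R' => (measurable_trunc hf'c.measurable R').enorm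
  have hmb : Measurable (box (d := d) (n := n) R (C : ℝ≥0∞)) := measurable_box R C
  have ht1 : ∀ R' y, Tendsto (fun N => ‖stepFun R' N f' y‖ₑ) atTop (𝓝 ‖trunc R' f' y‖ₑ) :=
    fun R' y => (tendsto_stepFun hf'c R' y).enorm
  have ht2 : ∀ y, Tendsto (fun R' => ‖trunc R' f' y‖ₑ) atTop (𝓝 ‖f y‖ₑ) := fun y => by
    rw [← hen]; exact (tendsto_trunc f' y).enorm
  have htop : normSqB n f + B < ∞ := ENNReal.add_lt_top.mpr ⟨hf.norm_ne_top.lt_top, hBt.lt_top⟩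
  -- Fatou's lemma is applied twice, in the grid and in the radius, to carry the bound from step
  -- functions to `f`.
  refine ⟨ENNReal.sum_lt_top.mpr fun l _ => lt_of_le_of_lt ?_ htop,
    ENNReal.sum_lt_top.mpr fun l _ => lt_of_le_of_lt ?_ htop⟩
  · refine lintegral_pair_le_of_tendsto l hm2 (fun _ => hmb) ht2 (fun _ => tendsto_const_nhds)
      (fun _ => enorm_ne_top) hboxt hbound fun R' => ?_
    refine lintegral_pair_le_of_tendsto l (hm1 R') (fun _ => hmb) (ht1 R')
      (fun _ => tendsto_const_nhds) (fun _ => enorm_ne_top) hboxt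
      ((tendsto_normSqB_stepFun hf'c R').add tendsto_const_nhds) fun N => ?_
    exact ((hle l _ _).trans le_self_add).trans (hstep R' N)
  · refine lintegral_pair_le_of_tendsto l (fun _ => hmb) hm2 (fun _ => tendsto_const_nhds) ht2
      hboxt (fun _ => enorm_ne_top) hbound fun R' => ?_
    refine lintegral_pair_le_of_tendsto l (fun _ => hmb) (hm1 R')
      (fun _ => tendsto_const_nhds) (ht1 R') hboxt (fun _ => enorm_ne_top)
      ((tendsto_normSqB_stepFun hf'c R').add tendsto_const_nhds) fun N => ?_
    exact ((hle l _ _).trans le_add_self).trans (hstep R' N)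

lemma pairB_add_box_ne_top (hW : IsWhiteNoise W) {f : (Fin n → E d) → ℝ} (hf : ContB n f) (R : ℕ)
    (C : ℝ≥0) :
    pairB ((fun y => ‖f y‖ₑ) + box R (C : ℝ≥0∞)) ((fun y => ‖f y‖ₑ) + box R (C : ℝ≥0∞)) ≠ ∞ := by
  rw [pairB_add hf.continuous.measurable.enorm (measurable_box R _), ← normSqB_eq_pairB]
  obtain ⟨h1, h2⟩ := pairB_box_lt_top hW hf R C
  have := hf.norm_ne_top
  have := pairB_box_ne_top (d := d) (n := n) R (C := C) (by simp)
  finiteness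

lemma exists_normSqB_sub_trunc_lt {f : (Fin n → E d) → ℝ} (hf : ContB n f) {ε : ℝ≥0∞} (hε : 0 < ε) :
    ∀ᶠ R in atTop, normSqB n (f - trunc R f) < ε := by
  have h : Tendsto (fun R => normSqB n (f - trunc R f)) atTop
      (𝓝 (normSqB n (0 : (Fin n → E d) → ℝ))) := by
    refine tendsto_normSqB (b := fun y => ‖f y‖ₑ)
      (fun R => hf.continuous.measurable.sub (measurable_trunc hf.continuous.measurable R))
      hf.norm_ne_top (fun R y => enorm_sub_trunc_le R f y) fun y => ?_
    have := (tendsto_trunc f y).const_sub (f y)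
    rwa [sub_self] at this
  rw [normSqB_zero] at h
  exact h.eventually_lt_const hε

/-- The constructed integral is the iterated Stratonovich integral. -/
lemma isIteratedIntegral_of_ae_eq (hW : IsWhiteNoise W) {f : (Fin n → E d) → ℝ} (hf : ContB n f)
    {X : Ω → ℝ} (hX : X =ᵐ[μ] stratLp hW f) : IsIteratedIntegral W n f X := by
  refine ⟨hf.continuous.measurable, (memLp_congr_ae hX).mpr (Lp.memLp _), fun ε hε => ?_⟩
  have hε' : 0 < ε := pos_iff_ne_zero.mpr hε
  have hε2 : 0 < ε / 2 := ENNReal.half_pos hε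
  have h1 := (EMetric.tendsto_nhds.mp (tendsto_truncLp hW hf)) (ε / 2) hε2
  obtain ⟨R, hR1, hR2⟩ := (h1.and (exists_normSqB_sub_trunc_lt hf hε')).exists
  have h2 := (EMetric.tendsto_nhds.mp (tendsto_stepLp hW R hf.continuous)) (ε / 2) hε2
  have h3 : Tendsto (fun N => normSqB n (f - stepFun R N f)) atTop
      (𝓝 (normSqB n (f - trunc R f))) := by
    obtain ⟨C, hC⟩ := exists_stepFun_bound hf.continuous R
    -- The kernel is not truncated here, while the step functions are bounded on a ball. The sum of
    -- the two dominating functions has finite norm because the mixed terms are finite.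
    refine tendsto_normSqB (b := (fun y => ‖f y‖ₑ) + box R (C : ℝ≥0∞))
      (fun N => hf.continuous.measurable.sub (measurable_stepFun hf.continuous.measurable R N))
      (pairB_add_box_ne_top hW hf R C) (fun N y => ?_)
      fun y => (tendsto_stepFun hf.continuous R y).const_sub (f y)
    exact enorm_sub_le.trans (add_le_add le_rfl (hC N y))
  obtain ⟨N, hN1, hN2⟩ := (h2.and (h3.eventually_lt_const hR2)).exists
  refine ⟨stepInt R N f, ?_, ?_⟩
  · rwa [normSqB_congr ((AEEqB.refl f).sub (aeeqB_stepInt R N f))]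
  · have h4 : eLpNorm (X - (stepInt R N f).integral W) 2 μ = ‖stratLp hW f - stepLp hW R N f‖ₑ := by
      rw [Lp.enorm_def]
      refine eLpNorm_congr_ae ?_
      refine EventuallyEq.trans ?_ (Lp.coeFn_sub _ _).symm
      exact hX.sub (MemLp.coeFn_toLp ((stepInt R N f).memLp hW)).symm
    rw [h4, ← edist_eq_enorm_sub]
    calc edist (stratLp hW f) (stepLp hW R N f)
        ≤ edist (stratLp hW f) (truncLp hW R f) + edist (truncLp hW R f) (stepLp hW R N f) :=
          edist_triangle _ _ _
      _ < ε / 2 + ε / 2 := by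
          rw [edist_comm] at hR1 hN1
          exact ENNReal.add_lt_add hR1 hN1
      _ = ε := ENNReal.add_halves ε

/-- Continuous kernels of finite norm belong to `𝓑_n`. -/
lemma ContB.memB (hW : IsWhiteNoise W) {f : (Fin n → E d) → ℝ} (hf : ContB n f) : MemB n f := by
  refine ⟨hf.continuous.measurable, fun ε hε => ?_⟩
  have hε' : 0 < ε := pos_iff_ne_zero.mpr hε
  obtain ⟨R, hR⟩ := (exists_normSqB_sub_trunc_lt hf hε').exists
  -- A continuous cutoff, 1 on the ball of radius R and 0 outside that of radius R + 1. The smooth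
  -- approximations of `f * χ` vanish wherever it does, hence have compact support.
  set χ : (Fin n → E d) → ℝ := fun y => max 0 (min 1 (R + 1 - ‖y‖)) with hχ
  have hχ0 : ∀ y, 0 ≤ χ y := fun y => le_max_left _ _
  have hχ1 : ∀ y, χ y ≤ 1 := fun y => max_le zero_le_one (min_le_left _ _)
  have hχin : ∀ y, ‖y‖ ≤ R → χ y = 1 := fun y hy => by
    rw [hχ]; simp only; rw [min_eq_left (by linarith), max_eq_right zero_le_one]
  have hχout : ∀ y, ¬ ‖y‖ ≤ R + 1 → χ y = 0 := fun y hy => by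
    rw [hχ]; simp only
    exact max_eq_left ((min_le_right _ _).trans (by linarith [not_le.mp hy]))
  set g : (Fin n → E d) → ℝ := fun y => f y * χ y with hg
  have hgc : Continuous g := hf.continuous.mul (by fun_prop)
  have hpi : ∀ (r : ℕ) (y : Fin n → E d), (∀ k, ‖y k‖ ≤ r) ↔ ‖y‖ ≤ r := fun r y =>
    (pi_norm_le_iff_of_nonneg (Nat.cast_nonneg r)).symm
  have hchoose : ∀ j : ℕ, ∃ φ : (Fin n → E d) → ℝ, ContDiff ℝ ((⊤ : ℕ∞) : WithTop ℕ∞) φ ∧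
      (∀ y, dist (φ y) (g y) < 1 / ((j : ℝ) + 1)) ∧ Function.support φ ⊆ Function.support g :=
    fun j => hgc.exists_contDiff_approx ⊤ continuous_const (fun _ => by positivity)
  choose φ hφ1 hφ2 hφ3 using hchoose
  have hφout : ∀ j y, ¬ ‖y‖ ≤ R + 1 → φ j y = 0 := fun j y hy => by
    by_contra h
    exact hφ3 j h (by simp [hg, hχout y hy])
  have hfg : ∀ y, ‖f y - g y‖ₑ ≤ ‖f y‖ₑ := fun y => by
    have h1 : f y - g y = f y * (1 - χ y) := by simp [hg]; ring
    rw [h1, enorm_mul]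
    refine (mul_le_mul' le_rfl ?_).trans (mul_one _).le
    rw [Real.enorm_of_nonneg (by linarith [hχ1 y]), ENNReal.ofReal_le_one]
    linarith [hχ0 y]
  have hlim : Tendsto (fun j => normSqB n (f - φ j)) atTop (𝓝 (normSqB n (f - g))) := by
    refine tendsto_normSqB (b := (fun y => ‖f y‖ₑ) + box (R + 1) ((1 : ℝ≥0) : ℝ≥0∞))
      (fun j => hf.continuous.measurable.sub (hφ1 j).continuous.measurable)
      (pairB_add_box_ne_top hW hf (R + 1) 1) (fun j y => ?_) fun y => ?_
    · have h1 : (f - φ j) y = (f y - g y) + (g y - φ j y) := by simp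
      rw [h1]
      refine (enorm_add_le _ _).trans (add_le_add (hfg y) ?_)
      unfold box
      split_ifs with hy
      · rw [← ofReal_norm, ← dist_eq_norm, dist_comm]
        refine ENNReal.ofReal_le_of_le_toReal ((hφ2 j y).le.trans ?_)
        simp only [ENNReal.coe_one, ENNReal.toReal_one]
        rw [div_le_one (by positivity)]
        linarith [(Nat.cast_nonneg j : (0 : ℝ) ≤ j)]
      · have hy' : ¬ ‖y‖ ≤ R + 1 := fun h => hy ((hpi (R + 1) y).mpr (by exact_mod_cast h))
        rw [hφout j y hy']
        simp [hg, hχout y hy']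
    · have h1 : Tendsto (fun j => φ j y) atTop (𝓝 (g y)) := by
        rw [tendsto_iff_dist_tendsto_zero]
        exact squeeze_zero (fun _ => dist_nonneg) (fun j => (hφ2 j y).le)
          tendsto_one_div_add_atTop_nhds_zero_nat
      exact h1.const_sub (f y)
  have hlt : normSqB n (f - g) < ε := by
    refine lt_of_le_of_lt (normSqB_mono fun y => ?_) hR
    simp only [Pi.sub_apply]
    by_cases hy : ‖y‖ ≤ R
    · simp [hg, hχin y hy]
    · unfold trunc
      rw [if_neg (fun h => hy ((hpi R y).mp h)), sub_zero]
      exact hfg y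
  obtain ⟨j, hj⟩ := (hlim.eventually_lt_const hlt).exists
  refine ⟨φ j, hφ1 j, ?_, hj⟩
  refine HasCompactSupport.intro (isCompact_closedBall (0 : Fin n → E d) (R + 1)) fun y hy => ?_
  exact hφout j y (by rwa [mem_closedBall_zero_iff] at hy)

/-- Iterated integrals of order zero are constants. -/
lemma stratLp_zero_ae_eq (hW : IsWhiteNoise W) {f : (Fin 0 → E d) → ℝ} (hf : ContB 0 f) :
    ∀ᵐ ω ∂μ, (stratLp hW f : Ω → ℝ) ω = f 0 := by
  have h1 : ∀ R N, stepLp hW R N f = Lp.const 2 μ (f 0) := by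
    intro R N
    apply Lp.ext
    refine (MemLp.coeFn_toLp ((stepInt R N f).memLp hW)).trans (EventuallyEq.trans ?_ (Lp.coeFn_const 2 μ (f 0)).symm)
    refine Eventually.of_forall fun ω => ?_
    change ∑ j : Fin (Fintype.card (GridIndex d 0 N)), f (fun k =>
      ((Fintype.equivFin (GridIndex d 0 N)).symm j k : E d)) * ∏ k : Fin 0, _ = f 0
    have h2 : ∀ y : Fin 0 → E d, f y = f 0 := fun y => by rw [Subsingleton.elim y 0]
    simp [h2]
  have h2 : ∀ R, truncLp hW R f = Lp.const 2 μ (f 0) := fun R =>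
    tendsto_nhds_unique (tendsto_stepLp hW R hf.continuous) (by simp only [h1]; exact tendsto_const_nhds)
  have h3 : stratLp hW f = Lp.const 2 μ (f 0) :=
    tendsto_nhds_unique (tendsto_truncLp hW hf) (by simp only [h2]; exact tendsto_const_nhds)
  rw [h3]
  exact Lp.coeFn_const 2 μ (f 0)

end Approximation

/-! ### Pointwise versions of functions with values in L²(Ω). -/

section Version

variable {Ω : Type*} [MeasurableSpace Ω] {μ : Measure Ω} [IsProbabilityMeasure μ]
  {X : Type*} [MeasurableSpace X]

lemma lintegral_enorm_le_of_ae_eq {f : Ω → ℝ} {g : Lp ℝ 2 μ} (h : f =ᵐ[μ] g) :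
    ∫⁻ ω, ‖f ω‖ₑ ∂μ ≤ ‖g‖ₑ := by
  rw [Lp.enorm_def, ← eLpNorm_congr_ae h, ← eLpNorm_one_eq_lintegral_enorm]
  exact eLpNorm_le_eLpNorm_of_exponent_le (by norm_num)
    ((Lp.aestronglyMeasurable g).congr h.symm)

/-- Only finitely many classes occur as values, so fixing one measurable representative of each
gives joint measurability. -/
lemma SimpleFunc.measurable_uncurry_Lp (S : SimpleFunc X (Lp ℝ 2 μ)) :
    Measurable fun q : X × Ω => (S q.1 : Ω → ℝ) q.2 := by
  have h : (fun q : X × Ω => (S q.1 : Ω → ℝ) q.2) = fun q =>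
      ∑ p ∈ S.range, (S ⁻¹' {p}).indicator (fun _ => (1 : ℝ)) q.1 * (p : Ω → ℝ) q.2 := by
    ext q
    rw [Finset.sum_eq_single (S q.1)]
    · simp
    · intro p _ hp
      rw [indicator_of_notMem (by simpa using hp.symm), zero_mul]
    · intro h
      exact absurd (SimpleFunc.mem_range_self S q.1) h
  rw [h]
  refine Finset.measurable_fun_sum _ fun p _ => Measurable.mul ?_ ?_
  · exact (measurable_const.indicator (S.measurableSet_fiber p)).comp measurable_fst
  · exact (Lp.stronglyMeasurable p).measurable.comp measurable_snd

/-- A strongly measurable `L²(Ω)`-valued function has a jointly measurable version. -/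
lemma exists_joint_version {Φ : X → Lp ℝ 2 μ} (hΦ : StronglyMeasurable Φ) :
    ∃ φ : X × Ω → ℝ, StronglyMeasurable φ ∧ ∀ x, (fun ω => φ (x, ω)) =ᵐ[μ] Φ x := by
  classical
  -- The first index with error below 2^{-k} depends measurably on `x`. Along these indices the
  -- errors are summable in L¹(Ω), hence the representatives converge almost surely for every `x`.
  have hex : ∀ (k : ℕ) (x : X), ∃ j, ‖hΦ.approx j x - Φ x‖ < (1 / 2 : ℝ) ^ k := by
    intro k x
    have h := (tendsto_iff_norm_sub_tendsto_zero.mp (hΦ.tendsto_approx x)).eventually_lt_const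
      (show (0 : ℝ) < (1 / 2) ^ k by positivity)
    exact h.exists
  have hidx : ∀ k, Measurable fun x => Nat.find (hex k x) := by
    intro k
    refine measurable_find (hex k) fun j => ?_
    exact measurableSet_lt ((hΦ.approx j).stronglyMeasurable.sub hΦ).norm.measurable
      measurable_const
  have hφm : Measurable fun r : ℕ × (X × Ω) => (hΦ.approx r.1 r.2.1 : Ω → ℝ) r.2.2 :=
    measurable_from_prod_countable_right fun j => SimpleFunc.measurable_uncurry_Lp (hΦ.approx j)
  set ψ : ℕ → X × Ω → ℝ := fun k q => (hΦ.approx (Nat.find (hex k q.1)) q.1 : Ω → ℝ) q.2 with hψ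
  have hψm : ∀ k, StronglyMeasurable (ψ k) := fun k =>
    (hφm.comp (((hidx k).comp measurable_fst).prodMk measurable_id)).stronglyMeasurable
  refine ⟨fun q => limUnder atTop fun k => ψ k q, StronglyMeasurable.limUnder hψm, fun x => ?_⟩
  have h1 : ∀ k, ∫⁻ ω, ‖ψ k (x, ω) - (Φ x : Ω → ℝ) ω‖ₑ ∂μ ≤ (2⁻¹ : ℝ≥0∞) ^ k := by
    intro k
    refine (lintegral_enorm_le_of_ae_eq (Lp.coeFn_sub (hΦ.approx (Nat.find (hex k x)) x)
      (Φ x)).symm).trans ?_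
    rw [← ofReal_norm]
    refine (ENNReal.ofReal_le_ofReal (Nat.find_spec (hex k x)).le).trans ?_
    rw [ENNReal.ofReal_pow (by norm_num), one_div, ENNReal.ofReal_inv_of_pos (by norm_num)]
    simp
  have h2 : ∫⁻ ω, ∑' k, ‖ψ k (x, ω) - (Φ x : Ω → ℝ) ω‖ₑ ∂μ ≠ ∞ := by
    rw [lintegral_tsum fun k => ?_]
    · refine ne_top_of_le_ne_top ?_ (ENNReal.tsum_le_tsum h1)
      rw [ENNReal.tsum_geometric]
      simp
    · have : Measurable fun ω => ψ k (x, ω) := (hψm k).measurable.comp measurable_prodMk_left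
      exact (this.sub (Lp.stronglyMeasurable (Φ x)).measurable).enorm.aemeasurable
  have h3 := ae_lt_top' (AEMeasurable.tsum fun k => ?_) h2
  · filter_upwards [h3] with ω hω
    have h4 := ENNReal.tendsto_atTop_zero_of_tsum_ne_top hω.ne
    have h5 : Tendsto (fun k => ψ k (x, ω)) atTop (𝓝 ((Φ x : Ω → ℝ) ω)) := by
      rw [tendsto_iff_edist_tendsto_0]
      simpa only [edist_eq_enorm_sub] using h4
    exact h5.limUnder_eq
  · have : Measurable fun ω => ψ k (x, ω) := (hψm k).measurable.comp measurable_prodMk_left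
    exact (this.sub (Lp.stronglyMeasurable (Φ x)).measurable).enorm.aemeasurable

/-- Pointwise description of the Bochner integral of an `L²(Ω)`-valued function. -/
lemma ae_integral_version {ν : Measure X} [SFinite ν] {Φ : X → Lp ℝ 2 μ} (hΦ : Integrable Φ ν)
    {φ : X × Ω → ℝ} (hφ : StronglyMeasurable φ) (h : ∀ᵐ x ∂ν, (fun ω => φ (x, ω)) =ᵐ[μ] Φ x) :
    ∀ᵐ ω ∂μ, Integrable (fun x => φ (x, ω)) ν ∧
      ((∫ x, Φ x ∂ν : Lp ℝ 2 μ) : Ω → ℝ) ω = ∫ x, φ (x, ω) ∂ν := by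
  have hint : Integrable φ (ν.prod μ) := by
    refine ⟨hφ.aestronglyMeasurable, ?_⟩
    rw [HasFiniteIntegral, lintegral_prod _ hφ.enorm.aemeasurable]
    refine lt_of_le_of_lt (lintegral_mono_ae ?_) hΦ.2
    filter_upwards [h] with x hx
    exact lintegral_enorm_le_of_ae_eq hx
  have h1 := hint.prod_left_ae
  have h2 : ((∫ x, Φ x ∂ν : Lp ℝ 2 μ) : Ω → ℝ) =ᵐ[μ] fun ω => ∫ x, φ (x, ω) ∂ν := by
    -- Both sides are tested on a set `A`: pairing with its indicator commutes with the Bochner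
    -- integral, and Fubini's theorem does the same for the version.
    refine Integrable.ae_eq_of_forall_setIntegral_eq _ _
      ((Lp.memLp _).integrable (by norm_num)) hint.integral_prod_right fun A hA _ => ?_
    have hAt : μ A ≠ ∞ := measure_ne_top μ A
    have hintA : Integrable (Function.uncurry fun x ω => φ (x, ω)) (ν.prod (μ.restrict A)) := by
      refine Integrable.mono_measure hint ?_
      exact Measure.prod_mono le_rfl Measure.restrict_le_self
    calc ∫ ω in A, ((∫ x, Φ x ∂ν : Lp ℝ 2 μ) : Ω → ℝ) ω ∂μ
        = inner ℝ (indicatorConstLp 2 hA hAt (1 : ℝ)) (∫ x, Φ x ∂ν) :=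
          (L2.inner_indicatorConstLp_one hA hAt _).symm
      _ = ∫ x, inner ℝ (indicatorConstLp 2 hA hAt (1 : ℝ)) (Φ x) ∂ν := (integral_inner hΦ _).symm
      _ = ∫ x, ∫ ω in A, φ (x, ω) ∂μ ∂ν := by
          refine integral_congr_ae ?_
          filter_upwards [h] with x hx
          rw [L2.inner_indicatorConstLp_one hA hAt]
          exact integral_congr_ae (ae_restrict_of_ae hx.symm)
      _ = ∫ ω in A, ∫ x, φ (x, ω) ∂ν ∂μ := integral_integral_swap hintA
  filter_upwards [h1, h2] with ω hω hω' using ⟨hω, hω'⟩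

end Version

/-! ### Time integrals -/

section Time

/-- The normalized powers `t^{a-1} / Γ(a)` on the positive half-line. -/
def powerDensity (a t : ℝ) : ℝ≥0∞ :=
  if 0 < t then ENNReal.ofReal (t ^ (a - 1) / Real.Gamma a) else 0

@[fun_prop]
lemma measurable_powerDensity (a : ℝ) : Measurable (powerDensity a) := by
  unfold powerDensity
  exact Measurable.ite measurableSet_Ioi (by fun_prop) measurable_const

lemma powerDensity_of_nonpos {a t : ℝ} (ht : t ≤ 0) : powerDensity a t = 0 :=
  if_neg (not_lt.mpr ht)

lemma lintegral_comp_mul_left_pos {f : ℝ → ℝ≥0∞} (hf : Measurable f) {t : ℝ} (ht : 0 < t) :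
    ∫⁻ r, f r = ENNReal.ofReal t * ∫⁻ x, f (t * x) := by
  have h := Real.smul_map_volume_mul_left ht.ne'
  conv_lhs => rw [← h]
  rw [lintegral_smul_measure, lintegral_map hf (measurable_const_mul t), abs_of_pos ht,
    smul_eq_mul]

/-- Scaling the variable by `t` reduces the convolution to the beta density, whose total mass is
one. The normalization by Γ makes the powers a convolution semigroup. -/
lemma lintegral_powerDensity_conv {a b : ℝ} (ha : 0 < a) (hb : 0 < b) (t : ℝ) :
    ∫⁻ r, powerDensity a r * powerDensity b (t - r) = powerDensity (a + b) t := by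
  rcases le_or_gt t 0 with ht | ht
  · rw [powerDensity_of_nonpos ht, lintegral_eq_zero_iff (by fun_prop)]
    refine ae_of_all _ fun r => ?_
    rcases le_or_gt r 0 with hr | hr
    · simp [powerDensity_of_nonpos hr]
    · simp [powerDensity_of_nonpos (show t - r ≤ 0 by linarith)]
  · rw [lintegral_comp_mul_left_pos (by fun_prop) ht]
    have key : ∀ x, powerDensity a (t * x) * powerDensity b (t - t * x)
        = ENNReal.ofReal (t ^ (a + b - 2) / Real.Gamma (a + b)) * betaPDF a b x := by
      intro x
      have h1 : 0 < t * x ↔ 0 < x := by rw [mul_pos_iff_of_pos_left ht]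
      have h2 : t - t * x = t * (1 - x) := by ring
      have h3 : 0 < t * (1 - x) ↔ x < 1 := by rw [mul_pos_iff_of_pos_left ht, sub_pos]
      rw [h2]
      unfold powerDensity
      simp only [h1, h3]
      by_cases hx0 : 0 < x
      · by_cases hx1 : x < 1
        · have e1 := Real.Gamma_pos_of_pos ha
          have e2 := Real.Gamma_pos_of_pos hb
          have e3 := Real.Gamma_pos_of_pos (add_pos ha hb)
          have e5 : 0 < 1 - x := by linarith
          rw [if_pos hx0, if_pos hx1, betaPDF_of_pos_lt_one hx0 hx1,
            ← ENNReal.ofReal_mul (by positivity), ← ENNReal.ofReal_mul (by positivity)]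
          congr 1
          rw [Real.mul_rpow ht.le hx0.le, Real.mul_rpow ht.le e5.le, beta,
            show a + b - 2 = (a - 1) + (b - 1) by ring, Real.rpow_add ht]
          field_simp
        · rw [if_neg hx1, mul_zero, betaPDF_eq_zero_of_one_le (not_lt.mp hx1), mul_zero]
      · rw [if_neg hx0, zero_mul, betaPDF_eq_zero_of_nonpos (not_lt.mp hx0), mul_zero]
    simp only [key]
    rw [lintegral_const_mul' _ _ (by finiteness), lintegral_betaPDF_eq_one ha hb, mul_one,
      ← ENNReal.ofReal_mul ht.le]
    unfold powerDensity
    rw [if_pos ht]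
    congr 1
    rw [show a + b - 1 = 1 + (a + b - 2) by ring, Real.rpow_add ht, Real.rpow_one]
    ring

lemma lintegral_fin_succ {n : ℕ} {f : (Fin (n + 1) → ℝ) → ℝ≥0∞} (hf : Measurable f) :
    ∫⁻ θ, f θ = ∫⁻ r : ℝ, ∫⁻ θ : Fin n → ℝ, f (Fin.cons r θ) := by
  have h := (volume_preserving_piFinSuccAbove (fun _ : Fin (n + 1) => ℝ) 0).symm
  rw [← h.lintegral_comp_emb (MeasurableEquiv.measurableEmbedding _)]
  change ∫⁻ p : ℝ × (Fin n → ℝ), _ ∂(volume.prod volume) = _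
  rw [lintegral_prod _ (by
    exact (hf.comp (MeasurableEquiv.measurable _)).aemeasurable)]
  refine lintegral_congr fun r => lintegral_congr fun θ => congrArg f ?_
  exact Fin.insertNth_zero' r θ

/-- Dirichlet's integral over a simplex, as an iterated convolution. -/
lemma lintegral_powerDensity_pi {n : ℕ} (a : Fin n → ℝ) (ha : ∀ k, 0 < a k) {b : ℝ} (hb : 0 < b)
    (t : ℝ) :
    ∫⁻ θ : Fin n → ℝ, (∏ k, powerDensity (a k) (θ k)) * powerDensity b (t - ∑ k, θ k)
      = powerDensity (∑ k, a k + b) t := by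
  induction n generalizing t with
  | zero =>
    simp [volume_pi]
  | succ n ih =>
    rw [lintegral_fin_succ (by fun_prop)]
    simp only [Fin.prod_univ_succ, Fin.sum_univ_succ, Fin.cons_zero, Fin.cons_succ, ← sub_sub,
      mul_assoc]
    have h1 : ∀ r, ∫⁻ θ : Fin n → ℝ, powerDensity (a 0) r *
        ((∏ k, powerDensity (a k.succ) (θ k)) * powerDensity b (t - r - ∑ k, θ k))
        = powerDensity (a 0) r * powerDensity (∑ k : Fin n, a k.succ + b) (t - r) := by
      intro r
      rw [lintegral_const_mul _ (by fun_prop), ih (fun k => a k.succ) (fun k => ha _)]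
    simp only [h1]
    rw [lintegral_powerDensity_conv (ha 0) (add_pos_of_nonneg_of_pos
      (Finset.sum_nonneg fun k _ => (ha _).le) hb), add_assoc]

/-- The two weights in time: `1` or `r^{-α}`, on the positive half-line. -/
def timeWeight (α : ℝ) (o : Bool) (r : ℝ) : ℝ≥0∞ :=
  if 0 < r then (if o then ENNReal.ofReal (r ^ (-α)) else 1) else 0

/-- The exponents that correspond to the weights in time. -/
def timeExp (α : ℝ) (o : Bool) : ℝ := if o then 1 - α else 1

@[fun_prop]
lemma measurable_timeWeight (α : ℝ) (o : Bool) : Measurable (timeWeight α o) := by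
  unfold timeWeight
  refine Measurable.ite measurableSet_Ioi ?_ measurable_const
  cases o
  · simp
  · simp only [if_true]; fun_prop

lemma timeExp_pos {α : ℝ} (hα : α < 1) (o : Bool) : 0 < timeExp α o := by
  unfold timeExp; split_ifs <;> linarith

/-- The constant that relates the weights and the normalized powers. -/
def weightConst (α : ℝ) : ℝ≥0 := (max 1 (Real.Gamma (1 - α))).toNNReal

lemma timeWeight_le {α : ℝ} (hα : α < 1) (o : Bool) (r : ℝ) :
    timeWeight α o r ≤ weightConst α * powerDensity (timeExp α o) r := by
  unfold timeWeight powerDensity timeExp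
  have h1 : (weightConst α : ℝ≥0∞) = ENNReal.ofReal (max 1 (Real.Gamma (1 - α))) := rfl
  split_ifs with hr ho
  · rw [h1, ← ENNReal.ofReal_mul (by positivity)]
    refine ENNReal.ofReal_le_ofReal ?_
    have h2 := Real.Gamma_pos_of_pos (show 0 < 1 - α by linarith)
    rw [show 1 - α - 1 = -α by ring, ← mul_div_assoc, le_div_iff₀ h2, mul_comm]
    exact mul_le_mul_of_nonneg_right (le_max_right _ _) (by positivity)
  · simp only [sub_self, Real.rpow_zero, Real.Gamma_one, div_one, ENNReal.ofReal_one, mul_one, h1]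
    rw [← ENNReal.ofReal_one]
    exact ENNReal.ofReal_le_ofReal (le_max_left _ _)
  · simp

/-- The gaps between the times of a path of total duration `t`. -/
def gaps {n : ℕ} (t : ℝ) (θ : Fin n → ℝ) : Fin (n + 1) → ℝ := Fin.snoc (α := fun _ => ℝ) θ (t - ∑ k, θ k)

@[fun_prop]
lemma measurable_gaps {n : ℕ} (t : ℝ) : Measurable (gaps (n := n) t) := by
  refine measurable_pi_lambda _ fun k => ?_
  refine Fin.lastCases ?_ (fun j => ?_) k
  · simp only [gaps, Fin.snoc_last]; fun_prop
  · simp only [gaps, Fin.snoc_castSucc]; fun_prop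

lemma gaps_cons {n : ℕ} (t r : ℝ) (θ : Fin n → ℝ) :
    gaps t (Fin.cons r θ : Fin (n + 1) → ℝ) = Fin.cons r (gaps (t - r) θ) := by
  unfold gaps
  rw [Fin.cons_snoc_eq_snoc_cons, Fin.sum_univ_succ]
  simp only [Fin.cons_zero, Fin.cons_succ, sub_sub]

/-- Each step bounded by a supremum lowers the total exponent by α; the integral over all gaps is
then a single normalized power of the duration. -/
lemma lintegral_timeWeight_le {α : ℝ} (hα : α < 1) {n : ℕ} (o : Fin (n + 1) → Bool) (t : ℝ) :
    ∫⁻ θ : Fin n → ℝ, ∏ k, timeWeight α (o k) (gaps t θ k)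
      ≤ (weightConst α : ℝ≥0∞) ^ (n + 1) * powerDensity (∑ k, timeExp α (o k)) t := by
  calc ∫⁻ θ : Fin n → ℝ, ∏ k, timeWeight α (o k) (gaps t θ k)
      ≤ ∫⁻ θ : Fin n → ℝ, (weightConst α : ℝ≥0∞) ^ (n + 1) *
          ((∏ k : Fin n, powerDensity (timeExp α (o k.castSucc)) (θ k)) *
            powerDensity (timeExp α (o (Fin.last n))) (t - ∑ k, θ k)) := by
        refine lintegral_mono fun θ => ?_
        refine (Finset.prod_le_prod' fun k _ => timeWeight_le hα (o k) _).trans ?_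
        rw [Finset.prod_mul_distrib, Finset.prod_const, Finset.card_univ, Fintype.card_fin,
          Fin.prod_univ_castSucc]
        simp only [gaps, Fin.snoc_castSucc, Fin.snoc_last]
        exact le_rfl
    _ = (weightConst α : ℝ≥0∞) ^ (n + 1) * powerDensity (∑ k, timeExp α (o k)) t := by
        rw [lintegral_const_mul _ (by fun_prop),
          lintegral_powerDensity_pi _ (fun k => timeExp_pos hα _) (timeExp_pos hα _),
          Fin.sum_univ_castSucc]

/-- A substitute for Stirling's formula in which the point `c` is free: the Gamma integral is
restricted to [c, c+1]. The factor 1/2 covers a < 1, where the power decreases by at most a factor 2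
since x/c ≤ 2. -/
lemma Gamma_ge {a c : ℝ} (ha : 0 < a) (hc : 1 ≤ c) :
    Real.exp (-(c + 1)) / 2 * c ^ (a - 1) ≤ Real.Gamma a := by
  rw [Real.Gamma_eq_integral ha]
  have hc0 : 0 < c := by linarith
  have hint := Real.GammaIntegral_convergent ha
  have hsub : Icc c (c + 1) ⊆ Ioi (0 : ℝ) := fun x hx => lt_of_lt_of_le hc0 hx.1
  calc Real.exp (-(c + 1)) / 2 * c ^ (a - 1)
      = ∫ x in Icc c (c + 1), Real.exp (-(c + 1)) / 2 * c ^ (a - 1) := by simp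
    _ ≤ ∫ x in Icc c (c + 1), Real.exp (-x) * x ^ (a - 1) := by
        refine setIntegral_mono_on continuousOn_const.integrableOn_Icc (hint.mono_set hsub) measurableSet_Icc fun x hx => ?_
        have hx0 : 0 < x := hsub hx
        have h1 : Real.exp (-(c + 1)) ≤ Real.exp (-x) := Real.exp_le_exp.mpr (by linarith [hx.2])
        have h2 : c ^ (a - 1) / 2 ≤ x ^ (a - 1) := by
          have h3 : 1 ≤ x / c := (one_le_div hc0).mpr hx.1
          have h4 : x / c ≤ 2 := (div_le_iff₀ hc0).mpr (by linarith [hx.2])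
          have h5 : (1 / 2 : ℝ) ≤ (x / c) ^ (a - 1) := by
            rcases le_or_gt 1 a with h | h
            · exact le_trans (by norm_num) (Real.one_le_rpow h3 (by linarith))
            · calc (1 / 2 : ℝ) = 2 ^ (-1 : ℝ) := by rw [Real.rpow_neg_one]; norm_num
                _ ≤ 2 ^ (a - 1) := Real.rpow_le_rpow_of_exponent_le (by norm_num) (by linarith)
                _ ≤ (x / c) ^ (a - 1) :=
                  Real.rpow_le_rpow_of_nonpos (by linarith) h4 (by linarith)
          rw [Real.div_rpow hx0.le hc0.le, le_div_iff₀ (by positivity)] at h5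
          linarith
        calc Real.exp (-(c + 1)) / 2 * c ^ (a - 1) = Real.exp (-(c + 1)) * (c ^ (a - 1) / 2) := by ring
          _ ≤ Real.exp (-x) * x ^ (a - 1) := by gcongr
    _ ≤ ∫ x in Ioi 0, Real.exp (-x) * x ^ (a - 1) := by
        refine setIntegral_mono_set hint ?_ hsub.eventuallyLE
        filter_upwards [ae_restrict_mem measurableSet_Ioi] with x hx
        have : (0 : ℝ) < x := hx
        simp only [Pi.zero_apply]
        positivity

/-- Since `c` does not depend on `a`, the choice c = n + 1 treats all exponents that occur at level
n with the same base t/(n+1), and these bounds multiply by adding exponents. -/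
lemma powerDensity_le {a c t : ℝ} (ha : 0 < a) (hc : 1 ≤ c) (ht : 0 < t) :
    powerDensity a t ≤ ENNReal.ofReal (2 * Real.exp (c + 1) * (t / c) ^ (a - 1)) := by
  unfold powerDensity
  rw [if_pos ht]
  refine ENNReal.ofReal_le_ofReal ?_
  have hc0 : 0 < c := by linarith
  rw [div_le_iff₀ (Real.Gamma_pos_of_pos ha), Real.div_rpow ht.le hc0.le]
  have h := Gamma_ge ha hc
  have h1 : 0 < c ^ (a - 1) := by positivity
  have h2 : 0 < t ^ (a - 1) := by positivity
  calc t ^ (a - 1) = 2 * Real.exp (c + 1) * (t ^ (a - 1) / c ^ (a - 1)) *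
        (Real.exp (-(c + 1)) / 2 * c ^ (a - 1)) := by
        rw [Real.exp_neg]
        field_simp
    _ ≤ _ := by gcongr

end Time

/-! ### Integrals along walks -/

section Walk

variable {κ X : Type*} [Fintype κ] [DecidableEq κ] [MeasureSpace X]
  [SigmaFinite (volume : Measure X)]

/-- The number of flags that are set. -/
def flagCount {n : ℕ} (o : Fin n → Bool) : ℕ := ∑ k, (o k).toNat

/-- The position of a site: the root has position `x`, the vertex `k` has position `z k`. -/
def sitePos (x : X) (z : κ → X) (s : Option κ) : X := s.elim x z

@[fun_prop]
lemma measurable_sitePos (x : X) (s : Option κ) : Measurable fun z : κ → X => sitePos x z s := by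
  cases s
  · exact measurable_const
  · exact measurable_pi_apply _

lemma sitePos_update (x : X) (z : κ → X) {w : κ} (a : X) {s : Option κ} (hs : s ≠ some w) :
    sitePos x (Function.update z w a) s = sitePos x z s := by
  cases s with
  | none => rfl
  | some k =>
    have : k ≠ w := fun h => hs (by rw [h])
    simp [sitePos, this]

lemma lmarginal_mul_const (V : Finset κ) {f : (κ → X) → ℝ≥0∞} (hf : Measurable f) (c : ℝ≥0∞)
    (z : κ → X) :
    (∫⋯∫⁻_V, (fun z => f z * c) ∂fun _ => volume) z = (∫⋯∫⁻_V, f ∂fun _ => volume) z * c := by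
  unfold lmarginal
  rw [lintegral_mul_const]
  exact hf.comp measurable_updateFinset

/-- Integration along a walk: a step to a new vertex costs an integral, and a step to a
vertex that was visited before costs a supremum.  The flags mark the steps of the second kind. -/
theorem exists_walk_flags {n : ℕ} (Y : Fin (n + 1) → Option κ) (V : Finset κ)
    (h0 : ∀ k, Y 0 = some k → k ∈ V) :
    ∃ (V' : Finset κ) (o : Fin n → Bool), V ⊆ V' ∧ (∀ i k, Y i = some k → k ∈ V') ∧
      flagCount o + V'.card = n + V.card ∧
      ∀ (x : X) (q : Fin n → X → X → ℝ≥0∞) (c : Fin n → Bool → ℝ≥0∞),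
        (∀ k, Measurable (Function.uncurry (q k))) →
        (∀ k a, ∫⁻ b, q k a b ≤ c k false) → (∀ k a b, q k a b ≤ c k true) →
        ∀ f : (κ → X) → ℝ≥0∞, Measurable f →
        (∀ w ∉ V, ∀ z a, f (Function.update z w a) = f z) →
        ∀ B, (∀ z, (∫⋯∫⁻_V, f ∂fun _ => volume) z ≤ B) → ∀ z,
          (∫⋯∫⁻_V', (fun z => f z * ∏ k, q k (sitePos x z (Y k.castSucc)) (sitePos x z (Y k.succ)))
            ∂fun _ => volume) z ≤ B * ∏ k, c k (o k) := by
  induction n with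
  | zero =>
    refine ⟨V, Fin.elim0, subset_rfl, fun i k h => h0 k (by rwa [Fin.fin_one_eq_zero i] at h),
      by simp [flagCount], ?_⟩
    intro x q c _ _ _ f _ _ B hB z
    simpa using hB z
  | succ n ih =>
    obtain ⟨V', o, hV, hY, hcard, H⟩ := ih (fun i => Y i.castSucc) h0
    have hmeas : ∀ (x : X) (q : Fin (n + 1) → X → X → ℝ≥0∞),
        (∀ k, Measurable (Function.uncurry (q k))) → ∀ f : (κ → X) → ℝ≥0∞, Measurable f →
        Measurable fun z => f z * ∏ k : Fin n, q k.castSucc (sitePos x z (Y k.castSucc.castSucc))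
          (sitePos x z (Y k.succ.castSucc)) := by
      intro x q hq f hf
      refine hf.mul (Finset.measurable_prod _ fun k _ => ?_)
      exact (hq k.castSucc).comp (by fun_prop :
        Measurable fun z => (sitePos x z (Y k.castSucc.castSucc), sitePos x z (Y k.succ.castSucc)))
    by_cases hnew : ∃ w, Y (Fin.last (n + 1)) = some w ∧ w ∉ V'
    · obtain ⟨w, hw, hwV⟩ := hnew
      refine ⟨insert w V', Fin.snoc (α := fun _ => Bool) o false,
        hV.trans (Finset.subset_insert _ _), ?_, ?_, ?_⟩
      · intro i
        refine Fin.lastCases (fun k hk => ?_) (fun j k hk => ?_) i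
        · rw [hw] at hk
          simp [Option.some.inj hk]
        · exact Finset.mem_insert_of_mem (hY j k hk)
      · rw [Finset.card_insert_of_notMem hwV]
        simp only [flagCount, Fin.sum_univ_castSucc, Fin.snoc_castSucc, Fin.snoc_last,
          Bool.toNat_false] at hcard ⊢
        omega
      · intro x q c hq hq0 hq1 f hf hdep B hB z
        have H' := H x (fun k => q k.castSucc) (fun k => c k.castSucc) (fun k => hq _)
          (fun k => hq0 _) (fun k => hq1 _) f hf hdep B hB z
        have hm := hmeas x q hq f hf
        -- The new variable is integrated innermost. Neither `f` nor the earlier factors depend on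
        -- it, so only the last kernel is integrated and its mass bound applies.
        rw [lmarginal_insert' _ _ hwV]
        · rw [Fin.prod_univ_castSucc]
          simp only [Fin.snoc_castSucc, Fin.snoc_last]
          rw [← mul_assoc]
          refine le_trans (lmarginal_mono (fun z => ?_) z) (le_trans
            (lmarginal_mul_const V' hm (c (Fin.last n) false) z).le (mul_le_mul_left H' _))
          have hs : ∀ i : Fin (n + 1), Y i.castSucc ≠ some w := fun i h => hwV (hY i w h)
          have hfw : ∀ a, f (Function.update z w a) = f z := fun a =>
            hdep w (fun h => hwV (hV h)) z a
          simp only [Fin.prod_univ_castSucc, Fin.succ_last, Fin.succ_castSucc, hfw,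
            sitePos_update x z _ (hs _), ← mul_assoc]
          rw [lintegral_const_mul]
          · refine mul_le_mul_right (le_trans (le_of_eq ?_) (hq0 (Fin.last n)
              (sitePos x z (Y (Fin.last n).castSucc)))) _
            simp [hw, sitePos]
          · rw [hw]
            simp only [sitePos, Option.elim_some, Function.update_self]
            exact (hq _).of_uncurry_left
        · refine hf.mul (Finset.measurable_prod _ fun k _ => ?_)
          exact (hq k).comp (by fun_prop :
            Measurable fun z => (sitePos x z (Y k.castSucc), sitePos x z (Y k.succ)))
    · push Not at hnew
      refine ⟨V', Fin.snoc (α := fun _ => Bool) o true, hV, ?_, ?_, ?_⟩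
      · intro i
        refine Fin.lastCases (fun k hk => hnew k hk) (fun j k hk => hY j k hk) i
      · simp only [flagCount, Fin.sum_univ_castSucc, Fin.snoc_castSucc, Fin.snoc_last,
          Bool.toNat_true] at hcard ⊢
        omega
      · intro x q c hq hq0 hq1 f hf hdep B hB z
        have H' := H x (fun k => q k.castSucc) (fun k => c k.castSucc) (fun k => hq _)
          (fun k => hq0 _) (fun k => hq1 _) f hf hdep B hB z
        have hm := hmeas x q hq f hf
        rw [Fin.prod_univ_castSucc]
        simp only [Fin.snoc_castSucc, Fin.snoc_last]
        rw [← mul_assoc]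
        refine le_trans (lmarginal_mono (fun z => ?_) z) (le_trans
          (lmarginal_mul_const V' hm (c (Fin.last n) true) z).le (mul_le_mul_left H' _))
        simp only [Fin.prod_univ_castSucc, Fin.succ_last, Fin.succ_castSucc, ← mul_assoc]
        exact mul_le_mul_right (hq1 _ _ _) _

end Walk

/-! ### Paths of Green's functions -/

section Paths

variable {d : ℕ}

/-- Bounds on a family of kernels, extended by zero to all times: the mass is bounded, and the
supremum is bounded by a multiple of `r^{-α}`. -/
structure GreenKernel (α : ℝ) (K : ℝ≥0∞) (g : ℝ → E d → E d → ℝ) : Prop where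
  lt_one : α < 1
  nonneg : 0 ≤ α
  ne_top : K ≠ ∞
  measurable : Measurable fun p : ℝ × E d × E d => g p.1 p.2.1 p.2.2
  continuous : ∀ r, Continuous (Function.uncurry (g r))
  symm : ∀ r x y, g r x y = g r y x
  mass_le : ∀ r x, ∫⁻ y, ‖g r x y‖ₑ ≤ K * timeWeight α false r
  sup_le : ∀ r x y, ‖g r x y‖ₑ ≤ K * timeWeight α true r

/-- The action of the absolute value of a kernel on the absolute value of a function. -/
def absFlow (g : ℝ → E d → E d → ℝ) (u : E d → ℝ) (r : ℝ) (y : E d) : ℝ≥0∞ :=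
  ∫⁻ ξ, ‖g r y ξ‖ₑ * ‖u ξ‖ₑ

/-- The weight of a path `y` with gaps `γ` between the times of its points. -/
def pathWeight (g : ℝ → E d → E d → ℝ) (u : E d → ℝ) {n : ℕ} (γ : Fin (n + 1) → ℝ)
    (y : Fin (n + 1) → E d) : ℝ≥0∞ :=
  (∏ k : Fin n, ‖g (γ k.castSucc) (y k.castSucc) (y k.succ)‖ₑ) *
    absFlow g u (γ (Fin.last n)) (y (Fin.last n))

lemma pathWeight_cons (g : ℝ → E d → E d → ℝ) (u : E d → ℝ) {n : ℕ} (r : ℝ) (γ : Fin (n + 1) → ℝ)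
    (x : E d) (y : Fin (n + 1) → E d) :
    pathWeight g u (Fin.cons r γ : Fin (n + 2) → ℝ) (Fin.cons x y : Fin (n + 2) → E d)
      = ‖g r x (y 0)‖ₑ * pathWeight g u γ y := by
  unfold pathWeight
  simp only [Fin.prod_univ_succ, ← Fin.succ_last, Fin.cons_succ, Fin.castSucc_zero, Fin.cons_zero,
    ← Fin.succ_castSucc, mul_assoc]

variable {α : ℝ} {K : ℝ≥0∞} {g : ℝ → E d → E d → ℝ} {u : E d → ℝ}

lemma GreenKernel.measurable_absFlow (hg : GreenKernel α K g) (hu : Measurable u) :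
    Measurable fun p : ℝ × E d => absFlow g u p.1 p.2 := by
  refine Measurable.lintegral_prod_right' (f := fun q : (ℝ × E d) × E d =>
    ‖g q.1.1 q.1.2 q.2‖ₑ * ‖u q.2‖ₑ) ?_
  exact ((hg.measurable.comp (by fun_prop : Measurable fun q : (ℝ × E d) × E d =>
    (q.1.1, q.1.2, q.2))).enorm).mul (hu.comp measurable_snd).enorm

lemma GreenKernel.absFlow_le (hg : GreenKernel α K g) (r : ℝ) (y : E d) :
    absFlow g u r y ≤ K * (∫⁻ ξ, ‖u ξ‖ₑ) * timeWeight α true r := by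
  unfold absFlow
  calc _ ≤ ∫⁻ ξ, K * timeWeight α true r * ‖u ξ‖ₑ :=
        lintegral_mono fun ξ => mul_le_mul_left (hg.sup_le _ _ _) _
    _ ≤ _ := by
        rw [lintegral_const_mul']
        · exact le_of_eq (by ring)
        · refine ENNReal.mul_ne_top hg.ne_top ?_
          unfold timeWeight
          split_ifs <;> simp

lemma GreenKernel.lintegral_absFlow_le (hg : GreenKernel α K g) (hu : Measurable u) (r : ℝ) :
    ∫⁻ y, absFlow g u r y ≤ K * (∫⁻ ξ, ‖u ξ‖ₑ) * timeWeight α false r := by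
  unfold absFlow
  rw [lintegral_lintegral_swap]
  · calc _ ≤ ∫⁻ ξ, K * timeWeight α false r * ‖u ξ‖ₑ := by
          refine lintegral_mono fun ξ => ?_
          rw [lintegral_mul_const' _ _ (by simp)]
          refine mul_le_mul_left ?_ _
          simp only [hg.symm r _ ξ]
          exact hg.mass_le _ _
      _ ≤ _ := by
          rw [lintegral_const_mul _ hu.enorm]
          exact le_of_eq (by ring)
  · exact ((hg.continuous r).measurable.enorm.mul (hu.comp measurable_snd).enorm).aemeasurable

lemma GreenKernel.measurable_pathWeight (hg : GreenKernel α K g) (hu : Measurable u) {n : ℕ} :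
    Measurable fun p : (Fin (n + 1) → ℝ) × (Fin (n + 1) → E d) => pathWeight g u p.1 p.2 := by
  unfold pathWeight
  refine (Finset.measurable_prod _ fun k _ => ?_).mul ?_
  · exact (hg.measurable.comp (by fun_prop : Measurable
      fun p : (Fin (n + 1) → ℝ) × (Fin (n + 1) → E d) =>
        (p.1 k.castSucc, p.2 k.castSucc, p.2 k.succ))).enorm
  · exact (hg.measurable_absFlow hu).comp (by fun_prop : Measurable
      fun p : (Fin (n + 1) → ℝ) × (Fin (n + 1) → E d) => (p.1 (Fin.last n), p.2 (Fin.last n)))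

lemma GreenKernel.pathWeight_le (hg : GreenKernel α K g) {n : ℕ} (γ : Fin (n + 1) → ℝ)
    (y : Fin (n + 1) → E d) :
    pathWeight g u γ y ≤ K ^ (n + 1) * (∫⁻ ξ, ‖u ξ‖ₑ) * ∏ k, timeWeight α true (γ k) := by
  unfold pathWeight
  refine (mul_le_mul' (Finset.prod_le_prod' fun k _ => hg.sup_le _ _ _)
    (hg.absFlow_le _ _)).trans (le_of_eq ?_)
  rw [Finset.prod_mul_distrib, Finset.prod_const, Finset.card_univ, Fintype.card_fin,
    Fin.prod_univ_castSucc]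
  ring

/-- The bound on the integral of the weights of two paths with the same initial point whose
points are identified. -/
theorem exists_flags {κ : Type*} [Fintype κ] [DecidableEq κ] {n : ℕ}
    (Y₁ Y₂ : Fin (n + 1) → Option κ) (h0 : Y₁ 0 = Y₂ 0)
    (hsurj : ∀ k, (∃ i, Y₁ i = some k) ∨ ∃ i, Y₂ i = some k) :
    ∃ o₁ o₂ : Fin (n + 1) → Bool,
      flagCount o₁ + flagCount o₂ + Fintype.card κ = 2 * n + 2 ∧
      ∀ {α : ℝ} {K : ℝ≥0∞} {g : ℝ → E d → E d → ℝ} {u : E d → ℝ}, GreenKernel α K g →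
        Measurable u → ∀ (x : E d) (γ₁ γ₂ : Fin (n + 1) → ℝ),
        ∫⁻ z : κ → E d, pathWeight g u γ₁ (fun i => sitePos x z (Y₁ i)) *
            pathWeight g u γ₂ (fun i => sitePos x z (Y₂ i))
          ≤ K ^ (2 * n + 2) * (∫⁻ ξ, ‖u ξ‖ₑ) ^ 2 *
            ((∏ k, timeWeight α (o₁ k) (γ₁ k)) * ∏ k, timeWeight α (o₂ k) (γ₂ k)) := by
  classical
  have hrev : ∀ k : Fin n, (Fin.rev k).castSucc = Fin.rev k.succ ∧
      (Fin.rev k).succ = Fin.rev k.castSucc := fun k => ⟨by simp [Fin.rev_succ], by simp [Fin.rev_castSucc]⟩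
  -- The walk starts with the free flow at the end of the first path. It costs an integral if that
  -- point is a vertex and a supremum if it is the fixed root.
  obtain ⟨V₀, b, hV₀, hcard₀, H₀⟩ : ∃ (V₀ : Finset κ) (b : Bool),
      (∀ k, Y₁ (Fin.last n) = some k ↔ k ∈ V₀) ∧ b.toNat + V₀.card = 1 ∧
      ∀ (x : E d) (F : E d → ℝ≥0∞) (c : Bool → ℝ≥0∞), Measurable F →
        (∫⁻ y, F y ≤ c false) → (∀ y, F y ≤ c true) → ∀ z,
        (∫⋯∫⁻_V₀, (fun z : κ → E d => F (sitePos x z (Y₁ (Fin.last n)))) ∂fun _ => volume) z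
          ≤ c b := by
    cases hs : Y₁ (Fin.last n) with
    | none =>
      refine ⟨∅, true, by simp, by simp, fun x F c _ _ h1 z => ?_⟩
      simpa [sitePos] using h1 x
    | some k =>
      refine ⟨{k}, false, by simp [eq_comm], by simp, fun x F c _ h1 _ z => ?_⟩
      rw [lmarginal_singleton]
      simpa [sitePos] using h1
  -- The first path is walked backwards, which the symmetry of the kernel permits, down to the
  -- common initial point; the second path continues forwards from there.
  obtain ⟨V₁, oA, hVA, hYA, hcardA, HA⟩ := exists_walk_flags (X := E d) (fun i => Y₁ (Fin.rev i)) V₀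
    (fun k hk => (hV₀ k).1 (by simpa using hk))
  obtain ⟨V₂, oB, hVB, hYB, hcardB, HB⟩ := exists_walk_flags (X := E d) Y₂ V₁
    (fun k hk => hYA (Fin.last n) k (by simpa [h0] using hk))
  have hV₂ : V₂ = Finset.univ := by
    refine Finset.eq_univ_iff_forall.mpr fun k => ?_
    rcases hsurj k with ⟨i, hi⟩ | ⟨i, hi⟩
    · exact hVB (hYA (Fin.rev i) k (by simpa using hi))
    · exact hYB i k hi
  -- The free flow at the end of the second path is always bounded by its supremum. So one supremum
  -- is added to 2n + 1 factors, of which exactly one per vertex was integrated.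
  refine ⟨Fin.snoc (α := fun _ => Bool) (fun k => oA (Fin.rev k)) b,
    Fin.snoc (α := fun _ => Bool) oB true, ?_, ?_⟩
  · have h1 : flagCount (fun k => oA (Fin.rev k)) = flagCount oA :=
      Equiv.sum_comp Fin.revPerm fun k => (oA k).toNat
    have h2 : V₂.card = Fintype.card κ := by rw [hV₂, Finset.card_univ]
    simp only [flagCount] at h1 hcardA hcardB ⊢
    simp only [Fin.sum_univ_castSucc, Fin.snoc_castSucc, Fin.snoc_last, Bool.toNat_true, h1]
    omega
  · intro α K g u hg hu x γ₁ γ₂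
    set A := ∫⁻ ξ, ‖u ξ‖ₑ with hA
    have hm : ∀ r, Measurable (Function.uncurry fun a b => ‖g r a b‖ₑ) := fun r =>
      (hg.continuous r).measurable.enorm
    have hF : ∀ r, Measurable (absFlow g u r) := fun r => (hg.measurable_absFlow hu).of_uncurry_left
    have B0 := H₀ x (absFlow g u (γ₁ (Fin.last n)))
      (fun o => K * A * timeWeight α o (γ₁ (Fin.last n))) (hF _) (hg.lintegral_absFlow_le hu _)
      (hg.absFlow_le _)
    have mA : Measurable fun z : κ → E d =>
        absFlow g u (γ₁ (Fin.last n)) (sitePos x z (Y₁ (Fin.last n))) :=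
      (hF _).comp (measurable_sitePos x _)
    have B1 := HA x (fun k a b => ‖g (γ₁ (Fin.rev k).castSucc) a b‖ₑ)
      (fun k o => K * timeWeight α o (γ₁ (Fin.rev k).castSucc)) (fun k => hm _)
      (fun k a => hg.mass_le _ _) (fun k a b => hg.sup_le _ _ _) _ mA (fun w hw z a => by
        rw [sitePos_update x z a (fun h => hw ((hV₀ w).1 h))]) _ B0
    have m1 : Measurable fun z : κ → E d => absFlow g u (γ₁ (Fin.last n))
        (sitePos x z (Y₁ (Fin.last n))) * ∏ k : Fin n, ‖g (γ₁ (Fin.rev k).castSucc)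
          (sitePos x z (Y₁ (Fin.rev k.castSucc))) (sitePos x z (Y₁ (Fin.rev k.succ)))‖ₑ := by
      refine mA.mul (Finset.measurable_prod _ fun k _ => ?_)
      exact (hm (γ₁ (Fin.rev k).castSucc)).comp (by fun_prop : Measurable fun z : κ → E d =>
        (sitePos x z (Y₁ (Fin.rev k.castSucc)), sitePos x z (Y₁ (Fin.rev k.succ))))
    have B2 := HB x (fun k a b => ‖g (γ₂ k.castSucc) a b‖ₑ)
      (fun k o => K * timeWeight α o (γ₂ k.castSucc)) (fun k => hm _)
      (fun k a => hg.mass_le _ _) (fun k a b => hg.sup_le _ _ _) _ m1 (fun w hw z a => by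
        have h1 : ∀ i, Y₁ i ≠ some w := fun i h => hw (hYA (Fin.rev i) w (by simpa using h))
        simp only [sitePos_update x z a (h1 _)]) _ B1
    rw [hV₂] at B2
    have e1 : ∀ z : κ → E d, pathWeight g u γ₁ (fun i => sitePos x z (Y₁ i)) =
        absFlow g u (γ₁ (Fin.last n)) (sitePos x z (Y₁ (Fin.last n))) *
          ∏ k : Fin n, ‖g (γ₁ (Fin.rev k).castSucc) (sitePos x z (Y₁ (Fin.rev k.castSucc)))
            (sitePos x z (Y₁ (Fin.rev k.succ)))‖ₑ := by
      intro z
      unfold pathWeight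
      rw [mul_comm]
      congr 1
      rw [← Equiv.prod_comp Fin.revPerm]
      refine Finset.prod_congr rfl fun k _ => ?_
      simp only [Fin.revPerm_apply]
      rw [hg.symm, (hrev k).2, ← (hrev k).1]
    have B3 := B2 (fun _ => x)
    rw [lmarginal_univ] at B3
    calc ∫⁻ z : κ → E d, pathWeight g u γ₁ (fun i => sitePos x z (Y₁ i)) *
            pathWeight g u γ₂ (fun i => sitePos x z (Y₂ i))
        ≤ ∫⁻ z : κ → E d, (absFlow g u (γ₁ (Fin.last n)) (sitePos x z (Y₁ (Fin.last n))) *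
          ∏ k : Fin n, ‖g (γ₁ (Fin.rev k).castSucc) (sitePos x z (Y₁ (Fin.rev k.castSucc)))
            (sitePos x z (Y₁ (Fin.rev k.succ)))‖ₑ) * (∏ k : Fin n, ‖g (γ₂ k.castSucc)
              (sitePos x z (Y₂ k.castSucc)) (sitePos x z (Y₂ k.succ))‖ₑ) *
              (K * A * timeWeight α true (γ₂ (Fin.last n))) := by
          refine lintegral_mono fun z => ?_
          simp only []
          rw [e1 z, mul_assoc _ _ (K * A * _)]
          refine mul_le_mul_right ?_ _
          exact mul_le_mul_right (hg.absFlow_le _ _) _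
      _ ≤ _ := by
          rw [lintegral_mul_const]
          · refine (mul_le_mul_left B3 _).trans (le_of_eq ?_)
            rw [Fin.prod_univ_castSucc, Fin.prod_univ_castSucc]
            simp only [Fin.snoc_castSucc, Fin.snoc_last, Finset.prod_mul_distrib, Finset.prod_const,
              Finset.card_univ, Fintype.card_fin]
            have : ∏ k : Fin n, timeWeight α (oA k.rev) (γ₁ k.castSucc)
                = ∏ k : Fin n, timeWeight α (oA k) (γ₁ k.rev.castSucc) := by
              rw [← Equiv.prod_comp Fin.revPerm]
              simp
            rw [this]
            ring
          · refine m1.mul (Finset.measurable_prod _ fun k _ => ?_)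
            exact (hm (γ₂ k.castSucc)).comp (by fun_prop : Measurable fun z : κ → E d =>
              (sitePos x z (Y₂ k.castSucc), sitePos x z (Y₂ k.succ)))

end Paths

/-! ### Norms of functions dominated by path weights. -/

section PathBounds

variable {d n : ℕ} {α : ℝ} {K : ℝ≥0∞} {g : ℝ → E d → E d → ℝ} {u : E d → ℝ}
  {Θ : Type*} [MeasurableSpace Θ] {ν : Measure Θ} [SFinite ν]

lemma GreenKernel.measurable_pathWeight_comp (hg : GreenKernel α K g) (hu : Measurable u)
    {a : Θ → Fin (n + 1) → ℝ} {b : Θ → Fin (n + 1) → E d} (ha : Measurable a)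
    (hb : Measurable b) : Measurable fun θ => pathWeight g u (a θ) (b θ) :=
  (hg.measurable_pathWeight hu).comp (ha.prodMk hb)

/-- Tonelli's theorem puts the space integral inside. As the flags were chosen independently of the
times, the remaining integrals over the times of the two paths factor. -/
lemma lintegral_pathWeight_mul_le {κ : Type*} [Fintype κ] (hg : GreenKernel α K g)
    (hu : Measurable u) {γ : Θ → Fin (n + 1) → ℝ} (hγ : Measurable γ)
    {Y₁ Y₂ : Fin (n + 1) → Option κ} {x : E d} {C : (Fin (n + 1) → Bool) → ℝ≥0∞}
    (hC : ∀ o, ∫⁻ θ, ∏ k, timeWeight α (o k) (γ θ k) ∂ν ≤ C o) {o₁ o₂ : Fin (n + 1) → Bool}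
    (ho : ∀ γ₁ γ₂ : Fin (n + 1) → ℝ,
      ∫⁻ z : κ → E d, pathWeight g u γ₁ (fun i => sitePos x z (Y₁ i)) *
            pathWeight g u γ₂ (fun i => sitePos x z (Y₂ i))
          ≤ K ^ (2 * n + 2) * (∫⁻ ξ, ‖u ξ‖ₑ) ^ 2 *
            ((∏ k, timeWeight α (o₁ k) (γ₁ k)) * ∏ k, timeWeight α (o₂ k) (γ₂ k))) :
    ∫⁻ z : κ → E d, (∫⁻ θ, pathWeight g u (γ θ) (fun i => sitePos x z (Y₁ i)) ∂ν) *
        ∫⁻ θ, pathWeight g u (γ θ) (fun i => sitePos x z (Y₂ i)) ∂ν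
      ≤ K ^ (2 * n + 2) * (∫⁻ ξ, ‖u ξ‖ₑ) ^ 2 * (C o₁ * C o₂) := by
  classical
  have hsite : ∀ Y : Fin (n + 1) → Option κ, Measurable fun z : κ → E d =>
      fun i => sitePos x z (Y i) := fun Y => measurable_pi_lambda _ fun i => measurable_sitePos x (Y i)
  have hmz : ∀ (Y : Fin (n + 1) → Option κ) (z : κ → E d),
      Measurable fun θ => pathWeight g u (γ θ) (fun i => sitePos x z (Y i)) := fun Y z =>
    hg.measurable_pathWeight_comp (b := fun _ i => sitePos x z (Y i)) hu hγ measurable_const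
  have hm : ∀ Y : Fin (n + 1) → Option κ, Measurable fun p : (κ → E d) × Θ =>
      pathWeight g u (γ p.2) (fun i => sitePos x p.1 (Y i)) := fun Y =>
    hg.measurable_pathWeight_comp hu (hγ.comp measurable_snd) ((hsite Y).comp measurable_fst)
  have hw : ∀ o : Fin (n + 1) → Bool, Measurable fun θ => ∏ k, timeWeight α (o k) (γ θ k) :=
    fun o => Finset.measurable_prod _ fun k _ => by fun_prop
  calc _ = ∫⁻ z : κ → E d, ∫⁻ θ, (∫⁻ θ', pathWeight g u (γ θ) (fun i => sitePos x z (Y₁ i)) *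
          pathWeight g u (γ θ') (fun i => sitePos x z (Y₂ i)) ∂ν) ∂ν := by
        refine lintegral_congr fun z => ?_
        rw [← lintegral_mul_const _ (hmz Y₁ z)]
        refine lintegral_congr fun θ => ?_
        rw [lintegral_const_mul _ (hmz Y₂ z)]
    _ = ∫⁻ θ, ∫⁻ θ', (∫⁻ z : κ → E d, pathWeight g u (γ θ) (fun i => sitePos x z (Y₁ i)) *
          pathWeight g u (γ θ') (fun i => sitePos x z (Y₂ i))) ∂ν ∂ν := by
        rw [lintegral_lintegral_swap]
        · refine lintegral_congr fun θ => ?_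
          rw [lintegral_lintegral_swap]
          exact ((hg.measurable_pathWeight_comp hu measurable_const
            ((hsite Y₁).comp measurable_fst)).mul (hm Y₂)).aemeasurable
        · refine Measurable.aemeasurable ?_
          refine Measurable.lintegral_prod_right' (f := fun q : ((κ → E d) × Θ) × Θ =>
            pathWeight g u (γ q.1.2) (fun i => sitePos x q.1.1 (Y₁ i)) *
              pathWeight g u (γ q.2) (fun i => sitePos x q.1.1 (Y₂ i))) ?_
          exact (hg.measurable_pathWeight_comp hu (hγ.comp (measurable_snd.comp measurable_fst))
              ((hsite Y₁).comp (measurable_fst.comp measurable_fst))).mul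
            (hg.measurable_pathWeight_comp hu (hγ.comp measurable_snd)
              ((hsite Y₂).comp (measurable_fst.comp measurable_fst)))
    _ ≤ ∫⁻ θ, ∫⁻ θ', K ^ (2 * n + 2) * (∫⁻ ξ, ‖u ξ‖ₑ) ^ 2 *
            ((∏ k, timeWeight α (o₁ k) (γ θ k)) * ∏ k, timeWeight α (o₂ k) (γ θ' k)) ∂ν ∂ν :=
        lintegral_mono fun θ => lintegral_mono fun θ' => ho _ _
    _ = K ^ (2 * n + 2) * (∫⁻ ξ, ‖u ξ‖ₑ) ^ 2 * ((∫⁻ θ, ∏ k, timeWeight α (o₁ k) (γ θ k) ∂ν) *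
          ∫⁻ θ, ∏ k, timeWeight α (o₂ k) (γ θ k) ∂ν) := by
        rw [← lintegral_mul_const _ (hw o₁), ← lintegral_const_mul _ ((hw o₁).mul_const _)]
        refine lintegral_congr fun θ => ?_
        rw [← lintegral_const_mul _ (hw o₂), ← lintegral_const_mul _ ((hw o₂).const_mul _)]
    _ ≤ _ := by gcongr <;> exact hC _

lemma measurable_cons {a : Θ → E d} {b : Θ → Fin n → E d} (ha : Measurable a) (hb : Measurable b) :
    Measurable fun θ => (Fin.cons (a θ) (b θ) : Fin (n + 1) → E d) := by
  refine measurable_pi_lambda _ fun i => ?_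
  refine Fin.cases ?_ (fun j => ?_) i
  · simpa only [Fin.cons_zero] using ha
  · simp only [Fin.cons_succ]; fun_prop

/-- The sites of the points of a path whose points, after the first one, are vertices of a
pairing. -/
def rootedSites {κ : Type*} (v : Fin n → κ) : Fin (n + 1) → Option κ :=
  Fin.cons none fun i => some (v i)

lemma sitePos_rootedSites {κ : Type*} (v : Fin n → κ) (x : E d) (z : κ → E d) :
    (fun i => sitePos x z (rootedSites v i)) = (Fin.cons x (fun i => z (v i)) : Fin (n + 1) → E d) := by
  funext i
  refine Fin.cases ?_ (fun j => ?_) i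
  · simp [rootedSites, sitePos]
  · simp [rootedSites, sitePos]

lemma Pairing.exists_rep_eq (l : Pairing (n + n)) (k : l.A₀) :
    (∃ i : Fin n, l.rep (Fin.castAdd n i) = k) ∨ ∃ i : Fin n, l.rep (Fin.natAdd n i) = k := by
  obtain ⟨j, hj⟩ := l.rep_surjective k
  revert hj
  refine Fin.addCases (fun i hi => Or.inl ⟨i, hi⟩) (fun i hi => Or.inr ⟨i, hi⟩) j

/-- The bound on the norm of `𝓑_n` of a function that is dominated by path weights. -/
theorem normSqB_le_of_pathWeight (hg : GreenKernel α K g) (hu : Measurable u)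
    {γ : Θ → Fin (n + 1) → ℝ} (hγ : Measurable γ) {C : (Fin (n + 1) → Bool) → ℝ≥0∞}
    (hC : ∀ o, ∫⁻ θ, ∏ k, timeWeight α (o k) (γ θ k) ∂ν ≤ C o) {B : ℝ≥0∞}
    (hB : ∀ o₁ o₂, flagCount o₁ + flagCount o₂ = n + 2 → C o₁ * C o₂ ≤ B) {x : E d}
    {c : ℝ≥0∞} {f : (Fin n → E d) → ℝ}
    (hf : ∀ y, ‖f y‖ₑ ≤ c * ∫⁻ θ, pathWeight g u (γ θ) (Fin.cons x y) ∂ν) :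
    normSqB n f ≤ (2 * n - 1).doubleFactorial *
      (c ^ 2 * (K ^ (2 * n + 2) * (∫⁻ ξ, ‖u ξ‖ₑ) ^ 2 * B)) := by
  classical
  unfold normSqB
  rw [← card_pairing, ← nsmul_eq_mul, ← Finset.card_univ]
  refine Finset.sum_le_card_nsmul _ _ _ fun l _ => ?_
  -- The root is fixed and there are n vertices, so n + 2 of the 2n + 2 factors are bounded by
  -- suprema.
  obtain ⟨o₁, o₂, hcount, ho⟩ := exists_flags (d := d)
    (rootedSites fun i : Fin n => l.rep (Fin.castAdd n i))
    (rootedSites fun i : Fin n => l.rep (Fin.natAdd n i)) rfl (fun k => by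
      rcases l.exists_rep_eq k with ⟨i, hi⟩ | ⟨i, hi⟩
      · exact Or.inl ⟨i.succ, congrArg some hi⟩
      · exact Or.inr ⟨i.succ, congrArg some hi⟩)
  have hcard : Fintype.card l.A₀ = n := l.card_A₀
  have key := lintegral_pathWeight_mul_le hg hu hγ hC (ho hg hu x)
  simp only [sitePos_rootedSites] at key
  calc _ ≤ ∫⁻ z : l.A₀ → E d, c ^ 2 *
        ((∫⁻ θ, pathWeight g u (γ θ) (Fin.cons x fun i => z (l.rep (Fin.castAdd n i))) ∂ν) *
        ∫⁻ θ, pathWeight g u (γ θ) (Fin.cons x fun i => z (l.rep (Fin.natAdd n i))) ∂ν) := by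
        refine lintegral_mono fun z => (mul_le_mul' (hf _) (hf _)).trans (le_of_eq (by ring))
    _ ≤ _ := by
        rw [lintegral_const_mul]
        · refine mul_le_mul_right (key.trans (mul_le_mul_right (hB _ _ (by omega)) _)) _
        · have hm : ∀ v : Fin n → l.A₀, Measurable fun z : l.A₀ → E d =>
              ∫⁻ θ, pathWeight g u (γ θ) (Fin.cons x fun i => z (v i)) ∂ν := by
            intro v
            refine Measurable.lintegral_prod_right' (f := fun q : (l.A₀ → E d) × Θ =>
              pathWeight g u (γ q.2) (Fin.cons x fun i => q.1 (v i))) ?_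
            exact hg.measurable_pathWeight_comp hu (hγ.comp measurable_snd)
              (measurable_cons measurable_const (by fun_prop))
          exact (hm _).mul (hm _)

/-- Makes the starting point of the two paths one more vertex when it is integrated as well. -/
lemma lintegral_option {κ X : Type*} [Fintype κ] [MeasureSpace X] [SigmaFinite (volume : Measure X)]
    {f : (Option κ → X) → ℝ≥0∞} (hf : Measurable f) :
    ∫⁻ z, f z = ∫⁻ x : X, ∫⁻ z : κ → X, f fun s => sitePos x z s := by
  have h := Measure.pi_map_piOptionEquivProd (ι := κ) (β := fun _ => X) (fun _ => volume)
  rw [volume_pi, ← h, lintegral_map hf (MeasurableEquiv.measurable _), lintegral_prod_symm]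
  · refine lintegral_congr fun x => lintegral_congr fun z => congrArg f ?_
    funext s
    cases s <;> rfl
  · exact (hf.comp (MeasurableEquiv.measurable _)).aemeasurable

lemma normSqL2B_le_of_le {c D : ℝ≥0∞} {f : E d → (Fin n → E d) → ℝ}
    {H : E d → (Fin n → E d) → ℝ≥0∞} (hH : Measurable (Function.uncurry H))
    (hf : ∀ x y, ‖f x y‖ₑ ≤ c * H x y)
    (hD : ∀ l : Pairing (n + n), ∫⁻ x, ∫⁻ z : l.A₀ → E d,
      H x (fun i => z (l.rep (Fin.castAdd n i))) * H x (fun i => z (l.rep (Fin.natAdd n i))) ≤ D) :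
    normSqL2B n f ≤ (2 * n - 1).doubleFactorial * (c ^ 2 * D) := by
  have hm : ∀ {κ : Type} (v w : Fin n → κ), Measurable fun p : E d × (κ → E d) =>
      H p.1 (fun i => p.2 (v i)) * H p.1 (fun i => p.2 (w i)) := fun v w =>
    (hH.comp (by fun_prop : Measurable fun p : E d × (_ → E d) => (p.1, fun i => p.2 (v i)))).mul
    (hH.comp (by fun_prop : Measurable fun p : E d × (_ → E d) => (p.1, fun i => p.2 (w i))))
  unfold normSqL2B normSqB
  calc _ ≤ ∫⁻ x, ∑ l : Pairing (n + n), c ^ 2 * ∫⁻ z : l.A₀ → E d,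
        H x (fun i => z (l.rep (Fin.castAdd n i))) * H x (fun i => z (l.rep (Fin.natAdd n i))) := by
        refine lintegral_mono fun x => Finset.sum_le_sum fun l _ => ?_
        have h1 : Measurable fun z : l.A₀ → E d => H x (fun i => z (l.rep (Fin.castAdd n i))) *
            H x (fun i => z (l.rep (Fin.natAdd n i))) := (hm _ _).comp measurable_prodMk_left
        rw [← lintegral_const_mul _ h1]
        exact lintegral_mono fun z => (mul_le_mul' (hf _ _) (hf _ _)).trans (le_of_eq (by ring))
    _ = ∑ l : Pairing (n + n), c ^ 2 * ∫⁻ x, ∫⁻ z : l.A₀ → E d,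
        H x (fun i => z (l.rep (Fin.castAdd n i))) * H x (fun i => z (l.rep (Fin.natAdd n i))) := by
        rw [lintegral_finsetSum _ fun l _ => ((hm _ _).lintegral_prod_right').const_mul _]
        exact Finset.sum_congr rfl fun l _ => lintegral_const_mul _ (hm _ _).lintegral_prod_right'
    _ ≤ _ := by
        rw [← card_pairing, ← nsmul_eq_mul, ← Finset.card_univ]
        exact Finset.sum_le_card_nsmul _ _ _ fun l _ => mul_le_mul_right (hD l) _

/-- With the starting point as a vertex there are n + 1 integrals, hence one supremum fewer than at
a fixed point. This gain keeps the bound uniform down to time zero when n ≥ 1. -/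
lemma lintegral_pairing_le (hg : GreenKernel α K g) (hu : Measurable u)
    {γ : Θ → Fin (n + 1) → ℝ} (hγ : Measurable γ) {C : (Fin (n + 1) → Bool) → ℝ≥0∞}
    (hC : ∀ o, ∫⁻ θ, ∏ k, timeWeight α (o k) (γ θ k) ∂ν ≤ C o) {B : ℝ≥0∞}
    (hB : ∀ o₁ o₂, flagCount o₁ + flagCount o₂ = n + 1 → C o₁ * C o₂ ≤ B) (l : Pairing (n + n)) :
    ∫⁻ x, ∫⁻ z : l.A₀ → E d,
        (∫⁻ θ, pathWeight g u (γ θ) (Fin.cons x fun i => z (l.rep (Fin.castAdd n i))) ∂ν) *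
        ∫⁻ θ, pathWeight g u (γ θ) (Fin.cons x fun i => z (l.rep (Fin.natAdd n i))) ∂ν
      ≤ K ^ (2 * n + 2) * (∫⁻ ξ, ‖u ξ‖ₑ) ^ 2 * B := by
  classical
  obtain ⟨o₁, o₂, hcount, ho⟩ := exists_flags (d := d)
    (fun k => some (rootedSites (fun i : Fin n => l.rep (Fin.castAdd n i)) k))
    (fun k => some (rootedSites (fun i : Fin n => l.rep (Fin.natAdd n i)) k)) rfl (fun k => by
      cases k with
      | none => exact Or.inl ⟨0, by simp [rootedSites]⟩
      | some k =>
        rcases l.exists_rep_eq k with ⟨i, hi⟩ | ⟨i, hi⟩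
        · exact Or.inl ⟨i.succ, congrArg (fun k => some (some k)) hi⟩
        · exact Or.inr ⟨i.succ, congrArg (fun k => some (some k)) hi⟩)
  have hcard : Fintype.card (Option l.A₀) = n + 1 := by rw [Fintype.card_option, l.card_A₀]
  have key := lintegral_pathWeight_mul_le hg hu hγ hC (ho hg hu 0)
  have hs : ∀ (z : Option l.A₀ → E d) s, sitePos 0 z (some s) = z s := fun _ _ => rfl
  simp only [hs] at key
  have hm : ∀ v : Fin (n + 1) → Option l.A₀, Measurable fun z : Option l.A₀ → E d =>
      ∫⁻ θ, pathWeight g u (γ θ) (fun i => z (v i)) ∂ν := by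
    intro v
    refine Measurable.lintegral_prod_right' (f := fun q : (Option l.A₀ → E d) × Θ =>
      pathWeight g u (γ q.2) (fun i => q.1 (v i))) ?_
    exact hg.measurable_pathWeight_comp hu (hγ.comp measurable_snd) (by fun_prop)
  have hm2 : ∀ v w : Fin (n + 1) → Option l.A₀, Measurable fun z : Option l.A₀ → E d =>
      (∫⁻ θ, pathWeight g u (γ θ) (fun i => z (v i)) ∂ν) *
        ∫⁻ θ, pathWeight g u (γ θ) (fun i => z (w i)) ∂ν := fun v w => (hm v).mul (hm w)
  rw [lintegral_option (hm2 _ _)] at key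
  simp only [sitePos_rootedSites] at key
  exact key.trans (mul_le_mul_right (hB _ _ (by omega)) _)

/-- The bound on the norm of `L²(ℝ^d; 𝓑_n)` of a function that is dominated by path weights. -/
theorem normSqL2B_le_of_pathWeight (hg : GreenKernel α K g) (hu : Measurable u)
    {γ : Θ → Fin (n + 1) → ℝ} (hγ : Measurable γ) {C : (Fin (n + 1) → Bool) → ℝ≥0∞}
    (hC : ∀ o, ∫⁻ θ, ∏ k, timeWeight α (o k) (γ θ k) ∂ν ≤ C o) {B : ℝ≥0∞}
    (hB : ∀ o₁ o₂, flagCount o₁ + flagCount o₂ = n + 1 → C o₁ * C o₂ ≤ B)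
    {c : ℝ≥0∞} {f : E d → (Fin n → E d) → ℝ}
    (hf : ∀ x y, ‖f x y‖ₑ ≤ c * ∫⁻ θ, pathWeight g u (γ θ) (Fin.cons x y) ∂ν) :
    normSqL2B n f ≤ (2 * n - 1).doubleFactorial *
      (c ^ 2 * (K ^ (2 * n + 2) * (∫⁻ ξ, ‖u ξ‖ₑ) ^ 2 * B)) := by
  refine normSqL2B_le_of_le (H := fun x y => ∫⁻ θ, pathWeight g u (γ θ) (Fin.cons x y) ∂ν) ?_ hf
    (lintegral_pairing_le hg hu hγ hC hB)
  refine Measurable.lintegral_prod_right' (f := fun q : (E d × (Fin n → E d)) × Θ =>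
    pathWeight g u (γ q.2) (Fin.cons q.1.1 q.1.2)) ?_
  exact hg.measurable_pathWeight_comp hu (hγ.comp measurable_snd)
    (measurable_cons (by fun_prop) (by fun_prop))

end PathBounds

/-! ### The kernels of the Duhamel expansion -/

section Kernels

variable {d : ℕ}

/-- The kernels of the Duhamel expansion for a Green's function that is extended by zero. -/
def kern (g : ℝ → E d → E d → ℝ) (σ : ℝ) (u : E d → ℝ) :
    ∀ n : ℕ, ℝ → E d → (Fin n → E d) → ℝ
  | 0 => fun t x _ => ∫ ξ, g t x ξ * u ξ
  | n + 1 => fun t x y => σ * ∫ s, g (t - s) x (y 0) * kern g σ u n s (y 0) (Fin.tail y)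

/-- The integrand in the recursion for the kernels. -/
def stepKern (g : ℝ → E d → E d → ℝ) (σ : ℝ) (u : E d → ℝ) (n : ℕ) (t s : ℝ) (x : E d)
    (y : Fin (n + 1) → E d) : ℝ :=
  g (t - s) x (y 0) * kern g σ u n s (y 0) (Fin.tail y)

variable {α : ℝ} {K : ℝ≥0∞} {g : ℝ → E d → E d → ℝ} {σ : ℝ} {u : E d → ℝ}

lemma GreenKernel.eq_zero (hg : GreenKernel α K g) {r : ℝ} (hr : r ≤ 0) (x y : E d) :
    g r x y = 0 := by
  have h := hg.sup_le r x y
  rw [timeWeight, if_neg (not_lt.mpr hr), mul_zero] at h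
  simpa using h

lemma kern_succ (g : ℝ → E d → E d → ℝ) (σ : ℝ) (u : E d → ℝ) (n : ℕ) (t : ℝ) (x : E d)
    (y : Fin (n + 1) → E d) :
    kern g σ u (n + 1) t x y = σ * ∫ s, stepKern g σ u n t s x y := rfl

lemma GreenKernel.kern_eq_zero (hg : GreenKernel α K g) (n : ℕ) {t : ℝ} (ht : t ≤ 0) (x : E d)
    (y : Fin n → E d) : kern g σ u n t x y = 0 := by
  induction n generalizing t x with
  | zero => simp [kern, hg.eq_zero ht]
  | succ n ih =>
    rw [kern_succ]
    have : ∀ s, stepKern g σ u n t s x y = 0 := by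
      intro s
      rcases le_or_gt s 0 with hs | hs
      · simp [stepKern, ih hs]
      · simp [stepKern, hg.eq_zero (show t - s ≤ 0 by linarith)]
    simp [this]

lemma GreenKernel.stepKern_eq_zero (hg : GreenKernel α K g) (n : ℕ) {t s : ℝ} (hs : s ∉ Ioo 0 t)
    (x : E d) (y : Fin (n + 1) → E d) : stepKern g σ u n t s x y = 0 := by
  rcases le_or_gt s 0 with h | h
  · simp [stepKern, hg.kern_eq_zero n h]
  · have : t - s ≤ 0 := by
      by_contra h'
      exact hs ⟨h, by linarith⟩
    simp [stepKern, hg.eq_zero this]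

lemma GreenKernel.measurable_kern (hg : GreenKernel α K g) (hu : Measurable u) (n : ℕ) :
    Measurable fun p : ℝ × E d × (Fin n → E d) => kern g σ u n p.1 p.2.1 p.2.2 := by
  induction n with
  | zero =>
    refine StronglyMeasurable.measurable ?_
    refine StronglyMeasurable.integral_prod_right'
      (f := fun q : (ℝ × E d × (Fin 0 → E d)) × E d => g q.1.1 q.1.2.1 q.2 * u q.2) ?_
    refine Measurable.stronglyMeasurable ?_
    exact (hg.measurable.comp (by fun_prop : Measurable fun q : (ℝ × E d × (Fin 0 → E d)) × E d =>
      (q.1.1, q.1.2.1, q.2))).mul (hu.comp measurable_snd)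
  | succ n ih =>
    refine StronglyMeasurable.measurable ?_
    refine StronglyMeasurable.const_mul ?_ σ
    refine StronglyMeasurable.integral_prod_right'
      (f := fun q : (ℝ × E d × (Fin (n + 1) → E d)) × ℝ =>
        g (q.1.1 - q.2) q.1.2.1 (q.1.2.2 0) * kern g σ u n q.2 (q.1.2.2 0) (Fin.tail q.1.2.2)) ?_
    refine Measurable.stronglyMeasurable ?_
    refine (hg.measurable.comp (by fun_prop :
      Measurable fun q : (ℝ × E d × (Fin (n + 1) → E d)) × ℝ =>
        (q.1.1 - q.2, q.1.2.1, q.1.2.2 0))).mul ?_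
    refine ih.comp (g := fun p : ℝ × E d × (Fin n → E d) => kern g σ u n p.1 p.2.1 p.2.2)
      (f := fun q : (ℝ × E d × (Fin (n + 1) → E d)) × ℝ => (q.2, q.1.2.2 0, Fin.tail q.1.2.2)) ?_
    unfold Fin.tail
    fun_prop

lemma GreenKernel.measurable_stepKern (hg : GreenKernel α K g) (hu : Measurable u) (n : ℕ) (t : ℝ) :
    Measurable fun p : ℝ × E d × (Fin (n + 1) → E d) => stepKern g σ u n t p.1 p.2.1 p.2.2 := by
  refine (hg.measurable.comp (by fun_prop :
      Measurable fun q : ℝ × E d × (Fin (n + 1) → E d) => (t - q.1, q.2.1, q.2.2 0))).mul ?_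
  refine (hg.measurable_kern (σ := σ) hu n).comp
    (g := fun p : ℝ × E d × (Fin n → E d) => kern g σ u n p.1 p.2.1 p.2.2)
    (f := fun q : ℝ × E d × (Fin (n + 1) → E d) => (q.1, q.2.2 0, Fin.tail q.2.2)) ?_
  unfold Fin.tail
  fun_prop

/-- Unrolls the recursion: one layer of it adds one gap in front of the gaps and one point in front
of the path. -/
lemma GreenKernel.enorm_kern_le (hg : GreenKernel α K g) (hu : Measurable u) (n : ℕ) (t : ℝ)
    (x : E d) (y : Fin n → E d) :
    ‖kern g σ u n t x y‖ₑ
      ≤ ‖σ‖ₑ ^ n * ∫⁻ θ : Fin n → ℝ, pathWeight g u (gaps t θ) (Fin.cons x y) := by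
  induction n generalizing t x with
  | zero =>
    simp only [pow_zero, one_mul]
    have e : ∀ θ : Fin 0 → ℝ, pathWeight g u (gaps t θ) (Fin.cons x y : Fin 1 → E d)
        = absFlow g u t x := by
      intro θ
      simp [pathWeight, gaps, Fin.snoc]
    simp only [e, lintegral_const, volume_pi, Measure.pi_univ, Finset.univ_eq_empty,
      Finset.prod_empty, mul_one]
    refine (enorm_integral_le_lintegral_enorm _).trans (le_of_eq ?_)
    simp [absFlow, enorm_mul]
  | succ n ih =>
    have hm : Measurable fun θ : Fin (n + 1) → ℝ =>
        pathWeight g u (gaps t θ) (Fin.cons x y : Fin (n + 2) → E d) :=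
      hg.measurable_pathWeight_comp (b := fun _ => Fin.cons x y) hu (measurable_gaps t)
        measurable_const
    rw [lintegral_fin_succ hm, kern_succ, enorm_mul, pow_succ', mul_assoc]
    refine mul_le_mul_right ?_ _
    refine (enorm_integral_le_lintegral_enorm _).trans ?_
    have h1 : ∀ s, ‖stepKern g σ u n t s x y‖ₑ ≤ ‖σ‖ₑ ^ n * (‖g (t - s) x (y 0)‖ₑ *
        ∫⁻ θ : Fin n → ℝ, pathWeight g u (gaps s θ) y) := by
      intro s
      have h2 := ih s (y 0) (Fin.tail y)
      rw [Fin.cons_self_tail] at h2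
      rw [stepKern, enorm_mul]
      exact (mul_le_mul_right h2 _).trans (le_of_eq (by ring))
    refine (lintegral_mono h1).trans ?_
    rw [lintegral_const_mul' _ _ (by finiteness)]
    refine mul_le_mul_right (le_of_eq ?_) _
    -- The intermediate time s is replaced by the first gap r = t - s.
    rw [← lintegral_sub_left_eq_self _ t]
    refine lintegral_congr fun r => ?_
    simp only [gaps_cons, pathWeight_cons, sub_sub_cancel]
    rw [lintegral_const_mul]
    exact hg.measurable_pathWeight_comp (b := fun _ => y) hu (measurable_gaps _) measurable_const

lemma GreenKernel.enorm_stepKern_le (hg : GreenKernel α K g) (hu : Measurable u) (n : ℕ) (t s : ℝ)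
    (x : E d) (y : Fin (n + 1) → E d) :
    ‖stepKern g σ u n t s x y‖ₑ ≤ ‖σ‖ₑ ^ n * ∫⁻ θ : Fin n → ℝ,
      pathWeight g u (Fin.cons (t - s) (gaps s θ) : Fin (n + 2) → ℝ) (Fin.cons x y) := by
  have h2 := hg.enorm_kern_le (σ := σ) hu n s (y 0) (Fin.tail y)
  rw [Fin.cons_self_tail] at h2
  simp only [pathWeight_cons]
  rw [stepKern, enorm_mul, lintegral_const_mul]
  · exact (mul_le_mul_right h2 _).trans (le_of_eq (by ring))
  · exact hg.measurable_pathWeight_comp (b := fun _ => y) hu (measurable_gaps _) measurable_const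

/-- The constant in the supremum bound for the kernels. -/
def kernConst (α : ℝ) (K : ℝ≥0∞) (σ : ℝ) (u : E d → ℝ) (n : ℕ) : ℝ≥0∞ :=
  ‖σ‖ₑ ^ n * (K ^ (n + 1) * (∫⁻ ξ, ‖u ξ‖ₑ) * (weightConst α : ℝ≥0∞) ^ (n + 1))

lemma GreenKernel.kernConst_ne_top (hg : GreenKernel α K g) (hu : Integrable u) (n : ℕ) :
    kernConst α K σ u n ≠ ∞ := by
  have h1 := hg.ne_top
  have h2 : ∫⁻ ξ, ‖u ξ‖ₑ ≠ ∞ := hu.2.ne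
  unfold kernConst
  finiteness

lemma timeWeight_ne_top (α : ℝ) (o : Bool) (r : ℝ) : timeWeight α o r ≠ ∞ := by
  unfold timeWeight
  split_ifs <;> simp

lemma powerDensity_ne_top (a r : ℝ) : powerDensity a r ≠ ∞ := by
  unfold powerDensity
  split_ifs <;> simp

/-- A crude bound with a supremum at every step. It supplies domination uniform in space, for
continuity and for exchanging integrals; the summability in n rests on the finer counting of flags.
-/
lemma GreenKernel.enorm_kern_le_const (hg : GreenKernel α K g) (hu : Measurable u) (n : ℕ) (t : ℝ)
    (x : E d) (y : Fin n → E d) :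
    ‖kern g σ u n t x y‖ₑ
      ≤ kernConst α K σ u n * powerDensity ((n + 1 : ℕ) * (1 - α)) t := by
  refine (hg.enorm_kern_le hu n t x y).trans ?_
  unfold kernConst
  rw [mul_assoc]
  refine mul_le_mul_right ?_ _
  calc _ ≤ ∫⁻ θ : Fin n → ℝ, K ^ (n + 1) * (∫⁻ ξ, ‖u ξ‖ₑ) *
        ∏ k, timeWeight α true (gaps t θ k) := lintegral_mono fun θ => hg.pathWeight_le _ _
    _ ≤ K ^ (n + 1) * (∫⁻ ξ, ‖u ξ‖ₑ) * ((weightConst α : ℝ≥0∞) ^ (n + 1) *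
        powerDensity ((n + 1 : ℕ) * (1 - α)) t) := by
        rw [lintegral_const_mul _ (by fun_prop)]
        refine mul_le_mul_right ?_ _
        refine (lintegral_timeWeight_le hg.lt_one (fun _ => true) t).trans (le_of_eq ?_)
        simp only [timeExp, if_true, Finset.sum_const, Finset.card_univ, Fintype.card_fin, nsmul_eq_mul]
    _ = _ := by ring

/-- The bound on the integrand in the recursion for the kernels. -/
def stepBound (α : ℝ) (K : ℝ≥0∞) (σ : ℝ) (u : E d → ℝ) (n : ℕ) (t s : ℝ) : ℝ≥0∞ :=
  K * timeWeight α true (t - s) *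
    (kernConst α K σ u n * powerDensity ((n + 1 : ℕ) * (1 - α)) s)

lemma GreenKernel.enorm_stepKern_le_bound (hg : GreenKernel α K g) (hu : Measurable u) (n : ℕ)
    (t s : ℝ) (x : E d) (y : Fin (n + 1) → E d) :
    ‖stepKern g σ u n t s x y‖ₑ ≤ stepBound α K σ u n t s := by
  rw [stepKern, enorm_mul]
  exact mul_le_mul' (hg.sup_le _ _ _) (hg.enorm_kern_le_const hu n s _ _)

lemma GreenKernel.stepBound_ne_top (hg : GreenKernel α K g) (hu : Integrable u) (n : ℕ) (t s : ℝ) :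
    stepBound α K σ u n t s ≠ ∞ := by
  have h1 := hg.ne_top
  have h2 := hg.kernConst_ne_top (σ := σ) hu n
  have h3 := timeWeight_ne_top α true (t - s)
  have h4 := powerDensity_ne_top ((n + 1 : ℕ) * (1 - α)) s
  unfold stepBound
  finiteness

lemma measurable_stepBound (n : ℕ) (t : ℝ) : Measurable (stepBound α K σ u n t) := by
  unfold stepBound
  fun_prop

lemma GreenKernel.lintegral_stepBound_ne_top (hg : GreenKernel α K g) (hu : Integrable u) (n : ℕ)
    (t : ℝ) : ∫⁻ s, stepBound α K σ u n t s ≠ ∞ := by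
  have h1 := hg.ne_top
  have h2 := hg.kernConst_ne_top (σ := σ) hu n
  have h0 : 0 < 1 - α := by linarith [hg.lt_one]
  refine ne_top_of_le_ne_top (b := K * weightConst α * kernConst α K σ u n *
    powerDensity ((n + 1 : ℕ) * (1 - α) + (1 - α)) t) ?_ ?_
  · have h4 := powerDensity_ne_top ((n + 1 : ℕ) * (1 - α) + (1 - α)) t
    finiteness
  · rw [← lintegral_powerDensity_conv (by positivity) h0, ← lintegral_const_mul _ (by fun_prop)]
    refine lintegral_mono fun s => ?_
    unfold stepBound
    calc _ ≤ K * (weightConst α * powerDensity (timeExp α true) (t - s)) *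
          (kernConst α K σ u n * powerDensity ((n + 1 : ℕ) * (1 - α)) s) := by
          gcongr
          exact timeWeight_le hg.lt_one _ _
      _ = _ := by
          simp only [timeExp, if_true]
          ring

lemma GreenKernel.integrable_stepBound (hg : GreenKernel α K g) (hu : Integrable u) (n : ℕ)
    (t : ℝ) : Integrable fun s => (stepBound α K σ u n t s).toReal :=
  integrable_toReal_of_lintegral_ne_top (measurable_stepBound n t).aemeasurable
    (hg.lintegral_stepBound_ne_top hu n t)

lemma GreenKernel.norm_stepKern_le (hg : GreenKernel α K g) (hu : Measurable u)
    (hui : Integrable u) (n : ℕ) (t s : ℝ) (x : E d) (y : Fin (n + 1) → E d) :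
    ‖stepKern g σ u n t s x y‖ ≤ (stepBound α K σ u n t s).toReal := by
  rw [← toReal_enorm]
  exact ENNReal.toReal_mono (hg.stepBound_ne_top hui n t s) (hg.enorm_stepKern_le_bound hu n t s x y)

lemma GreenKernel.continuous_kern (hg : GreenKernel α K g) (hu : Measurable u)
    (hui : Integrable u) (n : ℕ) (t : ℝ) : Continuous (Function.uncurry (kern g σ u n t)) := by
  induction n generalizing t with
  | zero =>
    refine continuous_of_dominated (F := fun (p : E d × (Fin 0 → E d)) ξ => g t p.1 ξ * u ξ)
      (bound := fun ξ => (K * timeWeight α true t).toReal * ‖u ξ‖) ?_ ?_ ?_ ?_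
    · intro p
      exact ((hg.continuous t).measurable.of_uncurry_left.mul hu).aestronglyMeasurable
    · intro p
      refine ae_of_all _ fun ξ => ?_
      rw [norm_mul]
      refine mul_le_mul_of_nonneg_right ?_ (norm_nonneg _)
      rw [← toReal_enorm]
      exact ENNReal.toReal_mono (ENNReal.mul_ne_top hg.ne_top (timeWeight_ne_top _ _ _))
        (hg.sup_le _ _ _)
    · exact hui.norm.const_mul _
    · refine ae_of_all _ fun ξ => ?_
      exact ((hg.continuous t).comp (by fun_prop : Continuous fun p : E d × (Fin 0 → E d) =>
        (p.1, ξ))).mul continuous_const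
  | succ n ih =>
    refine Continuous.mul continuous_const ?_
    refine continuous_of_dominated (F := fun (p : E d × (Fin (n + 1) → E d)) s =>
      stepKern g σ u n t s p.1 p.2) (bound := fun s => (stepBound α K σ u n t s).toReal) ?_ ?_ ?_ ?_
    · intro p
      exact ((hg.measurable_stepKern (σ := σ) hu n t).comp
        (g := fun p : ℝ × E d × (Fin (n + 1) → E d) => stepKern g σ u n t p.1 p.2.1 p.2.2)
        (f := fun s => (s, p.1, p.2)) (by fun_prop)).aestronglyMeasurable
    · intro p
      exact ae_of_all _ fun s => hg.norm_stepKern_le hu hui n t s _ _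
    · exact hg.integrable_stepBound hui n t
    · refine ae_of_all _ fun s => ?_
      refine ((hg.continuous (t - s)).comp (by fun_prop :
        Continuous fun p : E d × (Fin (n + 1) → E d) => (p.1, p.2 0))).mul ?_
      refine (ih s).comp (g := Function.uncurry (kern g σ u n s))
        (f := fun p : E d × (Fin (n + 1) → E d) => (p.2 0, Fin.tail p.2)) ?_
      unfold Fin.tail
      fun_prop

lemma GreenKernel.continuous_stepKern (hg : GreenKernel α K g) (hu : Measurable u)
    (hui : Integrable u) (n : ℕ) (t s : ℝ) (x : E d) : Continuous (stepKern g σ u n t s x) := by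
  refine ((hg.continuous (t - s)).comp (by fun_prop :
    Continuous fun p : Fin (n + 1) → E d => (x, p 0))).mul ?_
  refine (hg.continuous_kern (σ := σ) hu hui n s).comp (g := Function.uncurry (kern g σ u n s))
    (f := fun p : Fin (n + 1) → E d => (p 0, Fin.tail p)) ?_
  unfold Fin.tail
  fun_prop

end Kernels

/-! ### Numerical bounds -/

section Numeric

/-- A sequence that tends to zero faster than every geometric sequence. -/
def superExp (α D : ℝ) (n : ℕ) : ℝ := D * (D * ((n : ℝ) + 1) ^ (-(1 - α))) ^ n

lemma superExp_nonneg {α D : ℝ} (hD : 0 ≤ D) (n : ℕ) : 0 ≤ superExp α D n := by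
  unfold superExp
  positivity

/-- Because α < 1, the base of the n-th power tends to zero, so the terms are eventually below those
of a geometric series. -/
lemma summable_superExp {α D : ℝ} (hα : α < 1) (hD : 0 ≤ D) : Summable (superExp α D) := by
  have h1 : Tendsto (fun n : ℕ => D * ((n : ℝ) + 1) ^ (-(1 - α))) atTop (𝓝 (D * 0)) := by
    refine Tendsto.const_mul _ ?_
    exact (tendsto_rpow_neg_atTop (by linarith)).comp
      (tendsto_atTop_add_const_right _ _ tendsto_natCast_atTop_atTop)
  rw [mul_zero] at h1
  refine Summable.mul_left _ ?_
  refine summable_of_isBigO_nat (g := fun n : ℕ => (1 / 2 : ℝ) ^ n) summable_geometric_two ?_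
  refine Asymptotics.IsBigO.of_bound 1 ?_
  filter_upwards [h1.eventually_le_const (show (0 : ℝ) < 1 / 2 by norm_num)] with n hn
  rw [one_mul, Real.norm_of_nonneg (by positivity), Real.norm_of_nonneg (by positivity)]
  gcongr

lemma doubleFactorial_le (n : ℕ) : (2 * n + 1).doubleFactorial ≤ (2 * (n + 1)) ^ (n + 1) := by
  induction n with
  | zero => simp
  | succ n ih =>
    rw [show 2 * (n + 1) + 1 = (2 * n + 1) + 2 by ring, Nat.doubleFactorial_add_two, pow_succ']
    refine Nat.mul_le_mul (by omega) (ih.trans ?_)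
    exact Nat.pow_le_pow_left (by omega) _

lemma doubleFactorial_le' (n : ℕ) : (2 * n - 1).doubleFactorial ≤ (2 * (n + 1)) ^ (n + 1) := by
  cases n with
  | zero => simp
  | succ n =>
    rw [show 2 * (n + 1) - 1 = 2 * n + 1 by omega]
    refine (doubleFactorial_le n).trans ?_
    exact (Nat.pow_le_pow_left (by omega) _).trans (Nat.pow_le_pow_right (by omega) (by omega))

/-- With f ≤ n + 3 the exponent α f - 2n is at most 3 - (1-α)n - n. The part -n cancels the n^n from
the pairings, and (n+1)^3 ≤ 8^n is absorbed in the constant 32 = 2·2·8. -/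
lemma le_superExp {α L : ℝ} (hα0 : 0 ≤ α) (hα1 : α < 1) (hL : 1 ≤ L) {n f p N : ℕ}
    (hN : N ≤ (2 * (n + 1)) ^ (n + 1)) (hf : f ≤ n + 3) (hp : p ≤ 20 * (n + 1)) :
    N * (L ^ p * ((n : ℝ) + 1) ^ (α * f - 2 * n)) ≤ superExp α (32 * L ^ 20) n := by
  have hn : (1 : ℝ) ≤ n + 1 := by linarith [Nat.cast_nonneg (α := ℝ) n]
  have hn0 : (0 : ℝ) < n + 1 := by linarith
  have h2 : (n : ℝ) + 1 ≤ 2 ^ n := by exact_mod_cast Nat.lt_two_pow_self (n := n)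
  have h1 : ((n : ℝ) + 1) ^ (α * f - 2 * n) ≤
      8 ^ n * (((n : ℝ) + 1) ^ (-(1 - α))) ^ n * (((n : ℝ) + 1) ^ n)⁻¹ := by
    have hf' : (f : ℝ) ≤ n + 3 := by exact_mod_cast hf
    calc ((n : ℝ) + 1) ^ (α * f - 2 * n)
        ≤ ((n : ℝ) + 1) ^ ((3 : ℕ) + (-(1 - α)) * n + -(n : ℝ)) := by
          refine Real.rpow_le_rpow_of_exponent_le hn ?_
          push_cast
          nlinarith [mul_le_mul_of_nonneg_left hf' hα0]
      _ = ((n : ℝ) + 1) ^ 3 * (((n : ℝ) + 1) ^ (-(1 - α))) ^ n * (((n : ℝ) + 1) ^ n)⁻¹ := by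
          rw [Real.rpow_add hn0, Real.rpow_add hn0, Real.rpow_natCast, Real.rpow_mul hn0.le,
            Real.rpow_natCast, Real.rpow_neg hn0.le (n : ℝ), Real.rpow_natCast]
      _ ≤ _ := by
          gcongr
          calc ((n : ℝ) + 1) ^ 3 ≤ (2 ^ n) ^ 3 := by gcongr
            _ = 8 ^ n := by rw [← pow_mul, mul_comm, pow_mul]; norm_num
  have hN' : (N : ℝ) ≤ 2 * (2 ^ n * ((n : ℝ) + 1) ^ n * 2 ^ n) := by
    calc (N : ℝ) ≤ (2 * ((n : ℝ) + 1)) ^ (n + 1) := by exact_mod_cast hN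
      _ = 2 * (2 ^ n * ((n : ℝ) + 1) ^ n * ((n : ℝ) + 1)) := by rw [pow_succ, mul_pow]; ring
      _ ≤ _ := by gcongr
  calc N * (L ^ p * ((n : ℝ) + 1) ^ (α * f - 2 * n))
      ≤ 2 * (2 ^ n * ((n : ℝ) + 1) ^ n * 2 ^ n) * (L ^ (20 * (n + 1)) *
        (8 ^ n * (((n : ℝ) + 1) ^ (-(1 - α))) ^ n * (((n : ℝ) + 1) ^ n)⁻¹)) := by
        gcongr
    _ = 2 * L ^ 20 * (32 * L ^ 20 * ((n : ℝ) + 1) ^ (-(1 - α))) ^ n := by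
        rw [mul_pow (32 * L ^ 20), mul_pow 32, show (32 : ℝ) = 2 * 2 * 8 by norm_num, mul_pow,
          mul_pow]
        field_simp
        ring
    _ ≤ superExp α (32 * L ^ 20) n := by
        unfold superExp
        gcongr
        norm_num

/-- Since f ≤ n + 1, the power n - αf of s is at least -α; s^{-α} is split off and the remaining
power is nonnegative, hence bounded on bounded times. -/
lemma powerDensity_le_of_le {α L s : ℝ} (hα0 : 0 ≤ α) (hα : α < 1) (hL : Real.exp 1 ≤ L)
    (hs : 0 < s) (hsL : s ≤ L) {n f : ℕ} (hf : f ≤ n + 1) :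
    powerDensity ((n + 1 : ℕ) - α * f) s ≤
      ENNReal.ofReal (L ^ (2 * n + 4) * ((n : ℝ) + 1) ^ (α * f - n)) * timeWeight α true s := by
  have hL2 : 2 ≤ L := by linarith [Real.add_one_le_exp 1]
  have hn : (1 : ℝ) ≤ n + 1 := by linarith [Nat.cast_nonneg (α := ℝ) n]
  have hn0 : (0 : ℝ) < n + 1 := by linarith
  have hf' : (f : ℝ) ≤ n + 1 := by exact_mod_cast hf
  have hf0 : (0 : ℝ) ≤ f := Nat.cast_nonneg f
  have ha : 0 < ((n + 1 : ℕ) : ℝ) - α * f := by push_cast; nlinarith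
  rw [timeWeight, if_pos hs, if_pos rfl, ← ENNReal.ofReal_mul (by positivity)]
  refine (powerDensity_le ha hn hs).trans (ENNReal.ofReal_le_ofReal ?_)
  have e1 : ((n + 1 : ℕ) : ℝ) - α * f - 1 = (n + α - α * f) + -α := by push_cast; ring
  have e2 : α * f - n = -(((n + 1 : ℕ) : ℝ) - α * f - 1) := by push_cast; ring
  rw [Real.div_rpow hs.le hn0.le, e2, Real.rpow_neg hn0.le, div_eq_mul_inv]
  have h1 : s ^ (((n + 1 : ℕ) : ℝ) - α * f - 1) ≤ L ^ (n + 1) * s ^ (-α) := by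
    rw [e1, Real.rpow_add hs]
    gcongr
    calc s ^ (n + α - α * f) ≤ L ^ (n + α - α * f) :=
          Real.rpow_le_rpow hs.le hsL (by nlinarith)
      _ ≤ L ^ ((n + 1 : ℕ) : ℝ) :=
          Real.rpow_le_rpow_of_exponent_le (by linarith) (by push_cast; nlinarith)
      _ = L ^ (n + 1) := Real.rpow_natCast _ _
  have h2 : Real.exp (n + 1 + 1) ≤ L ^ (n + 2) := by
    rw [show (n : ℝ) + 1 + 1 = ((n + 2 : ℕ) : ℝ) * 1 by push_cast; ring, Real.exp_nat_mul]
    gcongr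
  calc 2 * Real.exp (n + 1 + 1) * (s ^ (((n + 1 : ℕ) : ℝ) - α * f - 1) *
        (((n : ℝ) + 1) ^ (((n + 1 : ℕ) : ℝ) - α * f - 1))⁻¹)
      ≤ L * L ^ (n + 2) * (L ^ (n + 1) * s ^ (-α) *
        (((n : ℝ) + 1) ^ (((n + 1 : ℕ) : ℝ) - α * f - 1))⁻¹) := by gcongr
    _ = _ := by
        rw [show 2 * n + 4 = 1 + (n + 2) + (n + 1) by ring, pow_add, pow_add, pow_one]
        ring

/-- The two powers of s combine to 2n - α(n+1), which is nonnegative for n ≥ 1. So no singularity at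
s = 0 remains, although each factor alone may have one. -/
lemma powerDensity_mul_le {α L s : ℝ} (hα0 : 0 ≤ α) (hα : α < 1) (hL : Real.exp 1 ≤ L)
    (hs : 0 < s) (hsL : s ≤ L) {n f₁ f₂ : ℕ} (hn1 : 1 ≤ n) (hf : f₁ + f₂ = n + 1) :
    powerDensity ((n + 1 : ℕ) - α * f₁) s * powerDensity ((n + 1 : ℕ) - α * f₂) s ≤
      ENNReal.ofReal (L ^ (4 * n + 6) * ((n : ℝ) + 1) ^ (α * (n + 1 : ℕ) - 2 * n)) := by
  have hL2 : 2 ≤ L := by linarith [Real.add_one_le_exp 1]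
  have hn' : (1 : ℝ) ≤ n := by exact_mod_cast hn1
  have hn : (1 : ℝ) ≤ n + 1 := by linarith
  have hn0 : (0 : ℝ) < n + 1 := by linarith
  have hff : (f₁ : ℝ) + f₂ = n + 1 := by exact_mod_cast hf
  have hf1 : (0 : ℝ) ≤ f₁ := Nat.cast_nonneg _
  have hf2 : (0 : ℝ) ≤ f₂ := Nat.cast_nonneg _
  have ha : ∀ f : ℝ, 0 ≤ f → f ≤ n + 1 → 0 < ((n + 1 : ℕ) : ℝ) - α * f := by
    intro f h0 h1; push_cast; nlinarith
  refine (mul_le_mul' (powerDensity_le (ha _ hf1 (by linarith)) hn hs)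
    (powerDensity_le (ha _ hf2 (by linarith)) hn hs)).trans ?_
  rw [← ENNReal.ofReal_mul (by positivity)]
  refine ENNReal.ofReal_le_ofReal ?_
  have h2 : Real.exp (n + 1 + 1) ≤ L ^ (n + 2) := by
    rw [show (n : ℝ) + 1 + 1 = ((n + 2 : ℕ) : ℝ) * 1 by push_cast; ring, Real.exp_nat_mul]
    gcongr
  have hq : 0 < s / (n + 1) := by positivity
  have h3 : (s / (n + 1)) ^ (((n + 1 : ℕ) : ℝ) - α * f₁ - 1) *
      (s / (n + 1)) ^ (((n + 1 : ℕ) : ℝ) - α * f₂ - 1)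
      ≤ L ^ (2 * n) * ((n : ℝ) + 1) ^ (α * (n + 1 : ℕ) - 2 * n) := by
    have e : ((n + 1 : ℕ) : ℝ) - α * f₁ - 1 + (((n + 1 : ℕ) : ℝ) - α * f₂ - 1) =
        2 * n - α * (n + 1) := by
      rw [← hff]; push_cast; ring
    rw [← Real.rpow_add hq, e, Real.div_rpow hs.le hn0.le, div_eq_mul_inv, ← Real.rpow_neg hn0.le]
    have e' : -(2 * n - α * (n + 1)) = α * (n + 1 : ℕ) - 2 * (n : ℝ) := by push_cast; ring
    rw [e']
    gcongr
    calc s ^ (2 * n - α * (n + 1)) ≤ L ^ (2 * n - α * (n + 1)) :=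
          Real.rpow_le_rpow hs.le hsL (by nlinarith)
      _ ≤ L ^ ((2 * n : ℕ) : ℝ) :=
          Real.rpow_le_rpow_of_exponent_le (by linarith) (by push_cast; nlinarith)
      _ = L ^ (2 * n) := Real.rpow_natCast _ _
  calc _ = 2 * Real.exp (n + 1 + 1) * (2 * Real.exp (n + 1 + 1)) *
        ((s / (n + 1)) ^ (((n + 1 : ℕ) : ℝ) - α * f₁ - 1) *
      (s / (n + 1)) ^ (((n + 1 : ℕ) : ℝ) - α * f₂ - 1)) := by ring
    _ ≤ L * L ^ (n + 2) * (L * L ^ (n + 2)) * (L ^ (2 * n) *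
        ((n : ℝ) + 1) ^ (α * (n + 1 : ℕ) - 2 * n)) := by gcongr
    _ = _ := by
        rw [show 4 * n + 6 = 1 + (n + 2) + 1 + (n + 2) + 2 * n by ring, pow_add, pow_add, pow_add,
          pow_add, pow_one]
        ring

/-- On bounded times the singular weight dominates both weights, so the flag of a single step need
not be tracked. -/
lemma timeWeight_le_of_le {α L r : ℝ} (hα0 : 0 ≤ α) (hα : α < 1) (hL : 1 ≤ L) (hr : r ≤ L)
    (o : Bool) : timeWeight α o r ≤ ENNReal.ofReal L * timeWeight α true r := by
  unfold timeWeight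
  by_cases h0 : 0 < r
  · simp only [if_pos h0, if_true]
    rw [← ENNReal.ofReal_mul (by linarith)]
    cases o
    · simp only [Bool.false_eq_true, if_false]
      rw [← ENNReal.ofReal_one]
      refine ENNReal.ofReal_le_ofReal ?_
      rw [Real.rpow_neg h0.le, ← div_eq_mul_inv, one_le_div (by positivity)]
      calc r ^ α ≤ L ^ α := Real.rpow_le_rpow h0.le hr hα0
        _ ≤ L ^ (1 : ℝ) := Real.rpow_le_rpow_of_exponent_le hL hα.le
        _ = L := Real.rpow_one L
    · simp only [if_true]
      refine ENNReal.ofReal_le_ofReal ?_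
      exact le_mul_of_one_le_left (by positivity) hL
  · simp [h0]

lemma sum_timeExp (α : ℝ) {n : ℕ} (o : Fin n → Bool) :
    ∑ k, timeExp α (o k) = n - α * flagCount o := by
  have h : ∀ k, timeExp α (o k) = 1 - α * ((o k).toNat : ℕ) := by
    intro k
    cases o k <;> simp [timeExp]
  simp only [h, Finset.sum_sub_distrib, ← Finset.mul_sum, flagCount, Nat.cast_sum]
  simp

lemma flagCount_le {n : ℕ} (o : Fin n → Bool) : flagCount o ≤ n := by
  calc flagCount o ≤ ∑ _k : Fin n, 1 := Finset.sum_le_sum fun k _ => Bool.toNat_le _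
    _ = n := by simp

lemma ennreal_le_superExp {α L : ℝ} (hα0 : 0 ≤ α) (hα1 : α < 1)
    (hL : 1 ≤ L) {n f q r N : ℕ}
    (hN : N ≤ (2 * (n + 1)) ^ (n + 1)) (hf : f ≤ n + 3)
    (hp : 2 * n + r + 2 + q ≤ 20 * (n + 1)) {s K A B X : ℝ≥0∞} (hs : s ≤ ENNReal.ofReal L)
    (hK : K ≤ ENNReal.ofReal L) (hA : A ≤ ENNReal.ofReal L)
    (hB : B ≤ ENNReal.ofReal (L ^ q * ((n : ℝ) + 1) ^ (α * f - 2 * n)) * X) :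
    N * ((s ^ n) ^ 2 * (K ^ r * A ^ 2 * B)) ≤
      ENNReal.ofReal (superExp α (32 * L ^ 20) n) * X := by
  have hL0 : 0 ≤ L := by linarith
  calc N * ((s ^ n) ^ 2 * (K ^ r * A ^ 2 * B))
      ≤ N * ((ENNReal.ofReal L ^ n) ^ 2 * (ENNReal.ofReal L ^ r * ENNReal.ofReal L ^ 2 *
          (ENNReal.ofReal (L ^ q * ((n : ℝ) + 1) ^ (α * f - 2 * n)) * X))) := by gcongr
    _ = ENNReal.ofReal (N * (L ^ (2 * n + r + 2 + q) * ((n : ℝ) + 1) ^ (α * f - 2 * n))) * X := by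
        rw [ENNReal.ofReal_mul (by positivity), ENNReal.ofReal_mul (by positivity),
          ENNReal.ofReal_mul (by positivity), ENNReal.ofReal_natCast, ENNReal.ofReal_pow hL0,
          ENNReal.ofReal_pow hL0]
        ring
    _ ≤ _ := by
        gcongr
        exact le_superExp hα0 hα1 hL hN hf hp

end Numeric

/-! ### Superexponential bounds on the Duhamel kernels. -/

section KernelBounds

lemma mul_powerDensity_mul_le {α L s : ℝ} (hα0 : 0 ≤ α) (hα : α < 1) (hL : Real.exp 1 ≤ L)
    (hs : 0 < s) (hsL : s ≤ L) {n f₁ f₂ : ℕ} (h₁ : f₁ ≤ n + 1) (h₂ : f₂ ≤ n + 1)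
    (hf : f₁ + f₂ ≤ n + 3) {c : ℝ≥0∞} (hc : c ≤ ENNReal.ofReal L) :
    (c ^ (n + 1) * powerDensity ((n + 1 : ℕ) - α * f₁) s) *
      (c ^ (n + 1) * powerDensity ((n + 1 : ℕ) - α * f₂) s) ≤
      ENNReal.ofReal (L ^ (6 * n + 10) * ((n : ℝ) + 1) ^ (α * (n + 3 : ℕ) - 2 * n)) *
        timeWeight α true s ^ 2 := by
  have hL0 : 0 ≤ L := by linarith [Real.exp_pos 1]
  have hn : (1 : ℝ) ≤ n + 1 := by linarith [Nat.cast_nonneg (α := ℝ) n]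
  have hn0 : (0 : ℝ) < n + 1 := by linarith
  have hf' : (f₁ : ℝ) + f₂ ≤ (n + 3 : ℕ) := by exact_mod_cast hf
  calc _ ≤ (ENNReal.ofReal L ^ (n + 1) * (ENNReal.ofReal (L ^ (2 * n + 4) *
          ((n : ℝ) + 1) ^ (α * f₁ - n)) * timeWeight α true s)) *
        (ENNReal.ofReal L ^ (n + 1) * (ENNReal.ofReal (L ^ (2 * n + 4) *
          ((n : ℝ) + 1) ^ (α * f₂ - n)) * timeWeight α true s)) := by
        gcongr
        · exact powerDensity_le_of_le hα0 hα hL hs hsL h₁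
        · exact powerDensity_le_of_le hα0 hα hL hs hsL h₂
    _ = ENNReal.ofReal (L ^ (6 * n + 10) *
          (((n : ℝ) + 1) ^ (α * f₁ - n) * ((n : ℝ) + 1) ^ (α * f₂ - n))) *
          timeWeight α true s ^ 2 := by
        rw [ENNReal.ofReal_mul (by positivity), ENNReal.ofReal_mul (by positivity),
          ENNReal.ofReal_mul (by positivity), ENNReal.ofReal_mul (by positivity),
          ENNReal.ofReal_pow hL0, ENNReal.ofReal_pow hL0]
        ring
    _ ≤ _ := by
        gcongr
        rw [← Real.rpow_add hn0]
        refine Real.rpow_le_rpow_of_exponent_le hn ?_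
        nlinarith [mul_le_mul_of_nonneg_left hf' hα0]

variable {d : ℕ} {α : ℝ} {K : ℝ≥0∞} {g : ℝ → E d → E d → ℝ} {σ : ℝ} {u : E d → ℝ}

lemma GreenKernel.exists_common_bound (hg : GreenKernel α K g) (hui : Integrable u) (t : ℝ) :
    ∃ L : ℝ, Real.exp 1 ≤ L ∧ t ≤ L ∧ t⁻¹ ≤ L ∧ ‖σ‖ₑ ≤ ENNReal.ofReal L ∧
      K ≤ ENNReal.ofReal L ∧ ∫⁻ ξ, ‖u ξ‖ₑ ≤ ENNReal.ofReal L ∧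
      (weightConst α : ℝ≥0∞) ≤ ENNReal.ofReal L := by
  have h2 : ∫⁻ ξ, ‖u ξ‖ₑ ≠ ∞ := hui.2.ne
  refine ⟨Real.exp 1 + |t| + |t⁻¹| + |σ| + K.toReal + (∫⁻ ξ, ‖u ξ‖ₑ).toReal + weightConst α,
    ?_, ?_, ?_, ?_, ?_, ?_, ?_⟩
  all_goals
    have a1 := Real.exp_pos 1
    have a2 := abs_nonneg t
    have a3 := abs_nonneg t⁻¹
    have a4 := abs_nonneg σ
    have a5 : 0 ≤ K.toReal := ENNReal.toReal_nonneg
    have a6 : 0 ≤ (∫⁻ ξ, ‖u ξ‖ₑ).toReal := ENNReal.toReal_nonneg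
    have a7 : 0 ≤ (weightConst α : ℝ) := NNReal.coe_nonneg _
    have a8 := le_abs_self t
    have a9 := le_abs_self t⁻¹
  · linarith
  · linarith
  · linarith
  · rw [← ofReal_norm]
    refine ENNReal.ofReal_le_ofReal ?_
    rw [Real.norm_eq_abs]
    linarith
  · rw [ENNReal.le_ofReal_iff_toReal_le hg.ne_top (by positivity)]
    linarith
  · rw [ENNReal.le_ofReal_iff_toReal_le h2 (by positivity)]
    linarith
  · rw [ENNReal.le_ofReal_iff_toReal_le (by simp) (by positivity)]
    simp only [ENNReal.coe_toReal]
    linarith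

/-- Bounds on the norms of the kernels of the Duhamel expansion at fixed times and points. -/
theorem GreenKernel.exists_normSqB_kern_le (hg : GreenKernel α K g) (hu : Measurable u)
    (hui : Integrable u) {t : ℝ} (ht : 0 < t) :
    ∃ D : ℝ, 0 ≤ D ∧ ∀ n x,
      normSqB n (kern g σ u n t x) ≤ ENNReal.ofReal (superExp α D n) := by
  obtain ⟨L, hL, htL, htL', hσ, hK, hA, hC⟩ := hg.exists_common_bound (σ := σ) hui t
  have hL2 : 2 ≤ L := by linarith [Real.add_one_le_exp 1]
  have hL1 : 1 ≤ L := by linarith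
  refine ⟨32 * L ^ 20, by positivity, fun n x => ?_⟩
  have hw : timeWeight α true t ≤ ENNReal.ofReal L := by
    rw [timeWeight, if_pos ht, if_pos rfl]
    refine ENNReal.ofReal_le_ofReal ?_
    rw [Real.rpow_neg ht.le, ← Real.inv_rpow ht.le]
    calc t⁻¹ ^ α ≤ L ^ α := Real.rpow_le_rpow (by positivity) htL' hg.nonneg
      _ ≤ L ^ (1 : ℝ) := Real.rpow_le_rpow_of_exponent_le hL1 hg.lt_one.le
      _ = L := Real.rpow_one L
  have h := normSqB_le_of_pathWeight (ν := volume) hg hu (measurable_gaps t)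
    (lintegral_timeWeight_le hg.lt_one · t)
    -- At a fixed positive time the two weights t^{-α} are bounded by L each, which raises the
    -- exponent 6n + 10 of L by 2.
    (B := ENNReal.ofReal (L ^ (6 * n + 12) * ((n : ℝ) + 1) ^ (α * (n + 3 : ℕ) - 2 * n)) * 1)
    (fun o₁ o₂ ho => by
      rw [sum_timeExp, sum_timeExp]
      refine (mul_powerDensity_mul_le hg.nonneg hg.lt_one hL ht htL (flagCount_le o₁)
        (flagCount_le o₂) (by omega) hC).trans ?_
      calc _ ≤ ENNReal.ofReal (L ^ (6 * n + 10) * ((n : ℝ) + 1) ^ (α * (n + 3 : ℕ) - 2 * n)) *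
            ENNReal.ofReal L ^ 2 := by gcongr
        _ = _ := by
          rw [← ENNReal.ofReal_pow (by linarith), ← ENNReal.ofReal_mul (by positivity), mul_one]
          congr 1
          ring)
    (hg.enorm_kern_le (σ := σ) hu n t x)
  refine h.trans ((ennreal_le_superExp hg.nonneg hg.lt_one hL1 (doubleFactorial_le' n) le_rfl
    (by omega) hσ hK hA le_rfl).trans (mul_one _).le)

/-- Bounds on the norms of the integrands in the recursion for the kernels. -/
theorem GreenKernel.exists_normSqB_stepKern_le (hg : GreenKernel α K g) (hu : Measurable u)
    (hui : Integrable u) (t : ℝ) :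
    ∃ D : ℝ, 0 ≤ D ∧ ∀ n s x, normSqB (n + 1) (stepKern g σ u n t s x) ≤
      ENNReal.ofReal (superExp α D n) * (timeWeight α true (t - s) * timeWeight α true s) ^ 2 := by
  obtain ⟨L, hL, htL, htL', hσ, hK, hA, hC⟩ := hg.exists_common_bound (σ := σ) hui t
  have hL2 : 2 ≤ L := by linarith [Real.add_one_le_exp 1]
  have hL1 : 1 ≤ L := by linarith
  refine ⟨32 * L ^ 20, by positivity, fun n s x => ?_⟩
  by_cases hs : s ∉ Ioo 0 t
  · have : stepKern g σ u n t s x = 0 := by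
      funext y
      exact hg.stepKern_eq_zero n hs x y
    rw [this]
    rw [normSqB_zero]
    exact zero_le
  · rw [not_not] at hs
    -- The first gap t - s is a parameter here. The paths have n + 2 gaps and n + 3 flags in total,
    -- and only the last n + 1 gaps are integrated.
    have h := normSqB_le_of_pathWeight (ν := volume) hg hu (n := n + 1)
      (γ := fun θ : Fin n → ℝ => (Fin.cons (t - s) (gaps s θ) : Fin (n + 2) → ℝ))
      (C := fun o => timeWeight α (o 0) (t - s) * ((weightConst α : ℝ≥0∞) ^ (n + 1) *
        powerDensity (∑ k : Fin (n + 1), timeExp α (o k.succ)) s))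
      (by
        refine measurable_pi_lambda _ fun i => ?_
        refine Fin.cases ?_ (fun j => ?_) i
        · simp only [Fin.cons_zero]; fun_prop
        · simp only [Fin.cons_succ]
          exact (measurable_pi_apply j).comp (measurable_gaps s))
      (fun o => by
        simp only [Fin.prod_univ_succ (n := n + 1), Fin.cons_zero, Fin.cons_succ]
        rw [lintegral_const_mul _ (by fun_prop)]
        exact mul_le_mul_right
          (lintegral_timeWeight_le hg.lt_one (fun k : Fin (n + 1) => o k.succ) s) _)
      (B := ENNReal.ofReal (L ^ (6 * n + 12) * ((n : ℝ) + 1) ^ (α * (n + 3 : ℕ) - 2 * n)) *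
        (timeWeight α true (t - s) * timeWeight α true s) ^ 2)
      (fun o₁ o₂ ho => by
        have hcount : ∀ o : Fin (n + 2) → Bool,
            flagCount (fun k : Fin (n + 1) => o k.succ) ≤ flagCount o := by
          intro o
          unfold flagCount
          rw [Fin.sum_univ_succ (n := n + 1)]
          exact Nat.le_add_left _ _
        have h₁ := hcount o₁
        have h₂ := hcount o₂
        rw [sum_timeExp, sum_timeExp]
        calc _ = (timeWeight α (o₁ 0) (t - s) * timeWeight α (o₂ 0) (t - s)) *
              (((weightConst α : ℝ≥0∞) ^ (n + 1) *
                powerDensity ((n + 1 : ℕ) - α * flagCount fun k : Fin (n + 1) => o₁ k.succ) s) *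
              ((weightConst α : ℝ≥0∞) ^ (n + 1) *
                powerDensity ((n + 1 : ℕ) - α * flagCount fun k : Fin (n + 1) => o₂ k.succ) s)) := by
              ring
          _ ≤ ((ENNReal.ofReal L * timeWeight α true (t - s)) *
                (ENNReal.ofReal L * timeWeight α true (t - s))) *
              (ENNReal.ofReal (L ^ (6 * n + 10) * ((n : ℝ) + 1) ^ (α * (n + 3 : ℕ) - 2 * n)) *
                timeWeight α true s ^ 2) := by
              refine mul_le_mul' (mul_le_mul' ?_ ?_) ?_
              · exact timeWeight_le_of_le hg.nonneg hg.lt_one hL1 (by linarith [hs.1]) _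
              · exact timeWeight_le_of_le hg.nonneg hg.lt_one hL1 (by linarith [hs.1]) _
              · exact mul_powerDensity_mul_le hg.nonneg hg.lt_one hL hs.1 (by linarith [hs.2])
                  (flagCount_le _) (flagCount_le _) (by omega) hC
          _ = _ := by
            rw [show 6 * n + 12 = 2 + (6 * n + 10) by ring, pow_add L 2, mul_assoc (L ^ 2),
              ENNReal.ofReal_mul (by positivity : 0 ≤ L ^ 2), ENNReal.ofReal_pow (by linarith)]
            ring)
      (hg.enorm_stepKern_le (σ := σ) hu n t s x)
    refine h.trans (ennreal_le_superExp hg.nonneg hg.lt_one hL1 ?_ le_rfl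
      (by omega) hσ hK hA le_rfl)
    rw [show 2 * (n + 1) - 1 = 2 * n + 1 by omega]
    exact doubleFactorial_le n

/-- Bounds on the norms of the kernels in `L²(ℝ^d; 𝓑_n)`, uniformly in time. -/
theorem GreenKernel.exists_normSqL2B_kern_le (hg : GreenKernel α K g) (hu : Measurable u)
    (hui : Integrable u) (T : ℝ) :
    ∃ D : ℝ, 0 ≤ D ∧ ∀ n, 1 ≤ n → ∀ t ∈ Ioo 0 T,
      normSqL2B n (kern g σ u n t) ≤ ENNReal.ofReal (superExp α D n) := by
  obtain ⟨L, hL, hTL, -, hσ, hK, hA, hC⟩ := hg.exists_common_bound (σ := σ) hui T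
  have hL2 : 2 ≤ L := by linarith [Real.add_one_le_exp 1]
  have hL1 : 1 ≤ L := by linarith
  refine ⟨32 * L ^ 20, by positivity, fun n hn t ht => ?_⟩
  have h := normSqL2B_le_of_pathWeight (ν := volume) hg hu (measurable_gaps t)
    (lintegral_timeWeight_le hg.lt_one · t)
    -- No power of t is left over: the flags now add up to n + 1, and the bound on the product of
    -- the two densities is uniform in time.
    (B := ENNReal.ofReal (L ^ (6 * n + 8) * ((n : ℝ) + 1) ^ (α * (n + 1 : ℕ) - 2 * n)) * 1)
    (fun o₁ o₂ ho => by
      rw [sum_timeExp, sum_timeExp]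
      calc _ = ((weightConst α : ℝ≥0∞) ^ (n + 1) * (weightConst α : ℝ≥0∞) ^ (n + 1)) *
            (powerDensity ((n + 1 : ℕ) - α * flagCount o₁) t *
              powerDensity ((n + 1 : ℕ) - α * flagCount o₂) t) := by ring
        _ ≤ (ENNReal.ofReal L ^ (n + 1) * ENNReal.ofReal L ^ (n + 1)) *
            ENNReal.ofReal (L ^ (4 * n + 6) * ((n : ℝ) + 1) ^ (α * (n + 1 : ℕ) - 2 * n)) := by
            gcongr
            exact powerDensity_mul_le hg.nonneg hg.lt_one hL ht.1 (by linarith [ht.2]) hn ho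
        _ = _ := by
            rw [← ENNReal.ofReal_pow (by linarith), ← ENNReal.ofReal_mul (by positivity),
              ← ENNReal.ofReal_mul (by positivity), mul_one]
            congr 1
            ring)
    (hg.enorm_kern_le (σ := σ) hu n t)
  refine h.trans ((ennreal_le_superExp hg.nonneg hg.lt_one hL1 (doubleFactorial_le' n)
    (by omega) (by omega) hσ hK hA le_rfl).trans (mul_one _).le)

lemma GreenKernel.lintegral_timeWeight_mul_ne_top (hg : GreenKernel α K g) (t : ℝ) :
    ∫⁻ s, timeWeight α true (t - s) * timeWeight α true s ≠ ∞ := by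
  have h0 : 0 < 1 - α := by linarith [hg.lt_one]
  have h4 := powerDensity_ne_top ((1 - α) + (1 - α)) t
  refine ne_top_of_le_ne_top (b := (weightConst α : ℝ≥0∞) * weightConst α *
    powerDensity ((1 - α) + (1 - α)) t) (by finiteness) ?_
  rw [← lintegral_powerDensity_conv h0 h0, ← lintegral_const_mul _ (by fun_prop)]
  refine lintegral_mono fun s => ?_
  refine (mul_le_mul' (timeWeight_le hg.lt_one _ _) (timeWeight_le hg.lt_one _ _)).trans
    (le_of_eq ?_)
  simp only [timeExp, if_true]
  ring

end KernelBounds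

/-! ### Random fields -/

section Fields

/-- The root halves 1 - α, that is, replaces α by (1+α)/2, which is still below 1. Hence the norms
are summable, and not only their squares. -/
lemma sqrt_superExp {α D : ℝ} (hD : 0 ≤ D) (n : ℕ) :
    ENNReal.ofReal (superExp α D n) ^ (1 / 2 : ℝ) =
      ENNReal.ofReal (superExp ((1 + α) / 2) (√D) n) := by
  have hn0 : (0 : ℝ) ≤ (n : ℝ) + 1 := by positivity
  rw [ENNReal.ofReal_rpow_of_nonneg (superExp_nonneg hD n) (by norm_num), ← Real.sqrt_eq_rpow]
  congr 1
  unfold superExp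
  rw [Real.sqrt_mul hD]
  congr 1
  rw [Real.sqrt_eq_rpow, ← Real.rpow_natCast, ← Real.rpow_mul (by positivity), mul_comm (n : ℝ),
    Real.rpow_mul (by positivity), Real.rpow_natCast, ← Real.sqrt_eq_rpow, Real.sqrt_mul hD,
    Real.sqrt_eq_rpow (_ ^ _), ← Real.rpow_mul hn0]
  congr 4
  ring

variable {d : ℕ} {α : ℝ} {K : ℝ≥0∞} {g : ℝ → E d → E d → ℝ} {σ : ℝ} {u : E d → ℝ}
  {Ω : Type*} [MeasurableSpace Ω] {μ : Measure Ω} [IsProbabilityMeasure μ]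
  {W : L2 d →ₗᵢ[ℝ] Lp ℝ 2 μ}

lemma contB_zero (n : ℕ) : ContB (d := d) n 0 :=
  ⟨continuous_const, by rw [normSqB_zero]; simp⟩

lemma stratLp_zero (hW : IsWhiteNoise W) (n : ℕ) :
    stratLp hW (0 : (Fin n → E d) → ℝ) = 0 := by
  have h1 := enorm_stratLp_le hW (contB_zero (d := d) n)
  rw [normSqB_zero, ENNReal.zero_rpow_of_pos (by norm_num)] at h1
  simpa using h1

lemma GreenKernel.contB_kern (hg : GreenKernel α K g) (hu : Measurable u) (hui : Integrable u)
    (n : ℕ) (t : ℝ) (x : E d) : ContB n (kern g σ u n t x) := by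
  rcases le_or_gt t 0 with ht | ht
  · have : kern g σ u n t x = 0 := funext fun y => hg.kern_eq_zero n ht x y
    rw [this]
    exact contB_zero n
  · obtain ⟨D, -, h⟩ := hg.exists_normSqB_kern_le (σ := σ) hu hui ht
    refine ⟨(hg.continuous_kern hu hui n t).comp (by fun_prop : Continuous fun y => (x, y)), ?_⟩
    exact ne_top_of_le_ne_top ENNReal.ofReal_ne_top (h n x)

lemma GreenKernel.contB_stepKern (hg : GreenKernel α K g) (hu : Measurable u) (hui : Integrable u)
    (n : ℕ) (t s : ℝ) (x : E d) : ContB (n + 1) (stepKern g σ u n t s x) := by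
  obtain ⟨D, -, h⟩ := hg.exists_normSqB_stepKern_le (σ := σ) hu hui t
  refine ⟨hg.continuous_stepKern hu hui n t s x, ?_⟩
  have h1 := timeWeight_ne_top α true (t - s)
  have h2 := timeWeight_ne_top α true s
  exact ne_top_of_le_ne_top (by finiteness) (h n s x)

lemma GreenKernel.exists_norm_stratLp_kern_le (hW : IsWhiteNoise W) (hg : GreenKernel α K g)
    (hu : Measurable u) (hui : Integrable u) (t : ℝ) :
    ∃ b : ℕ → ℝ, Summable b ∧ ∀ n x, ‖stratLp hW (kern g σ u n t x)‖ ≤ b n := by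
  rcases le_or_gt t 0 with ht | ht
  · refine ⟨fun _ => 0, summable_zero, fun n x => ?_⟩
    have : kern g σ u n t x = 0 := funext fun y => hg.kern_eq_zero n ht x y
    have h := enorm_stratLp_le hW (contB_zero (d := d) n)
    rw [normSqB_zero, ENNReal.zero_rpow_of_pos (by norm_num)] at h
    rw [this]
    simpa using h
  · obtain ⟨D, hD, h⟩ := hg.exists_normSqB_kern_le (σ := σ) hu hui ht
    refine ⟨superExp ((1 + α) / 2) (√D),
      summable_superExp (by linarith [hg.lt_one]) (Real.sqrt_nonneg _), fun n x => ?_⟩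
    have h1 := enorm_stratLp_le hW (hg.contB_kern (σ := σ) hu hui n t x)
    have h2 := h1.trans (ENNReal.rpow_le_rpow (h n x) (by norm_num))
    rw [sqrt_superExp hD, ← ofReal_norm] at h2
    exact (ENNReal.ofReal_le_ofReal_iff (superExp_nonneg (Real.sqrt_nonneg _) n)).1 h2

/-- After the root, the singularities in time are (t-s)^{-α} s^{-α}, integrable in s, and they
separate from a factor summable in n. -/
lemma GreenKernel.exists_normSqB_stepKern_sqrt_le (hg : GreenKernel α K g)
    (hu : Measurable u) (hui : Integrable u) (t : ℝ) :
    ∃ b : ℕ → ℝ, Summable b ∧ (∀ n, 0 ≤ b n) ∧ ∀ n s x,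
      normSqB (n + 1) (stepKern g σ u n t s x) ^ (1 / 2 : ℝ)
        ≤ ENNReal.ofReal (b n) * (timeWeight α true (t - s) * timeWeight α true s) := by
  obtain ⟨D, hD, h⟩ := hg.exists_normSqB_stepKern_le (σ := σ) hu hui t
  refine ⟨superExp ((1 + α) / 2) (√D),
    summable_superExp (by linarith [hg.lt_one]) (Real.sqrt_nonneg _),
    superExp_nonneg (Real.sqrt_nonneg _), fun n s x => ?_⟩
  refine (ENNReal.rpow_le_rpow (h n s x) (by norm_num)).trans (le_of_eq ?_)
  rw [ENNReal.mul_rpow_of_nonneg _ _ (by norm_num), sqrt_superExp hD]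
  congr 1
  rw [← ENNReal.rpow_natCast, ← ENNReal.rpow_mul]
  norm_num

lemma GreenKernel.integrable_timeWeight_mul (hg : GreenKernel α K g) (t : ℝ) :
    Integrable fun s => (timeWeight α true (t - s) * timeWeight α true s).toReal :=
  integrable_toReal_of_lintegral_ne_top (by fun_prop) (hg.lintegral_timeWeight_mul_ne_top t)

lemma GreenKernel.norm_stratLp_stepKern_le (hW : IsWhiteNoise W) (hg : GreenKernel α K g)
    (hu : Measurable u) (hui : Integrable u) {b : ℕ → ℝ} {t : ℝ} (hb : ∀ n, 0 ≤ b n)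
    (h : ∀ n s x, normSqB (n + 1) (stepKern g σ u n t s x) ^ (1 / 2 : ℝ)
        ≤ ENNReal.ofReal (b n) * (timeWeight α true (t - s) * timeWeight α true s))
    (n : ℕ) (s : ℝ) (x : E d) : ‖stratLp hW (stepKern g σ u n t s x)‖
      ≤ b n * (timeWeight α true (t - s) * timeWeight α true s).toReal := by
  have h1 := timeWeight_ne_top α true (t - s)
  have h2 := timeWeight_ne_top α true s
  have h3 := (enorm_stratLp_le hW (hg.contB_stepKern (σ := σ) hu hui n t s x)).trans (h n s x)
  have h4 := ENNReal.toReal_mono (by finiteness) h3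
  rwa [toReal_enorm, ENNReal.toReal_mul, ENNReal.toReal_ofReal (hb n)] at h4

lemma GreenKernel.stronglyMeasurable_stepKern (hW : IsWhiteNoise W) (hg : GreenKernel α K g)
    (hu : Measurable u) (hui : Integrable u) (n : ℕ) (t : ℝ) :
    StronglyMeasurable fun p : ℝ × E d => stratLp hW (stepKern g σ u n t p.1 p.2) :=
  stronglyMeasurable_stratLp hW (fun p => hg.contB_stepKern hu hui n t p.1 p.2) fun y =>
    (hg.measurable_stepKern (σ := σ) hu n t).comp
      (g := fun p : ℝ × E d × (Fin (n + 1) → E d) => stepKern g σ u n t p.1 p.2.1 p.2.2)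
      (f := fun p : ℝ × E d => (p.1, p.2, y)) (by fun_prop)

lemma GreenKernel.stronglyMeasurable_kern (hW : IsWhiteNoise W) (hg : GreenKernel α K g)
    (hu : Measurable u) (hui : Integrable u) (n : ℕ) (t : ℝ) :
    StronglyMeasurable fun x => stratLp hW (kern g σ u n t x) :=
  stronglyMeasurable_stratLp hW (fun x => hg.contB_kern hu hui n t x) fun y =>
    (hg.measurable_kern (σ := σ) hu n).comp
      (g := fun p : ℝ × E d × (Fin n → E d) => kern g σ u n p.1 p.2.1 p.2.2)
      (f := fun x : E d => (t, x, y)) (by fun_prop)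

lemma GreenKernel.smul_integral_stratLp_stepKern (hW : IsWhiteNoise W) (hg : GreenKernel α K g)
    (hu : Measurable u) (hui : Integrable u) (n : ℕ) (t : ℝ) (x : E d) :
    σ • ∫ s, stratLp hW (stepKern g σ u n t s x) = stratLp hW (kern g σ u (n + 1) t x) := by
  -- That the time integral without the factor σ is a continuous kernel of finite norm is deduced
  -- from the full kernel by division, so σ = 0 is separate.
  rcases eq_or_ne σ 0 with rfl | hσ
  · have h : kern g 0 u (n + 1) t x = 0 := by
      funext y
      simp [kern_succ]
    have h1 := enorm_stratLp_le hW (contB_zero (d := d) (n + 1))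
    rw [normSqB_zero, ENNReal.zero_rpow_of_pos (by norm_num)] at h1
    have h2 : stratLp hW (0 : (Fin (n + 1) → E d) → ℝ) = 0 := by simpa using h1
    rw [h, h2, zero_smul]
  · obtain ⟨b, -, hb0, hb⟩ := hg.exists_normSqB_stepKern_sqrt_le (σ := σ) hu hui t
    have hC : ContB (n + 1) fun y => ∫ s, stepKern g σ u n t s x y := by
      have h := (hg.contB_kern (σ := σ) hu hui (n + 1) t x).const_mul σ⁻¹
      simpa only [kern_succ, inv_mul_cancel_left₀ hσ] using h
    have h := integral_stratLp hW (ν := volume) (fun s => hg.contB_stepKern (σ := σ) hu hui n t s x)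
      ((hg.measurable_stepKern (σ := σ) hu n t).comp
        (g := fun p : ℝ × E d × (Fin (n + 1) → E d) => stepKern g σ u n t p.1 p.2.1 p.2.2)
        (f := fun q : ℝ × (Fin (n + 1) → E d) => (q.1, x, q.2)) (by fun_prop))
      (hg.integrable_stepBound (σ := σ) hui n t) (fun s y => hg.norm_stepKern_le hu hui n t s x y)
      (by
        have h1 := hg.lintegral_timeWeight_mul_ne_top t
        refine ne_top_of_le_ne_top ?_ (lintegral_mono fun s => hb n s x)
        rw [lintegral_const_mul _ (by fun_prop)]
        finiteness) hC
    rw [← h.2, ← stratLp_const_mul hW hC]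
    rfl

/-- Absolutely convergent expansions into iterated Stratonovich integrals. -/
lemma hasStratSeries_of_summable (hW : IsWhiteNoise W) {f : ∀ n, (Fin n → E d) → ℝ}
    (hf : ∀ n, ContB n (f n)) (hs : Summable fun n => stratLp hW (f n)) {X : Ω → ℝ}
    (hX : X =ᵐ[μ] (∑' n, stratLp hW (f n) : Lp ℝ 2 μ)) : HasStratSeries W f X := by
  refine ⟨(memLp_congr_ae hX).mpr (Lp.memLp _), fun n => stratLp hW (f n),
    fun n => isIteratedIntegral_of_ae_eq hW (hf n) ae_eq_rfl, ?_⟩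
  have h1 : ∀ N, eLpNorm (X - ∑ n ∈ Finset.range N, (stratLp hW (f n) : Ω → ℝ)) 2 μ =
      ‖(∑' n, stratLp hW (f n)) - ∑ n ∈ Finset.range N, stratLp hW (f n)‖ₑ := by
    intro N
    rw [Lp.enorm_def]
    refine eLpNorm_congr_ae ?_
    refine EventuallyEq.trans ?_ (Lp.coeFn_sub _ _).symm
    exact hX.sub (Lp.coeFn_finsetSum _ _).symm
  simp only [h1]
  have h2 := (tendsto_const_nhds (x := ∑' n, stratLp hW (f n))).sub hs.hasSum.tendsto_sum_nat
  rw [sub_self] at h2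
  simpa using h2.enorm

lemma stronglyMeasurable_tsum {X V : Type*} [MeasurableSpace X] [NormedAddCommGroup V]
    {F : ℕ → X → V} (hF : ∀ n, StronglyMeasurable (F n)) (hs : ∀ x, Summable fun n => F n x) :
    StronglyMeasurable fun x => ∑' n, F n x :=
  stronglyMeasurable_of_tendsto atTop
    (fun N => Finset.stronglyMeasurable_fun_sum (Finset.range N) fun n _ => hF n)
    (tendsto_pi_nhds.mpr fun x => (hs x).hasSum.tendsto_sum_nat)

/-- The coefficients `ε` select a part of the expansion: a single index gives the relation between
consecutive terms, and the constant 1 gives the mild equation. -/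
lemma GreenKernel.isStratIntegral (hW : IsWhiteNoise W) (hg : GreenKernel α K g)
    (hu : Measurable u) (hui : Integrable u) {ε : ℕ → ℝ} (hε : ∀ n, |ε n| ≤ 1) {t s : ℝ} {x : E d}
    {v : E d → Ω → ℝ} (hv : ∀ y, v y =ᵐ[μ]
      (∑' n, ε n • stratLp hW (kern g σ u n s y) : Lp ℝ 2 μ))
    (hsum : Summable fun n => ε n • stratLp hW (stepKern g σ u n t s x)) {X : Ω → ℝ}
    (hX : X =ᵐ[μ] (∑' n, ε n • stratLp hW (stepKern g σ u n t s x) : Lp ℝ 2 μ)) :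
    IsStratIntegral W (fun n y z => g (t - s) x y * (ε n * kern g σ u n s y z))
      (fun y ω => g (t - s) x y * v y ω) X := by
  refine ⟨fun n => ?_, ?_, ?_⟩
  · refine ((hg.continuous (t - s)).comp (by fun_prop :
      Continuous fun p : E d × (Fin n → E d) => (x, p.1))).mul ?_
    exact continuous_const.mul (hg.continuous_kern (σ := σ) hu hui n s)
  · refine ae_of_all _ fun y => ?_
    obtain ⟨c, hcs, hc⟩ := hg.exists_norm_stratLp_kern_le (σ := σ) hW hu hui s
    have hk : ∀ n, stratLp hW (fun z => g (t - s) x y * (ε n * kern g σ u n s y z)) =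
        g (t - s) x y • ε n • stratLp hW (kern g σ u n s y) := by
      intro n
      have h1 := hg.contB_kern (σ := σ) hu hui n s y
      rw [stratLp_const_mul hW (h1.const_mul (ε n)), stratLp_const_mul hW h1]
    have hsk : Summable fun n => ε n • stratLp hW (kern g σ u n s y) := by
      refine Summable.of_norm_bounded hcs fun n => ?_
      rw [norm_smul, Real.norm_eq_abs]
      exact (mul_le_mul (hε n) (hc n y) (norm_nonneg _) zero_le_one).trans (one_mul _).le
    refine hasStratSeries_of_summable hW (fun n =>
      ((hg.contB_kern (σ := σ) hu hui n s y).const_mul (ε n)).const_mul _) ?_ ?_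
    · simp only [hk]
      exact hsk.const_smul _
    · simp only [hk]
      rw [tsum_const_smul'']
      refine EventuallyEq.trans ?_ (Lp.coeFn_smul _ _).symm
      filter_upwards [hv y] with ω hω
      simp [hω]
  · have hk : ∀ n, stratLp hW (shift (fun n y z => g (t - s) x y * (ε n * kern g σ u n s y z))
        (n + 1)) = ε n • stratLp hW (stepKern g σ u n t s x) := by
      intro n
      rw [← stratLp_const_mul hW (hg.contB_stepKern (σ := σ) hu hui n t s x)]
      congr 1
      funext y
      simp only [shift, stepKern]
      ring
    have hk0 : stratLp hW (shift (fun n y z => g (t - s) x y * (ε n * kern g σ u n s y z)) 0)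
        = 0 := stratLp_zero hW 0
    have hss : Summable fun n => stratLp hW
        (shift (fun n y z => g (t - s) x y * (ε n * kern g σ u n s y z)) n) := by
      rw [← summable_nat_add_iff 1]
      simp only [hk]
      exact hsum
    refine hasStratSeries_of_summable hW (fun n => ?_) hss ?_
    · cases n with
      | zero => exact contB_zero 0
      | succ n =>
        have h1 := (hg.contB_stepKern (σ := σ) hu hui n t s x).const_mul (ε n)
        have h2 : shift (fun n y z => g (t - s) x y * (ε n * kern g σ u n s y z)) (n + 1) =
            fun y => ε n * stepKern g σ u n t s x y := by
          funext y
          simp only [shift, stepKern]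
          ring
        rw [h2]
        exact h1
    -- The expansion of the integral starts at order one; its term of order zero vanishes.
    · rw [hss.tsum_eq_zero_add, hk0, zero_add]
      simp only [hk]
      exact hX

lemma ae_integral_prod_version {t : ℝ} {Ψ : ℝ × E d → Lp ℝ 2 μ}
    (hΨ : ∀ x, IntegrableOn (fun s => Ψ (s, x)) (Ioo 0 t)) {Z : (ℝ × E d) × Ω → ℝ}
    (hZm : StronglyMeasurable Z) (hZ : ∀ p, (fun ω => Z (p, ω)) =ᵐ[μ] Ψ p)
    {w : E d → Ω → ℝ} (hwm : StronglyMeasurable (Function.uncurry w))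
    (hw : ∀ x, w x =ᵐ[μ] (σ • ∫ s in Ioo 0 t, Ψ (s, x) : Lp ℝ 2 μ)) :
    ∀ᵐ q ∂((volume : Measure (E d)).prod μ),
      IntegrableOn (fun s => Z ((s, q.1), q.2)) (Ioo 0 t) ∧
        w q.1 q.2 = σ * ∫ s in Ioo 0 t, Z ((s, q.1), q.2) := by
  have hZx : ∀ x : E d, StronglyMeasurable fun p : ℝ × Ω => Z ((p.1, x), p.2) := fun x =>
    hZm.comp_measurable (by fun_prop : Measurable fun p : ℝ × Ω => ((p.1, x), p.2))
  -- The identity holds almost surely for each x. Passing to almost every (x,ω) requires the set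
  -- where it holds to be measurable, hence the joint versions.
  rw [Measure.ae_prod_iff_ae_ae]
  · refine ae_of_all _ fun x => ?_
    have h1 := ae_integral_version (ν := volume.restrict (Ioo 0 t))
      (hΨ x) (hZx x) (ae_of_all _ fun s => hZ (s, x))
    filter_upwards [h1, hw x, Lp.coeFn_smul σ (∫ s in Ioo 0 t, Ψ (s, x))] with ω hω hwω hsm
    refine ⟨hω.1, ?_⟩
    rw [hwω, hsm, ← hω.2]
    rfl
  · have hZq : StronglyMeasurable (Function.uncurry fun (q : E d × Ω) (s : ℝ) =>
        Z ((s, q.1), q.2)) :=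
      hZm.comp_measurable (by fun_prop : Measurable fun p : (E d × Ω) × ℝ =>
        ((p.2, p.1.1), p.1.2))
    refine (_root_.measurableSet_integrable (μ := volume.restrict (Ioo 0 t)) hZq).inter ?_
    refine measurableSet_eq_fun hwm.measurable ?_
    exact (hZq.integral_prod_right (ν := volume.restrict (Ioo 0 t))).measurable.const_mul σ

/-- Duhamel's formula for a random field given by a part of the Duhamel expansion. -/
theorem GreenKernel.isDuhamelIntegral (hW : IsWhiteNoise W) (hg : GreenKernel α K g)
    (hu : Measurable u) (hui : Integrable u) {ε : ℕ → ℝ} (hε : ∀ n, |ε n| ≤ 1) {t : ℝ}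
    {v : ℝ → E d → Ω → ℝ} (hv : ∀ s y, v s y =ᵐ[μ]
      (∑' n, ε n • stratLp hW (kern g σ u n s y) : Lp ℝ 2 μ))
    {w : E d → Ω → ℝ} (hwm : StronglyMeasurable (Function.uncurry w))
    (hw : ∀ x, w x =ᵐ[μ] (∑' n, ε n • stratLp hW (kern g σ u (n + 1) t x) : Lp ℝ 2 μ)) :
    IsDuhamelIntegral W g σ (fun n s x y => ε n * kern g σ u n s x y) v t w := by
  obtain ⟨b, hbs, hb0, hb⟩ := hg.exists_normSqB_stepKern_sqrt_le (σ := σ) hu hui t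
  set τ : ℝ → ℝ := fun s => (timeWeight α true (t - s) * timeWeight α true s).toReal with hτ
  have hτ0 : ∀ s, 0 ≤ τ s := fun s => ENNReal.toReal_nonneg
  have hnorm : ∀ n s x, ‖ε n • stratLp hW (stepKern g σ u n t s x)‖ ≤ b n * τ s := by
    intro n s x
    rw [norm_smul, Real.norm_eq_abs]
    calc _ ≤ 1 * (b n * τ s) := mul_le_mul (hε n)
          (hg.norm_stratLp_stepKern_le hW hu hui hb0 hb n s x) (norm_nonneg _) zero_le_one
      _ = _ := one_mul _
  have hsum : ∀ s x, Summable fun n => ε n • stratLp hW (stepKern g σ u n t s x) := fun s x =>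
    Summable.of_norm_bounded (hbs.mul_right (τ s)) fun n => hnorm n s x
  set Ψ : ℝ × E d → Lp ℝ 2 μ := fun p => ∑' n, ε n • stratLp hW (stepKern g σ u n t p.1 p.2)
    with hΨ
  have hterm : ∀ n, StronglyMeasurable fun p : ℝ × E d =>
      ε n • stratLp hW (stepKern g σ u n t p.1 p.2) := fun n =>
    (hg.stronglyMeasurable_stepKern hW hu hui n t).const_smul (ε n)
  have hΨm : StronglyMeasurable Ψ := stronglyMeasurable_tsum hterm fun p => hsum p.1 p.2
  obtain ⟨Z, hZm, hZ⟩ := exists_joint_version hΨm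
  refine ⟨fun s x ω => Z ((s, x), ω), ?_, ?_, ?_⟩
  · refine (hZm.comp_measurable (by fun_prop : Measurable fun q : ℝ × E d × Ω =>
      ((q.1, q.2.1), q.2.2))).aestronglyMeasurable
  · exact ae_of_all _ fun s => ae_of_all _ fun x =>
      hg.isStratIntegral hW hu hui hε (hv s) (hsum s x) (hZ (s, x))
  · have hΨI : ∀ x, Integrable (fun s => Ψ (s, x)) ∧
        σ • ∫ s, Ψ (s, x) = ∑' n, ε n • stratLp hW (kern g σ u (n + 1) t x) := by
      intro x
      have hI : ∀ n, Integrable fun s => ε n • stratLp hW (stepKern g σ u n t s x) := fun n =>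
        ((hg.integrable_timeWeight_mul t).const_mul (b n)).mono'
          ((hterm n).comp_measurable (by fun_prop :
            Measurable fun s : ℝ => (s, x))).aestronglyMeasurable
          (ae_of_all _ fun s => hnorm n s x)
      -- The domination separates into a summable factor in n and an integrable factor in s, so the
      -- sum and the time integral can be exchanged.
      have h1 : HasSum (fun n => ∫ s, ε n • stratLp hW (stepKern g σ u n t s x))
          (∫ s, Ψ (s, x)) := by
        refine hasSum_integral_of_dominated_convergence (fun n s => b n * τ s)
          (fun n => (hI n).1) (fun n => ae_of_all _ fun s => hnorm n s x)
          (ae_of_all _ fun s => hbs.mul_right _) ?_ (ae_of_all _ fun s => (hsum s x).hasSum)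
        simp only [tsum_mul_right]
        exact (hg.integrable_timeWeight_mul t).const_mul _
      refine ⟨?_, ?_⟩
      · refine ((hg.integrable_timeWeight_mul t).const_mul (∑' n, b n)).mono'
          (hΨm.comp_measurable (by fun_prop :
            Measurable fun s : ℝ => (s, x))).aestronglyMeasurable (ae_of_all _ fun s => ?_)
        rw [← tsum_mul_right]
        exact tsum_of_norm_bounded (hbs.mul_right (τ s)).hasSum fun n => hnorm n s x
      · rw [← (h1.const_smul σ).tsum_eq]
        refine tsum_congr fun n => ?_
        rw [integral_smul, smul_comm, hg.smul_integral_stratLp_stepKern hW hu hui n t x]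
    have hoff : ∀ s ∉ Ioo 0 t, ∀ x, Ψ (s, x) = 0 := by
      intro s hs x
      have h1 : τ s = 0 := by
        simp only [hτ, timeWeight]
        rcases le_or_gt s 0 with h | h
        · simp [not_lt.mpr h]
        · have : ¬ 0 < t - s := fun h' => hs ⟨h, by linarith⟩
          simp [this]
      simp only [hΨ]
      refine (tsum_congr fun n => ?_).trans tsum_zero
      have h2 := hnorm n s x
      rw [h1, mul_zero] at h2
      exact norm_le_zero_iff.mp h2
    refine ae_integral_prod_version (fun x => (hΨI x).1.integrableOn) hZm hZ hwm fun x => ?_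
    rw [setIntegral_eq_integral_of_forall_compl_eq_zero (fun s hs => hoff s hs x), (hΨI x).2]
    exact hw x

end Fields

/-! ### The unperturbed flow -/

section FreeFlow

variable {d : ℕ} {α : ℝ} {K : ℝ≥0∞} {g : ℝ → E d → E d → ℝ} {σ : ℝ} {u : E d → ℝ}

lemma eLpNorm_two_sq {X V : Type*} [MeasurableSpace X] [NormedAddCommGroup V] {ν : Measure X}
    (f : X → V) : eLpNorm f 2 ν ^ 2 = ∫⁻ x, ‖f x‖ₑ ^ 2 ∂ν := by
  have h := eLpNorm_nnreal_pow_eq_lintegral (μ := ν) (f := f) (p := 2) (by norm_num)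
  norm_num at h
  simpa only [← ENNReal.rpow_two] using h

/-- The Cauchy–Schwarz inequality for the measure with density `p`; this is the core of Schur's
test. -/
lemma lintegral_mul_sq_le {X : Type*} [MeasurableSpace X] {ν : Measure X} {p q : X → ℝ≥0∞}
    (hp : Measurable p) (hq : Measurable q) :
    (∫⁻ x, p x * q x ∂ν) ^ 2 ≤ (∫⁻ x, p x ∂ν) * ∫⁻ x, p x * q x ^ 2 ∂ν := by
  have h := ENNReal.lintegral_mul_le_Lp_mul_Lq ν (p := 2) (q := 2)
    (by rw [Real.holderConjugate_iff]; norm_num) (f := fun x => p x ^ (1 / 2 : ℝ))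
    (g := fun x => p x ^ (1 / 2 : ℝ) * q x) (hp.pow_const _).aemeasurable
    ((hp.pow_const _).mul hq).aemeasurable
  have e1 : ∀ x, (p x ^ (1 / 2 : ℝ)) * (p x ^ (1 / 2 : ℝ)) = p x := by
    intro x
    rw [← ENNReal.rpow_add_of_nonneg _ _ (by norm_num) (by norm_num)]
    norm_num
  have e2 : ∀ x, (p x ^ (1 / 2 : ℝ)) ^ (2 : ℝ) = p x := by
    intro x
    rw [← ENNReal.rpow_mul]
    norm_num
  have e3 : ∀ a : ℝ≥0∞, (a ^ (1 / 2 : ℝ)) ^ 2 = a := by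
    intro a
    rw [← ENNReal.rpow_two, ← ENNReal.rpow_mul]
    norm_num
  have e4 : ∀ x, (p x ^ (1 / 2 : ℝ) * q x) ^ (2 : ℝ) = p x * q x ^ 2 := by
    intro x
    rw [ENNReal.mul_rpow_of_nonneg _ _ (by norm_num), e2, ENNReal.rpow_two]
  simp only [Pi.mul_apply, ← mul_assoc, e1, e2, e4] at h
  refine (pow_le_pow_left' h 2).trans (le_of_eq ?_)
  rw [mul_pow, e3, e3]

lemma GreenKernel.enorm_kern_zero_le (g : ℝ → E d → E d → ℝ) (σ : ℝ) (u : E d → ℝ) (t : ℝ)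
    (x : E d) (y : Fin 0 → E d) : ‖kern g σ u 0 t x y‖ₑ ≤ absFlow g u t x := by
  refine (enorm_integral_le_lintegral_enorm _).trans (le_of_eq ?_)
  simp [absFlow, enorm_mul]

/-- The bound on the square of the free flow by the mass of the initial datum. -/
lemma GreenKernel.lintegral_absFlow_sq_le (hg : GreenKernel α K g) (hu : Measurable u) (t : ℝ) :
    ∫⁻ x, absFlow g u t x ^ 2 ≤ (K * ∫⁻ ξ, ‖u ξ‖ₑ) ^ 2 *
      (timeWeight α true t * timeWeight α false t) := by
  have hm : Measurable (absFlow g u t) := (hg.measurable_absFlow hu).of_uncurry_left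
  calc _ ≤ ∫⁻ x, K * (∫⁻ ξ, ‖u ξ‖ₑ) * timeWeight α true t * absFlow g u t x := by
        refine lintegral_mono fun x => ?_
        rw [sq]
        exact mul_le_mul_left (hg.absFlow_le _ _) _
    _ ≤ _ := by
        rw [lintegral_const_mul _ hm]
        refine (mul_le_mul_right (hg.lintegral_absFlow_le hu t) _).trans (le_of_eq ?_)
        ring

/-- Schur's bound on the free flow. -/
lemma GreenKernel.lintegral_absFlow_sq_le_schur (hg : GreenKernel α K g) (hu : Measurable u)
    (t : ℝ) : ∫⁻ x, absFlow g u t x ^ 2 ≤ K ^ 2 * ∫⁻ ξ, ‖u ξ‖ₑ ^ 2 := by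
  have hw : timeWeight α false t ≤ 1 := by
    simp only [timeWeight, Bool.false_eq_true, if_false]
    split_ifs <;> simp
  have hmass : ∀ x, ∫⁻ ξ, ‖g t x ξ‖ₑ ≤ K := fun x =>
    (hg.mass_le t x).trans (mul_le_of_le_one_right' hw)
  have hgm : Measurable fun p : E d × E d => ‖g t p.1 p.2‖ₑ := (hg.continuous t).measurable.enorm
  have hm : Measurable fun p : E d × E d => ‖g t p.1 p.2‖ₑ * ‖u p.2‖ₑ ^ 2 :=
    hgm.mul ((hu.comp measurable_snd).enorm.pow_const 2)
  calc _ ≤ ∫⁻ x, K * ∫⁻ ξ, ‖g t x ξ‖ₑ * ‖u ξ‖ₑ ^ 2 := by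
        refine lintegral_mono fun x => ?_
        exact (lintegral_mul_sq_le (p := fun ξ => ‖g t x ξ‖ₑ) (hgm.comp measurable_prodMk_left)
          hu.enorm).trans (mul_le_mul_left (hmass x) _)
    _ = K * ∫⁻ ξ, (∫⁻ x, ‖g t x ξ‖ₑ) * ‖u ξ‖ₑ ^ 2 := by
        rw [lintegral_const_mul _ hm.lintegral_prod_right', lintegral_lintegral_swap hm.aemeasurable]
        congr 1
        refine lintegral_congr fun ξ => ?_
        exact lintegral_mul_const' (‖u ξ‖ₑ ^ 2) (fun x => ‖g t x ξ‖ₑ) (by finiteness)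
    _ ≤ K * ∫⁻ ξ, K * ‖u ξ‖ₑ ^ 2 := by
        gcongr with ξ
        simp only [hg.symm t _ ξ]
        exact hmass ξ
    _ = _ := by
        rw [lintegral_const_mul _ (hu.enorm.pow_const 2)]
        ring

lemma GreenKernel.eLpNorm_kern_zero_le (hg : GreenKernel α K g) (hu : Measurable u) (t : ℝ)
    (y : Fin 0 → E d) : eLpNorm (fun x => kern g σ u 0 t x y) 2 ≤ K * eLpNorm u 2 := by
  refine (ENNReal.pow_le_pow_left_iff two_ne_zero).1 ?_
  rw [mul_pow, eLpNorm_two_sq, eLpNorm_two_sq]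
  refine le_trans (lintegral_mono fun x => ?_) (hg.lintegral_absFlow_sq_le_schur hu t)
  exact pow_le_pow_left' (GreenKernel.enorm_kern_zero_le g σ u t x y) 2

lemma GreenKernel.integrable_mul (hg : GreenKernel α K g) (hui : Integrable u) (t : ℝ) (x : E d) :
    Integrable fun ξ => g t x ξ * u ξ := by
  refine hui.bdd_mul (c := (K * timeWeight α true t).toReal)
    ((hg.continuous t).measurable.of_uncurry_left).aestronglyMeasurable (ae_of_all _ fun ξ => ?_)
  rw [← toReal_enorm]
  exact ENNReal.toReal_mono (ENNReal.mul_ne_top hg.ne_top (timeWeight_ne_top _ _ _))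
    (hg.sup_le _ _ _)

/-- An operator on `L²(ℝ^d)` that is given by a kernel on smooth functions with compact support
is given by the kernel on integrable functions. -/
theorem GreenKernel.coeFn_eq_kern_zero (hg : GreenKernel α K g) (hu : Measurable u)
    (hui : Integrable u) (hu2 : MemLp u 2 volume) (t : ℝ) (S : L2 d →L[ℝ] L2 d)
    (hS : ∀ (φ : E d → ℝ) (hφ : MemLp φ 2 volume), ContDiff ℝ ((⊤ : ℕ∞) : WithTop ℕ∞) φ →
      HasCompactSupport φ → ∀ᵐ x, (S (hφ.toLp φ) : E d → ℝ) x = ∫ y, g t x y * φ y)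
    (y : Fin 0 → E d) :
    (S (hu2.toLp u) : E d → ℝ) =ᵐ[volume] fun x => kern g σ u 0 t x y := by
  have hmk : ∀ v : E d → ℝ, Measurable v → Measurable fun x => kern g σ v 0 t x y := fun v hv =>
    (hg.measurable_kern (σ := σ) hv 0).comp
      (g := fun p : ℝ × E d × (Fin 0 → E d) => kern g σ v 0 p.1 p.2.1 p.2.2)
      (f := fun x : E d => (t, x, y)) (by fun_prop)
  have hz : eLpNorm ((S (hu2.toLp u) : E d → ℝ) - fun x => kern g σ u 0 t x y) 2 = 0 := by
    -- Both sides are bounded operators of the datum in L², the kernel side by Schur's test, and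
    -- they agree on smooth compactly supported functions, which are dense.
    have hbound : ∀ ε : ℝ, 0 < ε →
        eLpNorm ((S (hu2.toLp u) : E d → ℝ) - fun x => kern g σ u 0 t x y) 2 ≤
          (‖S‖ₑ + K) * ENNReal.ofReal ε := by
      intro ε hε
      obtain ⟨φ, hφs, hφc, hφε⟩ := hu2.exist_eLpNorm_sub_le (by norm_num) (by norm_num) hε
      have hφ2 : MemLp φ 2 volume := hφc.continuous.memLp_of_hasCompactSupport hφs
      have hφi : Integrable φ := hφc.continuous.integrable_of_hasCompactSupport hφs
      have hφm : Measurable φ := hφc.continuous.measurable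
      have e1 : (S (hu2.toLp u) : E d → ℝ) - (fun x => kern g σ u 0 t x y) =ᵐ[volume]
          (S (hu2.toLp u) - S (hφ2.toLp φ) : L2 d) - fun x => kern g σ (u - φ) 0 t x y := by
        filter_upwards [hS φ hφ2 hφc hφs, Lp.coeFn_sub (S (hu2.toLp u)) (S (hφ2.toLp φ))]
          with x h1 h2
        have h3 : kern g σ (u - φ) 0 t x y = kern g σ u 0 t x y - ∫ ξ, g t x ξ * φ ξ := by
          simp only [kern, Pi.sub_apply, mul_sub]
          exact integral_sub (hg.integrable_mul hui t x) (hg.integrable_mul hφi t x)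
        simp only [Pi.sub_apply, h2, h1, h3]
        ring
      rw [eLpNorm_congr_ae e1]
      refine (eLpNorm_sub_le (Lp.aestronglyMeasurable _)
        (hmk _ (hu.sub hφm)).aestronglyMeasurable (by norm_num)).trans ?_
      rw [add_mul]
      refine add_le_add ?_ ?_
      · rw [← Lp.enorm_def, ← map_sub, ← MemLp.toLp_sub]
        refine (S.le_opENorm _).trans (mul_le_mul_right ?_ _)
        rwa [Lp.enorm_toLp]
      · exact (hg.eLpNorm_kern_zero_le (hu.sub hφm) t y).trans (mul_le_mul_right hφε _)
    by_contra hne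
    have hC : ‖S‖ₑ + K ≠ ∞ := ENNReal.add_ne_top.mpr ⟨by simp, hg.ne_top⟩
    set a := eLpNorm ((S (hu2.toLp u) : E d → ℝ) - fun x => kern g σ u 0 t x y) 2 with ha
    have hlim : Tendsto (fun ε : ℝ => (‖S‖ₑ + K) * ENNReal.ofReal ε) (𝓝[>] 0) (𝓝 0) := by
      have h0 : Tendsto ENNReal.ofReal (𝓝[>] 0) (𝓝 0) := by
        simpa using (ENNReal.tendsto_ofReal (tendsto_id (x := 𝓝 (0 : ℝ)))).mono_left
          nhdsWithin_le_nhds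
      simpa using ENNReal.Tendsto.const_mul (a := ‖S‖ₑ + K) h0 (Or.inr hC)
    refine hne (le_antisymm (ge_of_tendsto hlim ?_) zero_le)
    filter_upwards [self_mem_nhdsWithin] with ε hε
    exact hbound ε hε
  rw [eLpNorm_eq_zero_iff ((Lp.aestronglyMeasurable _).sub (hmk u hu).aestronglyMeasurable)
    (by norm_num)] at hz
  filter_upwards [hz] with x hx
  exact sub_eq_zero.mp hx

end FreeFlow

/-! ### Versions of random fields in `L²` -/

section Versions

variable {X Ω : Type*} [MeasurableSpace X] [MeasurableSpace Ω] {μ : Measure Ω}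
  [IsProbabilityMeasure μ] {ν : Measure X} [SFinite ν]

lemma eLpNorm_version_sq {φ : X × Ω → ℝ} (hφ : AEStronglyMeasurable φ (ν.prod μ))
    {Φ : X → Lp ℝ 2 μ} (h : ∀ x, (fun ω => φ (x, ω)) =ᵐ[μ] Φ x) :
    eLpNorm φ 2 (ν.prod μ) ^ 2 = ∫⁻ x, ‖Φ x‖ₑ ^ 2 ∂ν := by
  rw [eLpNorm_two_sq, lintegral_prod _ (hφ.enorm.pow_const 2)]
  refine lintegral_congr fun x => ?_
  rw [Lp.enorm_def, ← eLpNorm_congr_ae (h x), eLpNorm_two_sq]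

/-- The norm of the remainder of a series of random fields. -/
lemma eLpNorm_sub_sum_le {φ : ℕ → X × Ω → ℝ} (hφ : ∀ n, StronglyMeasurable (φ n))
    {Φ : ℕ → X → Lp ℝ 2 μ} (hΦm : ∀ n, StronglyMeasurable (Φ n))
    (hΦ : ∀ n x, (fun ω => φ n (x, ω)) =ᵐ[μ] Φ n x) (hs : ∀ x, Summable fun n => Φ n x)
    {ψ : X × Ω → ℝ} (hψ : StronglyMeasurable ψ)
    (hΨ : ∀ x, (fun ω => ψ (x, ω)) =ᵐ[μ] (∑' n, Φ n x : Lp ℝ 2 μ)) (N : ℕ) {c : ℕ → ℝ≥0∞}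
    (hc : ∀ n, N ≤ n → eLpNorm (φ n) 2 (ν.prod μ) ≤ c n) :
    eLpNorm (ψ - ∑ n ∈ Finset.range N, φ n) 2 (ν.prod μ) ≤ ∑' n, c (n + N) := by
  refine (ENNReal.pow_le_pow_left_iff two_ne_zero).1 ?_
  have hsum : ∀ (s : Finset ℕ) (k : ℕ → ℕ) x, (fun ω => (∑ n ∈ s, φ (k n)) (x, ω)) =ᵐ[μ]
      (∑ n ∈ s, Φ (k n) x : Lp ℝ 2 μ) := by
    intro s k x
    refine EventuallyEq.trans ?_ (Lp.coeFn_finsetSum _ _).symm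
    have h1 : ∀ᵐ ω ∂μ, ∀ n ∈ s, φ (k n) (x, ω) = (Φ (k n) x : Ω → ℝ) ω :=
      (ae_ball_iff s.countable_toSet).mpr fun n _ => hΦ (k n) x
    filter_upwards [h1] with ω hω
    simp only [Finset.sum_apply]
    exact Finset.sum_congr rfl hω
  have hsm : ∀ (s : Finset ℕ) (k : ℕ → ℕ), StronglyMeasurable (∑ n ∈ s, φ (k n)) := fun s k =>
    Finset.stronglyMeasurable_sum _ fun n _ => hφ (k n)
  rw [eLpNorm_version_sq (φ := ψ - ∑ n ∈ Finset.range N, φ n)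
    (Φ := fun x => ∑' n, Φ n x - ∑ n ∈ Finset.range N, Φ n x)
    (hψ.sub (hsm _ id)).aestronglyMeasurable (fun x => ?_)]
  · have hlim : ∀ x, Tendsto (fun M => ‖∑ n ∈ Finset.range M, Φ (n + N) x‖ₑ ^ 2) atTop
        (𝓝 (‖∑' n, Φ n x - ∑ n ∈ Finset.range N, Φ n x‖ₑ ^ 2)) := by
      intro x
      have h := ((hasSum_nat_add_iff' N).mpr (hs x).hasSum).tendsto_sum_nat.enorm
      exact ((ENNReal.continuous_pow 2).tendsto _).comp h
    -- Fatou's lemma along the partial sums of the tail reduces the bound to the triangle inequality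
    -- for finitely many terms.
    calc _ = ∫⁻ x, liminf (fun M => ‖∑ n ∈ Finset.range M, Φ (n + N) x‖ₑ ^ 2) atTop ∂ν :=
          lintegral_congr fun x => (hlim x).liminf_eq.symm
      _ ≤ liminf (fun M => ∫⁻ x, ‖∑ n ∈ Finset.range M, Φ (n + N) x‖ₑ ^ 2 ∂ν) atTop := by
          refine lintegral_liminf_le fun M => ?_
          exact ((Finset.stronglyMeasurable_fun_sum _ fun n _ => hΦm (n + N)).enorm).pow_const 2
      _ ≤ liminf (fun _ : ℕ => (∑' n, c (n + N)) ^ 2) atTop := by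
          refine liminf_le_liminf (Eventually.of_forall fun M => ?_)
          rw [← eLpNorm_version_sq (hsm (Finset.range M) fun n => n + N).aestronglyMeasurable
            (hsum _ _)]
          refine pow_le_pow_left' ?_ 2
          refine (eLpNorm_sum_le (fun n _ => (hφ (n + N)).aestronglyMeasurable) (by norm_num)).trans ?_
          refine (Finset.sum_le_sum fun n _ => hc (n + N) (Nat.le_add_left _ _)).trans ?_
          exact ENNReal.sum_le_tsum _
      _ = _ := liminf_const _
  · refine EventuallyEq.trans ?_ (Lp.coeFn_sub _ _).symm
    exact (hΨ x).sub (hsum _ id x)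

end Versions

/-! ### The Green's function of the unperturbed problem -/

section Green

variable {d : ℕ}

/-- The extension of a Green's function by zero to all times. -/
def zeroExtend (I : Set ℝ) (G : ℝ → E d → E d → ℝ) (r : ℝ) (x y : E d) : ℝ :=
  I.indicator (fun r => G r x y) r

lemma zeroExtend_of_mem {I : Set ℝ} (G : ℝ → E d → E d → ℝ) {r : ℝ} (hr : r ∈ I) :
    zeroExtend I G r = G r := by
  funext x y
  exact indicator_of_mem hr _

lemma zeroExtend_of_notMem {I : Set ℝ} (G : ℝ → E d → E d → ℝ) {r : ℝ} (hr : r ∉ I) :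
    zeroExtend I G r = 0 := by
  funext x y
  exact indicator_of_notMem hr _

lemma measurableSet_times (T₀ : EReal) : MeasurableSet (times T₀) :=
  measurableSet_Ioi.inter (measurable_coe_real_ereal measurableSet_Iio)

lemma times_of_le {T₀ : EReal} {s t : ℝ} (ht : t ∈ times T₀) (h0 : 0 < s) (hs : s ≤ t) :
    s ∈ times T₀ :=
  ⟨h0, lt_of_le_of_lt (EReal.coe_le_coe_iff.mpr hs) ht.2⟩

theorem exists_greenKernel {m : ℝ} (hm : (d : ℝ) < m) {T₀ : EReal} {G : ℝ → E d → E d → ℝ}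
    (hGsymm : ∀ t ∈ times T₀, ∀ x y, G t x y = G t y x)
    (hGcont : ContinuousOn (fun p : ℝ × E d × E d => G p.1 p.2.1 p.2.2) (times T₀ ×ˢ univ))
    (hGbound : GreenBounds m (times T₀) G) :
    ∃ K, GreenKernel ((d : ℝ) / m) K (zeroExtend (times T₀) G) := by
  have hd : (0 : ℝ) ≤ d := Nat.cast_nonneg d
  have hm0 : 0 < m := lt_of_le_of_lt hd hm
  -- The constant is the whole sum in `GreenBounds`, and the exponent d/m is below 1 because m > d.
  refine ⟨_, (div_lt_one hm0).mpr hm, div_nonneg hd hm0.le, hGbound.ne, ?_, ?_, ?_, ?_, ?_⟩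
  · classical
    have h := hGcont.measurable_piecewise (g := fun _ => (0 : ℝ)) continuousOn_const
      ((measurableSet_times T₀).prod MeasurableSet.univ)
    convert h using 1
    funext p
    by_cases hp : p.1 ∈ times T₀
    · rw [zeroExtend_of_mem G hp, piecewise_eq_of_mem]
      exact ⟨hp, mem_univ _⟩
    · rw [zeroExtend_of_notMem G hp, piecewise_eq_of_notMem]
      · rfl
      · exact fun h => hp h.1
  · intro r
    by_cases hr : r ∈ times T₀
    · rw [zeroExtend_of_mem G hr]
      exact hGcont.comp_continuous (f := fun p : E d × E d => (r, p.1, p.2)) (by fun_prop)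
        fun p => ⟨hr, mem_univ _⟩
    · rw [zeroExtend_of_notMem G hr]
      exact continuous_const
  · intro r x y
    by_cases hr : r ∈ times T₀
    · rw [zeroExtend_of_mem G hr]
      exact hGsymm r hr x y
    · rw [zeroExtend_of_notMem G hr]
      rfl
  · intro r x
    by_cases hr : r ∈ times T₀
    · rw [zeroExtend_of_mem G hr]
      simp only [timeWeight, if_pos hr.1, Bool.false_eq_true, if_false, mul_one]
      simp only [hGsymm r hr x]
      refine le_trans ?_ (le_self_add.trans le_self_add)
      exact (le_iSup (fun y => ∫⁻ x, ‖G r x y‖ₑ) x).trans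
        (le_iSup₂ (f := fun t (_ : t ∈ times T₀) => ⨆ y, ∫⁻ x, ‖G t x y‖ₑ) r hr)
    · rw [zeroExtend_of_notMem G hr]
      simp
  · intro r x y
    by_cases hr : r ∈ times T₀
    · rw [zeroExtend_of_mem G hr]
      have hr0 : 0 < r := hr.1
      have h1 : ENNReal.ofReal (r ^ ((d : ℝ) / m)) * ‖G r x y‖ₑ ≤
          ⨆ t ∈ times T₀, ⨆ x, ⨆ y, ENNReal.ofReal (t ^ ((d : ℝ) / m)) * ‖G t x y‖ₑ :=
        (le_iSup₂ (f := fun x y => ENNReal.ofReal (r ^ ((d : ℝ) / m)) * ‖G r x y‖ₑ) x y).trans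
          (le_iSup₂ (f := fun t (_ : t ∈ times T₀) => ⨆ x, ⨆ y,
            ENNReal.ofReal (t ^ ((d : ℝ) / m)) * ‖G t x y‖ₑ) r hr)
      have h2 := h1.trans (le_add_self (b := (⨆ t ∈ times T₀, ⨆ y, ∫⁻ x, ‖G t x y‖ₑ)
        + (⨆ t ∈ times T₀, ⨆ y, ENNReal.ofReal (t ^ ((d : ℝ) / m)) * ∫⁻ x, ‖G t x y‖ₑ ^ 2)))
      have h3 : ‖G r x y‖ₑ = ENNReal.ofReal (r ^ ((d : ℝ) / m)) * ‖G r x y‖ₑ *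
          timeWeight ((d : ℝ) / m) true r := by
        simp only [timeWeight, if_pos hr.1, if_true]
        rw [mul_right_comm, ← ENNReal.ofReal_mul (by positivity), ← Real.rpow_add hr0]
        simp
      rw [h3]
      exact mul_le_mul_left h2 _
    · rw [zeroExtend_of_notMem G hr]
      simp

/-- For s in (0,t) both s and t - s are admissible times, and outside (0,t) the integrand built from
the zero extension vanishes. The datum enters through integrals only, so a measurable representative
may be used. -/
lemma duhamelKernel_eq_kern {T₀ : EReal} {G : ℝ → E d → E d → ℝ} {α : ℝ} {K : ℝ≥0∞}
    (hg : GreenKernel α K (zeroExtend (times T₀) G)) (σ : ℝ) {u₀ u : E d → ℝ}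
    (hu : u₀ =ᵐ[volume] u) (n : ℕ) {t : ℝ} (ht : t ∈ times T₀) :
    duhamelKernel G σ u₀ n t = kern (zeroExtend (times T₀) G) σ u n t := by
  induction n generalizing t with
  | zero =>
    funext x _
    simp only [duhamelKernel, kern, freeFlow, zeroExtend_of_mem G ht]
    refine integral_congr_ae ?_
    filter_upwards [hu] with ξ hξ
    rw [hξ]
  | succ n ih =>
    funext x y
    rw [kern_succ, ← setIntegral_eq_integral_of_forall_compl_eq_zero (s := Ioo 0 t)
      fun s hs => hg.stepKern_eq_zero n hs x y]
    simp only [duhamelKernel]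
    rw [intervalIntegral.integral_of_le ht.1.le, integral_Ioc_eq_integral_Ioo]
    congr 1
    refine setIntegral_congr_fun measurableSet_Ioo fun s hs => ?_
    simp only [stepKern]
    rw [ih (times_of_le ht hs.1 hs.2.le), zeroExtend_of_mem G
      (times_of_le ht (sub_pos.mpr hs.2) (by linarith [hs.1]))]

lemma freeFlow_eq_kern {T₀ : EReal} {G : ℝ → E d → E d → ℝ} {α : ℝ} {K : ℝ≥0∞}
    (hg : GreenKernel α K (zeroExtend (times T₀) G)) (σ : ℝ) {u₀ u : E d → ℝ}
    (hu : u₀ =ᵐ[volume] u) {t : ℝ} (ht : t ∈ times T₀) (x : E d) (y : Fin 0 → E d) :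
    freeFlow G u₀ t x = kern (zeroExtend (times T₀) G) σ u 0 t x y := by
  rw [← duhamelKernel_eq_kern hg σ hu 0 ht]
  rfl

lemma IsDuhamelIntegral.congr {Ω : Type*} [MeasurableSpace Ω] {μ : Measure Ω}
    {W : L2 d →ₗᵢ[ℝ] Lp ℝ 2 μ} {G g : ℝ → E d → E d → ℝ} {σ : ℝ}
    {k k' : ∀ n : ℕ, ℝ → E d → (Fin n → E d) → ℝ} {v : ℝ → E d → Ω → ℝ} {t : ℝ}
    {w : E d → Ω → ℝ} (h : IsDuhamelIntegral W g σ k v t w)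
    (hG : ∀ s ∈ Ioo 0 t, g (t - s) = G (t - s)) (hk : ∀ s ∈ Ioo 0 t, ∀ n, k n s = k' n s) :
    IsDuhamelIntegral W G σ k' v t w := by
  obtain ⟨Z, hZm, hZ, hw⟩ := h
  refine ⟨Z, hZm, ?_, hw⟩
  filter_upwards [hZ, ae_restrict_mem measurableSet_Ioo] with s hs hst
  filter_upwards [hs] with x hx
  simpa only [hG s hst, hk s hst] using hx

end Green

/-! ### Norms of the terms of the expansion and of their versions. -/

section Expansion

variable {d : ℕ} {α : ℝ} {K : ℝ≥0∞} {g : ℝ → E d → E d → ℝ} {σ : ℝ} {u : E d → ℝ}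
  {Ω : Type*} [MeasurableSpace Ω] {μ : Measure Ω} [IsProbabilityMeasure μ]
  {W : L2 d →ₗᵢ[ℝ] Lp ℝ 2 μ}

lemma GreenKernel.measurable_kern_apply (hg : GreenKernel α K g) (hu : Measurable u) (n : ℕ)
    (t : ℝ) : Measurable (Function.uncurry (kern g σ u n t)) :=
  (hg.measurable_kern (σ := σ) hu n).comp
    (g := fun p : ℝ × E d × (Fin n → E d) => kern g σ u n p.1 p.2.1 p.2.2)
    (f := fun q : E d × (Fin n → E d) => (t, q.1, q.2)) (by fun_prop)

lemma GreenKernel.measurable_kern_zero (hg : GreenKernel α K g) (hu : Measurable u) (t : ℝ)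
    (y : Fin 0 → E d) : Measurable fun x => kern g σ u 0 t x y :=
  (hg.measurable_kern_apply (σ := σ) hu 0 t).comp
    (g := Function.uncurry (kern g σ u 0 t)) (f := fun x : E d => (x, y)) (by fun_prop)

lemma GreenKernel.summable_stratLp_kern (hW : IsWhiteNoise W) (hg : GreenKernel α K g)
    (hu : Measurable u) (hui : Integrable u) (t : ℝ) (x : E d) :
    Summable fun n => stratLp hW (kern g σ u n t x) := by
  obtain ⟨b, hb, h⟩ := hg.exists_norm_stratLp_kern_le (σ := σ) hW hu hui t
  exact Summable.of_norm_bounded hb fun n => h n x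

/-- Summable bounds on the norms in `L²(ℝ^d; 𝓑_n)`, uniformly in time. -/
lemma GreenKernel.exists_tsum_ne_top (hg : GreenKernel α K g) (hu : Measurable u)
    (hui : Integrable u) (T : ℝ) :
    ∃ c : ℕ → ℝ≥0∞, ∑' n, c n ≠ ∞ ∧ ∀ n, 1 ≤ n → ∀ t ∈ Ioo 0 T,
      normSqL2B n (kern g σ u n t) ^ (1 / 2 : ℝ) ≤ c n := by
  obtain ⟨D, hD, h⟩ := hg.exists_normSqL2B_kern_le (σ := σ) hu hui T
  refine ⟨fun n => ENNReal.ofReal (superExp ((1 + α) / 2) (√D) n), ?_, fun n hn t ht => ?_⟩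
  · exact (summable_superExp (by linarith [hg.lt_one]) (Real.sqrt_nonneg _)).tsum_ofReal_ne_top
  · simp only [← sqrt_superExp hD]
    exact ENNReal.rpow_le_rpow (h n hn t ht) (by norm_num)

lemma GreenKernel.eLpNorm_version_le (hW : IsWhiteNoise W) (hg : GreenKernel α K g)
    (hu : Measurable u) (hui : Integrable u) {n : ℕ} {t : ℝ} {φ : E d × Ω → ℝ}
    (hφm : StronglyMeasurable φ)
    (hφ : ∀ x, (fun ω => φ (x, ω)) =ᵐ[μ] stratLp hW (kern g σ u n t x)) :
    eLpNorm φ 2 (volume.prod μ) ≤ normSqL2B n (kern g σ u n t) ^ (1 / 2 : ℝ) := by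
  refine le_sqrt_of_sq_le ?_
  rw [eLpNorm_version_sq hφm.aestronglyMeasurable hφ]
  exact lintegral_mono fun x => enorm_stratLp_sq_le hW (hg.contB_kern hu hui n t x)

lemma GreenKernel.version_zero_ae_eq (hW : IsWhiteNoise W) (hg : GreenKernel α K g)
    (hu : Measurable u) (hui : Integrable u) {t : ℝ} {φ : E d × Ω → ℝ}
    (hφm : StronglyMeasurable φ)
    (hφ : ∀ x, (fun ω => φ (x, ω)) =ᵐ[μ] stratLp hW (kern g σ u 0 t x)) (y : Fin 0 → E d) :
    ∀ᵐ q ∂((volume : Measure (E d)).prod μ), φ q = kern g σ u 0 t q.1 y := by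
  rw [Measure.ae_prod_iff_ae_ae]
  · refine ae_of_all _ fun x => ?_
    filter_upwards [hφ x, stratLp_zero_ae_eq hW (hg.contB_kern (σ := σ) hu hui 0 t x)] with ω h1 h2
    rw [h1, h2, Subsingleton.elim y 0]
  · exact measurableSet_eq_fun hφm.measurable
      ((hg.measurable_kern_zero (σ := σ) hu t y).comp measurable_fst)

lemma GreenKernel.eLpNorm_version_zero_le (hW : IsWhiteNoise W) (hg : GreenKernel α K g)
    (hu : Measurable u) (hui : Integrable u) {t : ℝ} {φ : E d × Ω → ℝ}
    (hφm : StronglyMeasurable φ)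
    (hφ : ∀ x, (fun ω => φ (x, ω)) =ᵐ[μ] stratLp hW (kern g σ u 0 t x)) :
    eLpNorm φ 2 (volume.prod μ) ≤ K * eLpNorm u 2 := by
  rw [eLpNorm_congr_ae (hg.version_zero_ae_eq hW hu hui hφm hφ 0)]
  refine le_trans (le_of_eq ?_) (hg.eLpNorm_kern_zero_le (σ := σ) hu t 0)
  exact eLpNorm_comp_measurePreserving (g := fun x => kern g σ u 0 t x 0)
    (hg.measurable_kern_zero (σ := σ) hu t 0).aestronglyMeasurable measurePreserving_fst

/-- The free flow of an integrable function, multiplied by a power of time. -/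
lemma GreenKernel.eLpNorm_rpow_mul_kern_zero_le (hg : GreenKernel α K g) (hu : Measurable u)
    {t : ℝ} (ht : 0 < t) (y : Fin 0 → E d) :
    eLpNorm (fun x => t ^ (α / 2) * kern g σ u 0 t x y) 2 ≤ K * ∫⁻ ξ, ‖u ξ‖ₑ := by
  refine (ENNReal.pow_le_pow_left_iff two_ne_zero).1 ?_
  rw [eLpNorm_two_sq]
  -- The square of the prefactor cancels exactly the singularity t^{-α} from the supremum of the
  -- free flow.
  have h1 : ‖t ^ (α / 2)‖ₑ ^ 2 * timeWeight α true t = 1 := by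
    simp only [timeWeight, if_pos ht, if_true]
    rw [← ofReal_norm, Real.norm_of_nonneg (by positivity), ← ENNReal.ofReal_pow (by positivity),
      ← ENNReal.ofReal_mul (by positivity), ← Real.rpow_natCast, ← Real.rpow_mul ht.le,
      ← Real.rpow_add ht]
    norm_num
  calc _ = ‖t ^ (α / 2)‖ₑ ^ 2 * ∫⁻ x, ‖kern g σ u 0 t x y‖ₑ ^ 2 := by
        simp only [enorm_mul, mul_pow]
        exact lintegral_const_mul' _ _ (by finiteness)
    _ ≤ ‖t ^ (α / 2)‖ₑ ^ 2 * ((K * ∫⁻ ξ, ‖u ξ‖ₑ) ^ 2 *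
          (timeWeight α true t * timeWeight α false t)) := by
        refine mul_le_mul_right (le_trans (lintegral_mono fun x => ?_)
          (hg.lintegral_absFlow_sq_le hu t)) _
        exact pow_le_pow_left' (GreenKernel.enorm_kern_zero_le g σ u t x y) 2
    _ = (‖t ^ (α / 2)‖ₑ ^ 2 * timeWeight α true t) * (K * ∫⁻ ξ, ‖u ξ‖ₑ) ^ 2 := by
        have h2 : timeWeight α false t = 1 := by simp [timeWeight, ht]
        rw [h2]
        ring
    _ ≤ _ := by rw [h1, one_mul]

end Expansion

end StratSPDE

end

/-! ### Proof of the theorem. -/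

theorem theorem2p1 {d : ℕ} (hd : 0 < d) (m : ℝ) (hm : (d : ℝ) < m)
    {Ω : Type*} [MeasurableSpace Ω] (μ : Measure Ω) [IsProbabilityMeasure μ]
    (W : L2 d →ₗᵢ[ℝ] Lp ℝ 2 μ) (hW : IsWhiteNoise W)
    (P : L2 d →ₗ.[ℝ] L2 d) (S : ℝ → L2 d →L[ℝ] L2 d) (hS : IsSemigroupOf P S)
    (T₀ : EReal) (G : ℝ → E d → E d → ℝ)
    (hGS : IsKernelOf S (times T₀) G)
    (hGsymm : ∀ t ∈ times T₀, ∀ x y, G t x y = G t y x)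
    (hGcont : ContinuousOn (fun p : ℝ × E d × E d => G p.1 p.2.1 p.2.2) (times T₀ ×ˢ univ))
    (hGbound : GreenBounds m (times T₀) G)
    (σ : ℝ) (u₀ : E d → ℝ) (hu₀ : Integrable u₀) :
    -- for `n ≥ 1` the kernels lie in `L²(ℝ^d; 𝓑_n)`, uniformly in time on bounded intervals
    (∀ n, 1 ≤ n →
      (∀ t ∈ times T₀, MemL2B n (duhamelKernel G σ u₀ n t)) ∧
      ∀ T : ℝ, (T : EReal) ≤ T₀ →
        (⨆ t ∈ Ioo 0 T, normSqL2B n (duhamelKernel G σ u₀ n t)) < ∞) ∧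
    -- the iterated integrals `u_n` of the Duhamel expansion
    (∃ U : ℕ → ℝ → E d → Ω → ℝ,
      (∀ n, ∀ t ∈ times T₀,
        AEStronglyMeasurable (Function.uncurry (U n t)) (volume.prod μ) ∧
        ∀ᵐ x, IsIteratedIntegral W n (duhamelKernel G σ u₀ n t x) (U n t x)) ∧
      (∀ t ∈ times T₀, ∀ᵐ q ∂((volume : Measure (E d)).prod μ),
        U 0 t q.1 q.2 = freeFlow G u₀ t q.1) ∧
      (∀ n, ∀ t ∈ times T₀,
        IsDuhamelIntegral W G σ (Pi.single n (duhamelKernel G σ u₀ n)) (U n) t (U (n + 1) t)) ∧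
      (∀ n, 1 ≤ n → ∀ T : ℝ, (T : EReal) ≤ T₀ →
        (⨆ t ∈ Ioo 0 T, eLpNorm (Function.uncurry (U n t)) 2 (volume.prod μ)) < ∞) ∧
      -- for `u₀ ∈ L¹ ∩ L²` their sum converges and is a mild solution
      ∀ hu₀' : MemLp u₀ 2 volume, ∃ u : ℝ → E d → Ω → ℝ,
        (∀ t ∈ times T₀, MemLp (Function.uncurry (u t)) 2 (volume.prod μ)) ∧
        (∀ T : ℝ, (T : EReal) ≤ T₀ →
          (⨆ t ∈ Ioo 0 T, eLpNorm (Function.uncurry (u t)) 2 (volume.prod μ)) < ∞ ∧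
          Tendsto (fun N : ℕ => ⨆ t ∈ Ioo 0 T,
            eLpNorm (Function.uncurry (u t) - ∑ n ∈ Finset.range N, Function.uncurry (U n t)) 2
              (volume.prod μ)) atTop (𝓝 0)) ∧
        IsMildSolution W S G σ (times T₀) (hu₀'.toLp u₀) (duhamelKernel G σ u₀) u) ∧
    -- for `u₀ ∈ L¹` the deterministic component
    ((∀ t ∈ times T₀, MemLp (fun x => t ^ ((d : ℝ) / (2 * m)) * freeFlow G u₀ t x) 2 volume) ∧
      (⨆ t ∈ times T₀,
        eLpNorm (fun x => t ^ ((d : ℝ) / (2 * m)) * freeFlow G u₀ t x) 2 volume) < ∞) := by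
  obtain ⟨K, hg⟩ := exists_greenKernel hm hGsymm hGcont hGbound
  obtain ⟨u, hu, hue⟩ : ∃ u : E d → ℝ, Measurable u ∧ u₀ =ᵐ[volume] u :=
    ⟨_, hu₀.1.stronglyMeasurable_mk.measurable, hu₀.1.ae_eq_mk⟩
  have hui : Integrable u := hu₀.congr hue
  have hk : ∀ n, ∀ t ∈ times T₀, duhamelKernel G σ u₀ n t =
      kern (zeroExtend (times T₀) G) σ u n t := fun n t ht => duhamelKernel_eq_kern hg σ hue n ht
  have hsub : ∀ T : ℝ, (T : EReal) ≤ T₀ → ∀ t ∈ Ioo 0 T, t ∈ times T₀ := fun T hT t ht =>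
    ⟨ht.1, lt_of_lt_of_le (EReal.coe_lt_coe_iff.mpr ht.2) hT⟩
  refine ⟨fun n hn => ⟨fun t ht => ?_, fun T hT => ?_⟩, ?_, ?_⟩
  · rw [hk n t ht]
    obtain ⟨D, -, hD⟩ := hg.exists_normSqL2B_kern_le (σ := σ) hu hui (t + 1)
    exact ⟨hg.measurable_kern_apply hu n t,
      ae_of_all _ fun x => (hg.contB_kern hu hui n t x).memB hW,
      lt_of_le_of_lt (hD n hn t ⟨ht.1, by linarith⟩) ENNReal.ofReal_lt_top⟩
  · obtain ⟨D, -, hD⟩ := hg.exists_normSqL2B_kern_le (σ := σ) hu hui T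
    refine lt_of_le_of_lt (iSup₂_le fun t ht => ?_) (ENNReal.ofReal_lt_top (r := superExp (d / m) D n))
    rw [hk n t (hsub T hT t ht)]
    exact hD n hn t ht
  · choose φ hφm hφ using fun n t => exists_joint_version
      (hg.stronglyMeasurable_kern (σ := σ) hW hu hui n t)
    have hsum := fun t x => hg.summable_stratLp_kern (σ := σ) hW hu hui t x
    have hstep : ∀ t ∈ times T₀, ∀ s ∈ Ioo 0 t,
        zeroExtend (times T₀) G (t - s) = G (t - s) := fun t ht s hs =>
      zeroExtend_of_mem G (times_of_le ht (sub_pos.mpr hs.2) (by linarith [hs.1]))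
    refine ⟨fun n t x ω => φ n t (x, ω), fun n t ht => ⟨(hφm n t).aestronglyMeasurable, ?_⟩,
      fun t ht => ?_, fun n t ht => ?_, fun n hn T hT => ?_, fun hu₀' => ?_⟩
    · rw [hk n t ht]
      exact ae_of_all _ fun x =>
        isIteratedIntegral_of_ae_eq hW (hg.contB_kern hu hui n t x) (hφ n t x)
    · filter_upwards [hg.version_zero_ae_eq (σ := σ) hW hu hui (hφm 0 t) (hφ 0 t) 0] with q hq
      exact hq.trans (freeFlow_eq_kern hg σ hue ht q.1 0).symm
    -- A single nonzero coefficient reduces the series to its n-th term, so the general Duhamel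
    -- formula gives the relation between `U n` and `U (n + 1)`.
    · have hts : ∀ V : ℕ → Lp ℝ 2 μ, ∑' k, (Pi.single n 1 : ℕ → ℝ) k • V k = V n := by
        intro V
        rw [tsum_eq_single n fun k hkn => by rw [Pi.single_eq_of_ne hkn, zero_smul],
          Pi.single_eq_same, one_smul]
      have h := hg.isDuhamelIntegral (σ := σ) hW hu hui (ε := Pi.single n 1) (fun k => by
          by_cases hkn : k = n
          · subst hkn
            simp
          · simp [hkn]) (t := t)
        (v := fun s y ω => φ n s (y, ω)) (fun s y => by rw [hts]; exact hφ n s y)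
        (w := fun x ω => φ (n + 1) t (x, ω)) (hφm (n + 1) t)
        (fun x => by
          rw [hts fun k => stratLp hW (kern (zeroExtend (times T₀) G) σ u (k + 1) t x)]
          exact hφ (n + 1) t x)
      refine h.congr (hstep t ht) fun s hs k => ?_
      by_cases hkn : k = n
      · subst hkn
        rw [Pi.single_eq_same, Pi.single_eq_same, hk k s (times_of_le ht hs.1 hs.2.le)]
        funext x y
        exact one_mul _
      · rw [Pi.single_eq_of_ne hkn, Pi.single_eq_of_ne hkn]
        funext x y
        exact zero_mul _
    · obtain ⟨c, hc, hcn⟩ := hg.exists_tsum_ne_top (σ := σ) hu hui T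
      refine lt_of_le_of_lt (iSup₂_le fun t ht => ?_) (ENNReal.ne_top_of_tsum_ne_top hc n).lt_top
      exact (hg.eLpNorm_version_le hW hu hui (hφm n t) (hφ n t)).trans (hcn n hn t ht)
    · have hu2 : MemLp u 2 volume := hu₀'.ae_eq hue
      choose ψ hψm hψ using fun t => exists_joint_version
        (stronglyMeasurable_tsum (fun n => hg.stronglyMeasurable_kern (σ := σ) hW hu hui n t)
          (hsum t))
      have hbound : ∀ T : ℝ, ∃ c : ℕ → ℝ≥0∞, ∑' n, c n ≠ ∞ ∧ ∀ N, ∀ t ∈ Ioo 0 T,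
          eLpNorm (ψ t - ∑ n ∈ Finset.range N, φ n t) 2 (volume.prod μ) ≤ ∑' n, c (n + N) := by
        intro T
        obtain ⟨c, hc, hcn⟩ := hg.exists_tsum_ne_top (σ := σ) hu hui T
        -- The kernel bounds control only n ≥ 1 uniformly in time; the term n = 0 is where the datum
        -- in L² is needed, through Schur's test.
        refine ⟨fun n => (if n = 0 then K * eLpNorm u 2 else 0) + c n, ?_, fun N t ht => ?_⟩
        · rw [ENNReal.tsum_add, tsum_ite_eq]
          exact ENNReal.add_ne_top.mpr ⟨ENNReal.mul_ne_top hg.ne_top hu2.2.ne, hc⟩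
        · have hle : ∀ n, N ≤ n → eLpNorm (φ n t) 2 (volume.prod μ) ≤
              (if n = 0 then K * eLpNorm u 2 else 0) + c n := by
            intro n _
            rcases Nat.eq_zero_or_pos n with rfl | hn
            · exact (hg.eLpNorm_version_zero_le hW hu hui (hφm 0 t) (hφ 0 t)).trans (by simp)
            · exact ((hg.eLpNorm_version_le hW hu hui (hφm n t) (hφ n t)).trans
                (hcn n hn t ht)).trans le_add_self
          have hΦ := fun n => hg.stronglyMeasurable_kern (σ := σ) hW hu hui n t
          have h := eLpNorm_sub_sum_le (ν := volume) (fun n => hφm n t) hΦ (fun n => hφ n t)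
            (hsum t) (hψm t) (hψ t) N hle
          exact h
      refine ⟨fun t x ω => ψ t (x, ω), fun t ht => ⟨(hψm t).aestronglyMeasurable, ?_⟩,
        fun T hT => ⟨?_, ?_⟩, fun t ht => ⟨fun x ω => ψ t (x, ω) - φ 0 t (x, ω), ?_, ?_⟩⟩
      · obtain ⟨c, hc, hcn⟩ := hbound (t + 1)
        have h := hcn 0 t ⟨ht.1, by linarith⟩
        rw [Finset.range_zero, Finset.sum_empty, sub_zero] at h
        exact lt_of_le_of_lt h hc.lt_top
      · obtain ⟨c, hc, hcn⟩ := hbound T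
        refine lt_of_le_of_lt (iSup₂_le fun t ht => ?_) hc.lt_top
        have h := hcn 0 t ht
        rwa [Finset.range_zero, Finset.sum_empty, sub_zero] at h
      · obtain ⟨c, hc, hcn⟩ := hbound T
        refine tendsto_of_tendsto_of_tendsto_of_le_of_le tendsto_const_nhds
          (ENNReal.tendsto_sum_nat_add c hc) (fun N => zero_le) fun N => ?_
        exact iSup₂_le fun t ht => hcn N t ht
      · have h := hg.isDuhamelIntegral (σ := σ) hW hu hui (ε := fun _ => 1) (fun _ => by simp)
          (t := t) (v := fun s y ω => ψ s (y, ω))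
          (fun s y => by simp only [one_smul]; exact hψ s y)
          (w := fun x ω => ψ t (x, ω) - φ 0 t (x, ω)) ((hψm t).sub (hφm 0 t))
          (fun x => by
            simp only [one_smul]
            -- Duhamel's formula produces the series from n = 1 on, which is the whole field minus
            -- its deterministic term.
            have e : ∑' n, stratLp hW (kern (zeroExtend (times T₀) G) σ u (n + 1) t x) =
                ∑' n, stratLp hW (kern (zeroExtend (times T₀) G) σ u n t x) -
                  stratLp hW (kern (zeroExtend (times T₀) G) σ u 0 t x) := by
              rw [(hsum t x).tsum_eq_zero_add, add_sub_cancel_left]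
            rw [e]
            exact ((hψ t x).sub (hφ 0 t x)).trans (Lp.coeFn_sub _ _).symm)
        refine h.congr (hstep t ht) fun s hs k => ?_
        rw [hk k s (times_of_le ht hs.1 hs.2.le)]
        funext x y
        exact one_mul _
      · have h1 := hg.coeFn_eq_kern_zero (σ := σ) hu hui hu2 t (S t) (fun φ' hφ' hc hs => by
          rw [zeroExtend_of_mem G ht]
          exact hGS t ht φ' hφ' hc hs) 0
        rw [← MemLp.toLp_congr hu₀' hu2 hue] at h1
        filter_upwards [Measure.quasiMeasurePreserving_fst.ae h1,
          hg.version_zero_ae_eq (σ := σ) hW hu hui (hφm 0 t) (hφ 0 t) 0] with q hq hq0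
        rw [hq]
        change ψ t q = _ + (ψ t q - φ 0 t q)
        rw [hq0]
        ring
  · have hα : (d : ℝ) / (2 * m) = (d : ℝ) / m / 2 := by rw [mul_comm, div_mul_eq_div_div]
    have hf : ∀ t ∈ times T₀, (fun x => t ^ ((d : ℝ) / (2 * m)) * freeFlow G u₀ t x) =
        fun x => t ^ ((d : ℝ) / m / 2) * kern (zeroExtend (times T₀) G) σ u 0 t x 0 := by
      intro t ht
      funext x
      rw [hα, freeFlow_eq_kern hg σ hue ht x 0]
    have hfin : K * ∫⁻ ξ, ‖u ξ‖ₑ < ∞ := ENNReal.mul_lt_top hg.ne_top.lt_top hui.2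
    refine ⟨fun t ht => ?_, lt_of_le_of_lt (iSup₂_le fun t ht => ?_) hfin⟩
    · rw [hf t ht]
      exact ⟨((hg.measurable_kern_zero (σ := σ) hu t 0).const_mul _).aestronglyMeasurable,
        lt_of_le_of_lt (hg.eLpNorm_rpow_mul_kern_zero_le hu ht.1 0) hfin⟩
    · rw [hf t ht]
      exact hg.eLpNorm_rpow_mul_kern_zero_le hu ht.1 0
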